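/- Let $\mathcal T$ be a compact 3-manifold triangulation: a finite collection of tetrahedra $\Delta_1,\dots,\Delta_n$ some of whose $4n$ faces are affinely identified in pairs (two faces of one tetrahedron may be identified), such that the resulting quotient space is a compact 3-manifold, possibly with boundary. The vertices of $\mathcal T$ are the equivalence classes of tetrahedron vertices under these identifications. *Coordinates.* Vectors of $\mathbb R^{7n}$ (standard coordinates) have, for each tetrahedron, four triangle coordinates (one for each vertex of the tetrahedron) and three quadrilateral coordinates (one for each pair of opposite edges, which the quadrilateral separates). Vectors of $\mathbb R^{3n}$ (quadrilateral coordinates) have only the quadrilateral coordinates, and $\pi:\mathbb R^{7n}\to\mathbb R^{3n}$ drops the triangle coordinates. The *standard matching equations* are $t_{i,a}+q_{i,b}=t_{j,c}+q_{j,d}$, one for each non-boundary face $F$ and each edge $e$ of $F$, where $t_{i,a},q_{i,b}$ and $t_{j,c},q_{j,d}$ are the triangle and the quadrilateral coordinate of the types meeting $F$ in an arc parallel to $e$, in the two tetrahedra joined along $F$. The *quadrilateral matching equations* are, for each non-boundary edge $e$, that the sum of the coordinates of the upward quadrilaterals equals the sum of those of the downward ones, over the cycle of tetrahedra around $e$.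 The *quadrilateral constraints* say that in each tetrahedron at most one quadrilateral coordinate is non-zero. A vector is *admissible* if it is non-negative and satisfies the matching equations of its coordinate system and the quadrilateral constraints. The *standard* (resp. *quadrilateral*) *solution set* is the set of those vertices of the polytope of non-negative vectors of coordinate sum $1$ in $\mathbb R^{7n}$ (resp. $\mathbb R^{3n}$) that satisfy the corresponding matching equations, which also satisfy the quadrilateral constraints. The projective image of $\mathbf x$ is $\overline{\mathbf x}=\mathbf x/\sum x_i$ (and $\overline{\mathbf 0}=\mathbf 0$). *Vertex links.* For a vertex $V$ of $\mathcal T$, the vector $\ell(V)\in\mathbb R^{7n}$ has coordinate $1$ at each triangle type surrounding $V$ and $0$ elsewhere. A vector of $\mathbb R^{7n}$ is *canonical* if its triangle coordinates are non-negative but, for every vertex $V$ and every $\epsilon>0$, subtracting $\epsilon\,\ell(V)$ makes some triangle coordinate negative. For admissible $\mathbf q\in\mathbb R^{3n}$, the *canonical extension* $\varepsilon(\mathbf q)$ is the unique admissible canonical vector of $\mathbb R^{7n}$ with $\pi(\varepsilon(\mathbf q))=\mathbf q$. For a vertex $V$ put $\kappa_V(\mathbf w)=\mathbf w-\lambda\,\ell(V)$,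 where $\lambda$ is the largest scalar for which all triangle coordinates of $\mathbf w-\lambda\,\ell(V)$ around $V$ are non-negative. *Algorithm.* Let $V_1,\dots,V_m$ be the vertices of $\mathcal T$ in any order and let $\mathbf q_1,\dots,\mathbf q_k$ be the quadrilateral solution set, listed without repetition. Put $L_0=(\varepsilon(\mathbf q_1),\dots,\varepsilon(\mathbf q_k))$ and let $C$ be the set of all quadrilateral coordinate positions. For $r=1,\dots,m$: (a) insert $\kappa_{V_r}(\mathbf x)$ into $L_r$ for each $\mathbf x\in L_{r-1}$; (b) insert $-\ell(V_r)$ into $L_r$; (c) for each position $p$ with $\ell(V_r)_p\neq 0$, in any order: let $S_0,S_+,S_-$ be the lists of those $\mathbf x\in L_r$ with $x_p=0$, $x_p>0$, $x_p<0$ respectively, and replace $L_r$ by $S_0$ and $S_+$ together with the vectors $(u_p\mathbf w-w_p\mathbf u)/(u_p-w_p)$ for all pairs $\mathbf u\in S_+$, $\mathbf w\in S_-$ such that (1) in each tetrahedron at least two of the three quadrilateral coordinates are zero in both $\mathbf u$ and $\mathbf w$, and (2) no $\mathbf z$ in the old list $L_r$ other than $\mathbf u,\mathbf w$ has $z_i=0$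 for all $i\in C$ with $u_i=w_i=0$; then insert $p$ into $C$; (d) insert $\ell(V_r)$ into $L_r$. *Claim.* The canonical extensions $\varepsilon(\mathbf q_i)$ exist and are unique; no list $L_0,\dots,L_m$ contains a duplicate (although duplicates are never tested for); at the end $C$ consists of all $7n$ coordinate positions; and, if the final list $L_m$ consists of $\mathbf v_1,\dots,\mathbf v_{k'}$, then the projective images $\overline{\mathbf v_1},\dots,\overline{\mathbf v_{k'}}$ are pairwise distinct and form exactly the standard solution set of $\mathcal T$. -/

import Mathlib

/-- A finite collection of `n` tetrahedra with some of their `4n` faces identified in pairs.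
The vertices of each tetrahedron are `0, 1, 2, 3`, and face `f` is the face opposite vertex `f`.
`glue i f = some (j, g)` says that face `f` of tetrahedron `i` is identified with face `g f` of
tetrahedron `j` by the affine map sending each vertex `v ≠ f` of the former to the vertex `g v` of
the latter; `glue i f = none` says that face `f` of tetrahedron `i` is a boundary face. -/
structure FaceGluing (n : ℕ) where
  glue : Fin n → Fin 4 → Option (Fin n × Equiv.Perm (Fin 4))
  glue_symm : ∀ i f j g, glue i f = some (j, g) → glue j (g f) = some (i, g.symm)
  glue_ne_self : ∀ i f j g, glue i f = some (j, g) → (j, g f) ≠ (i, f)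

/-- A compact topological 3-manifold, possibly with boundary (not necessarily connected). -/
structure IsCompactThreeManifold (X : Type*) [TopologicalSpace X] : Prop where
  compact : CompactSpace X
  hausdorff : T2Space X
  secondCountable : SecondCountableTopology X
  locallyHalfSpace : ∀ x : X, ∃ e : OpenPartialHomeomorph X (EuclideanHalfSpace 3), x ∈ e.source

/-- The coordinate positions of the `7n`-dimensional standard coordinates: position
`(i, Sum.inl v)` is the triangle type of tetrahedron `i` surrounding its vertex `v`, and
`(i, Sum.inr k)` is its `k`-th quadrilateral type. -/
abbrev StdCoord (n : ℕ) := Fin n × (Fin 4 ⊕ Fin 3)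

/-- The coordinate positions of the `3n`-dimensional quadrilateral coordinates. -/
abbrev QuadCoord (n : ℕ) := Fin n × Fin 3

abbrev StdVec (n : ℕ) := StdCoord n → ℝ

abbrev QuadVec (n : ℕ) := QuadCoord n → ℝ

/-- For distinct vertices `a, b` of a tetrahedron, the quadrilateral type that separates the edge
`ab` from the opposite edge: type `0` separates `01` from `23`, type `1` separates `02` from `13`,
and type `2` separates `03` from `12`.  (The entries with `a = b` are never used.) -/
def quadSeparating (a b : Fin 4) : Fin 3 :=
  (![![0, 0, 1, 2], ![0, 0, 2, 1], ![1, 2, 0, 0], ![2, 1, 0, 0]] : Fin 4 → Fin 4 → Fin 3) a b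

/-- The projective image `x / ∑ xᵢ`; it sends the zero vector to the zero vector. -/
noncomputable def projImage {ι : Type*} [Fintype ι] (x : ι → ℝ) : ι → ℝ :=
  (∑ i, x i)⁻¹ • x

/-- The quadrilateral projection `π : ℝ⁷ⁿ → ℝ³ⁿ`. -/
def quadProj {n : ℕ} (w : StdVec n) : QuadVec n := fun p => w (p.1, Sum.inr p.2)

/-- The quadrilateral constraints: in each tetrahedron at most one quadrilateral coordinate is
non-zero. -/
def QuadConstraints {n : ℕ} (q : QuadVec n) : Prop :=
  ∀ i k k', q (i, k) ≠ 0 → q (i, k') ≠ 0 → k = k'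

/-- `u` and `w` together satisfy the quadrilateral constraints: in each tetrahedron at least two of
the three quadrilateral coordinates are zero in both `u` and `w`. -/
def QuadCompatible {n : ℕ} (u w : StdVec n) : Prop :=
  ∀ i, ∃ k k' : Fin 3, k ≠ k' ∧
    (u (i, Sum.inr k) = 0 ∧ w (i, Sum.inr k) = 0) ∧
    (u (i, Sum.inr k') = 0 ∧ w (i, Sum.inr k') = 0)

/-- The set of all quadrilateral coordinate positions. -/
def quadPositions (n : ℕ) : Set (StdCoord n) := {p | ∃ i k, p = (i, Sum.inr k)}

namespace FaceGluing

variable {n : ℕ}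

/-- Elementary identifications between points of the tetrahedra (each tetrahedron is a standard
simplex, with points given by barycentric coordinates). -/
def PointIdent (T : FaceGluing n) (p p' : Fin n × stdSimplex ℝ (Fin 4)) : Prop :=
  ∃ f g, T.glue p.1 f = some (p'.1, g) ∧ p.2.1 f = 0 ∧ ∀ v, p'.2.1 (g v) = p.2.1 v

/-- The topological space obtained by gluing the tetrahedra: the quotient of their disjoint union
by the equivalence relation generated by the face identifications. -/
abbrev Realization (T : FaceGluing n) : Type := Quot T.PointIdent

/-- The resulting space is a compact 3-manifold. -/
def IsCompactThreeManifoldTriangulation (T : FaceGluing n) : Prop :=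
  IsCompactThreeManifold T.Realization

/-- Elementary identifications between vertices of tetrahedra. -/
def VertexIdent (T : FaceGluing n) (c c' : Fin n × Fin 4) : Prop :=
  ∃ f g, T.glue c.1 f = some (c'.1, g) ∧ c.2 ≠ f ∧ c'.2 = g c.2

/-- A vertex of the triangulation: an equivalence class of vertices of tetrahedra. -/
abbrev Vertex (T : FaceGluing n) : Type := Quot T.VertexIdent

open Classical in
/-- The vertex link `ℓ(V)`: one copy of each triangle type surrounding `V`, and nothing else. -/
noncomputable def vertexLink (T : FaceGluing n) (V : T.Vertex) : StdVec n
  | (i, Sum.inl v) => if (Quot.mk _ (i, v) : T.Vertex) = V then 1 else 0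
  | (_, Sum.inr _) => 0

/-- The standard matching equations.  Let face `f` of tetrahedron `i` be glued to a face of `j`
and let `v` be a vertex of this face.  The normal arcs in the face that are parallel to its edge
opposite `v` come, in tetrahedron `i`, from the triangles around `v` and the quadrilaterals that
separate the edge `vf` from its opposite edge; similarly in tetrahedron `j`. -/
def StdMatching (T : FaceGluing n) (w : StdVec n) : Prop :=
  ∀ i f j g, T.glue i f = some (j, g) → ∀ v, v ≠ f →
    w (i, Sum.inl v) + w (i, Sum.inr (quadSeparating v f)) =
      w (j, Sum.inl (g v)) + w (j, Sum.inr (quadSeparating (g v) (g f)))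

/-- A pair `(i, σ)` encodes a visit to tetrahedron `i` while walking around the edge with lower end
`σ 0` and upper end `σ 1`: we enter through the face containing `σ 2` (the face opposite `σ 3`) and
leave through the face containing `σ 3` (the face opposite `σ 2`).  `EdgeStep` relates such a visit
to the next one. -/
def EdgeStep (T : FaceGluing n) (φ ψ : Fin n × Equiv.Perm (Fin 4)) : Prop :=
  ∃ g, T.glue φ.1 (φ.2 2) = some (ψ.1, g) ∧
    ψ.2 0 = g (φ.2 0) ∧ ψ.2 1 = g (φ.2 1) ∧ ψ.2 2 = g (φ.2 3) ∧ ψ.2 3 = g (φ.2 2)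

/-- The quadrilateral matching equations.  The tetrahedra around a non-boundary edge form a cycle
`c` (closed under `finRotate k`, which sends `j` to `j + 1` modulo `k`); the sum of the coordinates
of the quadrilaterals that rise in one direction around the cycle (those separating `σ 0, σ 2` from
`σ 1, σ 3`) equals the sum for those rising in the other direction (those separating `σ 0, σ 3`
from `σ 1, σ 2`).  Around a boundary edge there are no such cycles. -/
def QuadMatching (T : FaceGluing n) (q : QuadVec n) : Prop :=
  ∀ (k : ℕ) (c : Fin k → Fin n × Equiv.Perm (Fin 4)), Function.Injective c →
    (∀ j, T.EdgeStep (c j) (c (finRotate k j))) →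
    ∑ j, q ((c j).1, quadSeparating ((c j).2 0) ((c j).2 2)) =
      ∑ j, q ((c j).1, quadSeparating ((c j).2 0) ((c j).2 3))

/-- Admissible vectors in standard coordinates. -/
def StdAdmissible (T : FaceGluing n) (w : StdVec n) : Prop :=
  (∀ p, 0 ≤ w p) ∧ T.StdMatching w ∧ QuadConstraints (quadProj w)

/-- The standard projective solution space; `stdSimplex ℝ ι` is the set of non-negative vectors
whose coordinates sum to 1. -/
def stdSolutionSpace (T : FaceGluing n) : Set (StdVec n) :=
  {w | w ∈ stdSimplex ℝ (StdCoord n) ∧ T.StdMatching w}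

/-- The quadrilateral projective solution space. -/
def quadSolutionSpace (T : FaceGluing n) : Set (QuadVec n) :=
  {q | q ∈ stdSimplex ℝ (QuadCoord n) ∧ T.QuadMatching q}

/-- The standard solution set: all vertices of the standard projective solution space that satisfy
the quadrilateral constraints. -/
def stdSolutionSet (T : FaceGluing n) : Set (StdVec n) :=
  {w | w ∈ T.stdSolutionSpace.extremePoints ℝ ∧ QuadConstraints (quadProj w)}

/-- The quadrilateral solution set: all vertices of the quadrilateral projective solution space
that satisfy the quadrilateral constraints. -/
def quadSolutionSet (T : FaceGluing n) : Set (QuadVec n) :=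
  {q | q ∈ T.quadSolutionSpace.extremePoints ℝ ∧ QuadConstraints q}

/-- Canonical vectors: all triangular coordinates are non-negative, but subtracting any positive
multiple of any vertex link makes some triangular coordinate negative. -/
def Canonical (T : FaceGluing n) (w : StdVec n) : Prop :=
  (∀ i v, 0 ≤ w (i, Sum.inl v)) ∧
    ∀ (V : T.Vertex) (ε : ℝ), 0 < ε → ∃ i v, (w - ε • T.vertexLink V) (i, Sum.inl v) < 0

/-- `x` is an admissible canonical vector in standard coordinates with quadrilateral projection
`q`. -/
def IsCanonicalExtension (T : FaceGluing n) (q : QuadVec n) (x : StdVec n) : Prop :=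
  T.StdAdmissible x ∧ T.Canonical x ∧ quadProj x = q

/-- The canonical extension `ε(q)`: the unique admissible canonical vector in standard coordinates
whose quadrilateral projection is `q`. -/
noncomputable def canonicalExtension (T : FaceGluing n) (q : QuadVec n) : StdVec n :=
  Classical.epsilon (T.IsCanonicalExtension q)

/-- The partial canonical part of `w` at the vertex `V`: the vector `w - λ ℓ(V)`, where `λ` is the
largest scalar for which all coordinates of `w - λ ℓ(V)` that correspond to triangle types
surrounding `V` are non-negative. -/
noncomputable def partialCanonicalPart (T : FaceGluing n) (V : T.Vertex) (w : StdVec n) :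
    StdVec n :=
  w - sSup {l : ℝ | ∀ p, T.vertexLink V p ≠ 0 → 0 ≤ (w - l • T.vertexLink V) p} • T.vertexLink V

end FaceGluing

/-- The two conditions under which a pair `u ∈ S₊`, `w ∈ S₋` is processed, for the current list `L`
and the current set `C` of coordinate positions. -/
def PairCondition {n : ℕ} (C : Set (StdCoord n)) (L : List (StdVec n)) (u w : StdVec n) : Prop :=
  QuadCompatible u w ∧
    ¬ ∃ z ∈ L, z ≠ u ∧ z ≠ w ∧ ∀ i ∈ C, u i = 0 → w i = 0 → z i = 0

open Classical in
/-- Processing one coordinate position `p`: the list `L` is replaced by `S₀ ∪ S₊` together with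
the points where the segments `uw` meet `x p = 0`, over all pairs `u ∈ S₊`, `w ∈ S₋` that satisfy
both conditions, and then `p` is inserted into `C`. -/
noncomputable def processPosition {n : ℕ} (s : Set (StdCoord n) × List (StdVec n))
    (p : StdCoord n) : Set (StdCoord n) × List (StdVec n) :=
  let C := s.1
  let L := s.2
  let S0 := L.filter (fun x => x p = 0)
  let Spos := L.filter (fun x => 0 < x p)
  let Sneg := L.filter (fun x => x p < 0)
  let pairs := (Spos.product Sneg).filter (fun uw => PairCondition C L uw.1 uw.2)
  let new := pairs.map (fun uw => (uw.1 p - uw.2 p)⁻¹ • (uw.1 p • uw.2 - uw.2 p • uw.1))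
  (insert p C, S0 ++ Spos ++ new)

namespace FaceGluing

variable {n : ℕ}

/-- Processing one vertex `V`, whose triangular coordinate positions are listed, in the order in
which they are to be processed, by `ps`. -/
noncomputable def processVertex (T : FaceGluing n) (V : T.Vertex) (ps : List (StdCoord n))
    (s : Set (StdCoord n) × List (StdVec n)) : Set (StdCoord n) × List (StdVec n) :=
  let start := s.2.map (T.partialCanonicalPart V) ++ [-T.vertexLink V]
  let s' := ps.foldl processPosition (s.1, start)
  (s'.1, s'.2 ++ [T.vertexLink V])

/-- The state (coordinate set and list) of the quadrilateral-to-standard conversion algorithm on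
the input list `Q` after processing the vertices in the list `Vs` in this order, where the
positions in the link of `V` are processed in the order `pos V`. -/
noncomputable def quadToStd (T : FaceGluing n) (Q : List (QuadVec n))
    (pos : T.Vertex → List (StdCoord n)) (Vs : List T.Vertex) :
    Set (StdCoord n) × List (StdVec n) :=
  Vs.foldl (fun s V => T.processVertex V (pos V) s)
    (quadPositions n, Q.map T.canonicalExtension)

end FaceGluing

/-! The proof has a topological half and a convex-geometric half.

Topology. Every solution of the quadrilateral matching equations extends to a solution of the
standard ones (`QuadMatching.exists_stdMatching`). For fixed quadrilateral coordinates the standard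
equations prescribe the jump of the triangle coordinates across each edge of a vertex link, so a
potential for these jumps is wanted. The quadrilateral equations say that the jumps cancel around
each interior vertex of the link, which gives a potential on the corners of the link triangles
(`QuadMatching.exists_cornerPotential`). If the jumps are integers, affine interpolation of the
corner values modulo 1 is a continuous circle-valued map on a punctured neighbourhood of the vertex.
In a 3-manifold such maps lift to the reals on suitable small punctured neighbourhoods. The lift
differs from the interpolation by a constant on each link triangle, and these constants give the
potential (`exists_potential_at_vertex`). Real solutions are combinations of rational ones.
Subtracting minimal multiples of vertex links then gives canonical extensions.

Convexity. For a subspace `W` and a set `C` of positions, consider the cone of vectors of `W` that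
are non-negative on `C`, modulo vectors vanishing on `C`. Its extreme rays are the vectors of
minimal support (`IsExtremeOn`). With `C` the quadrilateral positions these are the quadrilateral
vertices; with `C` everything they are the standard vertices. The claim is that after each vertex
the list represents each extreme ray satisfying the quadrilateral constraints exactly once
(`IsExtremeList`). Adding one position is the double description step (`IsExtremeOn.of_insert`,
`isExtremeOn_hyperplanePoint`). The constraints pass to every vector of smaller support, so
filtering by them loses nothing.

The difficulty is that while a vertex is processed its link `ℓ` is an extreme ray missing from the
list, whereas the shifted initial vectors `K` stay in the list although they need not be extreme
yet. The invariant is `IsPhaseList`: the list contains representatives of all constrained extreme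
rays except `ℓ`, together with all of `K`. A member of `K` can replace `ℓ` in a pair, since it lies
in the face spanned by `ℓ` and its partner (`IsPhaseList.complete_processPosition`). At the end
every member of `K` has a zero around the vertex and is therefore extreme. -/

/-! ### Lifting circle-valued maps on punctured balls and half-balls. -/

/-- Contracting `S` to `c` along segments turns `F` into a homotopy that starts at a constant map.
Lift the homotopy from a constant and evaluate at time 1. -/
theorem StarConvex.exists_addCircle_lift {E : Type*} [AddCommGroup E] [Module ℝ E]
    [TopologicalSpace E] [ContinuousAdd E] [ContinuousSMul ℝ E] {S : Set E} {c : E}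
    (hS : StarConvex ℝ c S) {F : E → AddCircle (1 : ℝ)} (hF : ContinuousOn F S) :
    ∃ G : E → ℝ, ContinuousOn G S ∧ ∀ x ∈ S, (G x : AddCircle (1 : ℝ)) = F x := by
  classical
  have cov : IsCoveringMap ((↑) : ℝ → AddCircle (1 : ℝ)) := AddCircle.isCoveringMap_coe 1
  obtain ⟨b, hb⟩ : ∃ b : ℝ, (b : AddCircle (1 : ℝ)) = F c := QuotientAddGroup.mk_surjective _
  have hmem : ∀ q : unitInterval × S, (1 - (q.1 : ℝ)) • c + (q.1 : ℝ) • (q.2 : E) ∈ S := fun q =>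
    hS q.2.2 (by linarith [q.1.2.2]) q.1.2.1 (by ring)
  let H : C(unitInterval × S, AddCircle (1 : ℝ)) :=
    ⟨fun q => F ((1 - (q.1 : ℝ)) • c + (q.1 : ℝ) • (q.2 : E)), by
      refine hF.comp_continuous ?_ hmem
      fun_prop⟩
  let f : C(S, ℝ) := ContinuousMap.const S b
  have H0 : ∀ a, H (0, a) = ((f a : ℝ) : AddCircle (1 : ℝ)) := by
    intro a
    simp [H, f, hb]
  let G := cov.liftHomotopy H f H0
  have hG : ∀ q, ((G q : ℝ) : AddCircle (1 : ℝ)) = H q := fun q =>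
    congrFun (cov.liftHomotopy_lifts H f H0) q
  refine ⟨fun x => if h : x ∈ S then G (1, ⟨x, h⟩) else 0, ?_, ?_⟩
  · rw [continuousOn_iff_continuous_domRestrict]
    have : S.domRestrict (fun x => if h : x ∈ S then G (1, ⟨x, h⟩) else 0) =
        fun x : S => G (1, x) := by
      ext x
      simp [Set.domRestrict]
    rw [this]
    fun_prop
  · intro x hx
    simp only [hx, dif_pos, hG]
    simp [H]

/-- A continuous real function on a preconnected set whose values are integers is constant. -/
theorem IsPreconnected.eq_of_addCircle_eq_zero {X : Type*} [TopologicalSpace X] {S : Set X}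
    (hS : IsPreconnected S) {f : X → ℝ} (hf : ContinuousOn f S)
    (h : ∀ x ∈ S, (f x : AddCircle (1 : ℝ)) = 0) {x y : X} (hx : x ∈ S) (hy : y ∈ S) :
    f x = f y := by
  have hd : IsPreconnected (f '' S) := hS.image f hf
  have hsub : f '' S ⊆ Set.range ((↑) : ℤ → ℝ) := by
    rintro _ ⟨z, hz, rfl⟩
    obtain ⟨m, hm⟩ := (AddCircle.coe_eq_zero_iff (1 : ℝ)).1 (h z hz)
    exact ⟨m, by simpa using hm⟩
  have hss : (f '' S).Subsingleton := by
    have htd : IsTotallyDisconnected (Set.range ((↑) : ℤ → ℝ)) :=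
      (Set.countable_range _).isTotallyDisconnected
    exact htd _ hsub hd
  exact hss ⟨x, hx, rfl⟩ ⟨y, hy, rfl⟩

/-- On the overlap two lifts differ by a continuous integer-valued function, hence by one constant;
shifting one lift by it lets them be glued. -/
theorem exists_addCircle_lift_union {X : Type*} [TopologicalSpace X] {A B : Set X}
    (hA : IsOpen A) (hB : IsOpen B) (hAB : IsPreconnected (A ∩ B))
    {F : X → AddCircle (1 : ℝ)}
    (h1 : ∃ G : X → ℝ, ContinuousOn G A ∧ ∀ x ∈ A, (G x : AddCircle (1 : ℝ)) = F x)
    (h2 : ∃ G : X → ℝ, ContinuousOn G B ∧ ∀ x ∈ B, (G x : AddCircle (1 : ℝ)) = F x) :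
    ∃ G : X → ℝ, ContinuousOn G (A ∪ B) ∧ ∀ x ∈ A ∪ B, (G x : AddCircle (1 : ℝ)) = F x := by
  classical
  obtain ⟨G₁, c₁, e₁⟩ := h1
  obtain ⟨G₂, c₂, e₂⟩ := h2
  obtain ⟨m, hm, hm'⟩ : ∃ m : ℝ, (m : AddCircle (1 : ℝ)) = 0 ∧
      ∀ x ∈ A ∩ B, G₁ x = G₂ x + m := by
    have hz : ∀ x ∈ A ∩ B, ((G₁ x - G₂ x : ℝ) : AddCircle (1 : ℝ)) = 0 := fun x hx => by
      rw [AddCircle.coe_sub, e₁ x hx.1, e₂ x hx.2, sub_self]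
    by_cases hne : (A ∩ B).Nonempty
    · obtain ⟨x₀, hx₀⟩ := hne
      refine ⟨G₁ x₀ - G₂ x₀, hz x₀ hx₀, fun x hx => ?_⟩
      have := hAB.eq_of_addCircle_eq_zero (f := fun x => G₁ x - G₂ x)
        ((c₁.mono Set.inter_subset_left).sub (c₂.mono Set.inter_subset_right)) hz hx hx₀
      linarith
    · exact ⟨0, by simp, fun x hx => (hne ⟨x, hx⟩).elim⟩
  refine ⟨fun x => if x ∈ A then G₁ x else G₂ x + m, ?_, ?_⟩
  · refine ContinuousOn.union_of_isOpen ?_ ?_ hA hB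
    · exact c₁.congr fun x hx => by simp [hx]
    · refine (c₂.add (continuousOn_const (c := m))).congr fun x hx => ?_
      by_cases hxA : x ∈ A
      · simp [hxA, hm' x ⟨hxA, hx⟩]
      · simp [hxA]
  · intro x hx
    by_cases hxA : x ∈ A
    · simp [hxA, e₁ x hxA]
    · have hxB : x ∈ B := hx.resolve_left hxA
      simp only [hxA, if_false]
      rw [AddCircle.coe_add, hm, add_zero, e₂ x hxB]

-- A van Kampen argument: the punctured ball is covered by two star-shaped open sets with connected
-- intersection.
open Metric in
theorem exists_addCircle_lift_punctured_ball (y : EuclideanSpace ℝ (Fin 3)) {r : ℝ} (hr : 0 < r)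
    {F : EuclideanSpace ℝ (Fin 3) → AddCircle (1 : ℝ)} (hF : ContinuousOn F (ball y r \ {y})) :
    ∃ G : EuclideanSpace ℝ (Fin 3) → ℝ, ContinuousOn G (ball y r \ {y}) ∧
      ∀ x ∈ ball y r \ {y}, (G x : AddCircle (1 : ℝ)) = F x := by
  have hcont : ∀ i, Continuous fun x : EuclideanSpace ℝ (Fin 3) => x i := fun i => by fun_prop
  -- For `s = 1` and `s = -1` this is the ball without the closed vertical half-line from `y`
  -- downwards, respectively upwards.
  let A (s : ℝ) : Set (EuclideanSpace ℝ (Fin 3)) :=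
    {x | x ∈ ball y r ∧ (x 0 ≠ y 0 ∨ x 1 ≠ y 1 ∨ 0 < s * (x 2 - y 2))}
  have hopen : ∀ s, IsOpen (A s) := by
    intro s
    refine isOpen_ball.inter (IsOpen.union ?_ (IsOpen.union ?_ ?_))
    · exact isOpen_ne_fun (hcont 0) continuous_const
    · exact isOpen_ne_fun (hcont 1) continuous_const
    · exact isOpen_lt continuous_const (continuous_const.mul ((hcont 2).sub continuous_const))
  have hsub : ∀ s, A s ⊆ ball y r \ {y} := by
    rintro s x ⟨hx, h⟩
    refine ⟨hx, ?_⟩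
    rintro rfl
    simp at h
  have hpt : ∀ a b c : ℝ, |a| + |b| + |c| < r → y + WithLp.toLp 2 ![a, b, c] ∈ ball y r := by
    intro a b c h
    rw [mem_ball, dist_eq_norm, add_sub_cancel_left]
    have : (WithLp.toLp 2 ![a, b, c] : EuclideanSpace ℝ (Fin 3)) =
        EuclideanSpace.single 0 a + EuclideanSpace.single 1 b + EuclideanSpace.single 2 c := by
      ext i
      fin_cases i <;> simp
    rw [this]
    refine (norm_add₃_le).trans_lt ?_
    simpa using h
  have hstar : ∀ s : ℝ, s = 1 ∨ s = -1 → ∃ G : EuclideanSpace ℝ (Fin 3) → ℝ,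
      ContinuousOn G (A s) ∧ ∀ x ∈ A s, (G x : AddCircle (1 : ℝ)) = F x := by
    intro s hs
    have hss : 0 < s * s := by rcases hs with rfl | rfl <;> norm_num
    have habs : |s| = 1 := by rcases hs with rfl | rfl <;> norm_num
    have hc : y + WithLp.toLp 2 ![0, 0, s * (r / 2)] ∈ A s := by
      refine ⟨hpt _ _ _ ?_, Or.inr (Or.inr ?_)⟩
      · rw [abs_mul, habs, abs_of_pos (half_pos hr)]
        simp
        linarith
      · simp
        have := mul_pos hss (half_pos hr)
        linarith
    refine StarConvex.exists_addCircle_lift (c := y + WithLp.toLp 2 ![0, 0, s * (r / 2)])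
      ?_ (hF.mono (hsub s))
    intro x hx a b ha hb hab
    refine ⟨convex_ball y r hc.1 hx.1 ha hb hab, ?_⟩
    rcases hb.eq_or_lt with rfl | hb
    · have : a = 1 := by linarith
      subst this
      simpa using hc.2
    have ha' : a = 1 - b := by linarith
    subst ha'
    rcases hx.2 with h | h | h
    · left
      simp only [PiLp.add_apply, PiLp.smul_apply, smul_eq_mul]
      intro hh
      apply h
      have : b * (x 0 - y 0) = 0 := by
        simp at hh
        linarith
      rcases mul_eq_zero.1 this with h0 | h0 <;> linarith
    · right; left
      simp only [PiLp.add_apply, PiLp.smul_apply, smul_eq_mul]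
      intro hh
      apply h
      have : b * (x 1 - y 1) = 0 := by
        simp at hh
        linarith
      rcases mul_eq_zero.1 this with h0 | h0 <;> linarith
    · right; right
      simp
      have h1 : 0 < b * (s * (x 2 - y 2)) := mul_pos hb h
      have h2 : 0 ≤ (1 - b) * (s * s * (r / 2)) := mul_nonneg ha (by positivity)
      linarith
  have hunion : ball y r \ {y} = A 1 ∪ A (-1) := by
    refine Set.Subset.antisymm ?_ (Set.union_subset (hsub _) (hsub _))
    rintro x ⟨hx, hxy⟩
    by_contra hcon
    simp only [Set.mem_union, A, Set.mem_ofPred_eq, hx, true_and, not_or, not_not, not_lt] at hcon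
    apply hxy
    ext i
    fin_cases i
    · exact hcon.1.1
    · exact hcon.1.2.1
    · have := hcon.1.2.2
      have := hcon.2.2.2
      simp
      linarith
  -- The intersection is the ball minus the vertical axis. It is the union of four convex open
  -- half-balls, and the half-balls of the two horizontal directions meet.
  have hinter : IsPreconnected (A 1 ∩ A (-1)) := by
    let D (i : Fin 3) (s : ℝ) : Set (EuclideanSpace ℝ (Fin 3)) :=
      ball y r ∩ {x | 0 < s * (x i - y i)}
    have hD : ∀ i s, IsPreconnected (D i s) := by
      intro i s
      refine ((convex_ball y r).inter ?_).isPreconnected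
      intro x hx z hz a b ha hb hab
      simp only [Set.mem_ofPred_eq, PiLp.add_apply, PiLp.smul_apply, smul_eq_mul] at hx hz ⊢
      have : s * (a * x i + b * z i - y i) = a * (s * (x i - y i)) + b * (s * (z i - y i)) := by
        have : y i = (a + b) * y i := by rw [hab, one_mul]
        linear_combination (-s) * this
      rw [this]
      rcases ha.eq_or_lt with rfl | ha
      · have : b = 1 := by linarith
        subst this
        simpa using hz
      · have := mul_pos ha hx
        have := mul_nonneg hb hz.le
        linarith
    have hDpt : ∀ s t : ℝ, |s| = 1 → |t| = 1 → (D 0 s ∩ D 1 t).Nonempty := by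
      intro s t hs ht
      have h3 : 0 < r / 3 := by linarith
      refine ⟨y + WithLp.toLp 2 ![s * (r / 3), t * (r / 3), 0], ⟨?_, ?_⟩, ⟨?_, ?_⟩⟩
      · apply hpt
        rw [abs_mul, abs_mul, hs, ht, abs_of_pos h3]
        simp
        linarith
      · have : 0 < s * s := by rw [← abs_mul_abs_self, hs]; norm_num
        have := mul_pos this h3
        simp
        linarith
      · apply hpt
        rw [abs_mul, abs_mul, hs, ht, abs_of_pos h3]
        simp
        linarith
      · have : 0 < t * t := by rw [← abs_mul_abs_self, ht]; norm_num
        have := mul_pos this h3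
        simp
        linarith
    have heq : A 1 ∩ A (-1) = ((D 0 1 ∪ D 1 1) ∪ D 0 (-1)) ∪ D 1 (-1) := by
      ext x
      simp only [A, D, Set.mem_inter_iff, Set.mem_union, Set.mem_ofPred_eq]
      constructor
      · rintro ⟨⟨hx, h⟩, -, h'⟩
        have : x 0 ≠ y 0 ∨ x 1 ≠ y 1 := by
          by_contra hcon
          push Not at hcon
          have h1 := (h.resolve_left (by simp [hcon])).resolve_left (by simp [hcon])
          have h2 := (h'.resolve_left (by simp [hcon])).resolve_left (by simp [hcon])
          linarith
        rcases this with h | h <;> rcases h.lt_or_gt with h | h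
        · exact Or.inl (Or.inr ⟨hx, by linarith⟩)
        · exact Or.inl (Or.inl (Or.inl ⟨hx, by linarith⟩))
        · exact Or.inr ⟨hx, by linarith⟩
        · exact Or.inl (Or.inl (Or.inr ⟨hx, by linarith⟩))
      · have key0 : ∀ s : ℝ, 0 < s * (x 0 - y 0) → x 0 ≠ y 0 := by
          intro s h h'
          simp [h'] at h
        have key1 : ∀ s : ℝ, 0 < s * (x 1 - y 1) → x 1 ≠ y 1 := by
          intro s h h'
          simp [h'] at h
        rintro (((⟨hx, h⟩ | ⟨hx, h⟩) | ⟨hx, h⟩) | ⟨hx, h⟩)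
        · exact ⟨⟨hx, Or.inl (key0 _ h)⟩, hx, Or.inl (key0 _ h)⟩
        · exact ⟨⟨hx, Or.inr (Or.inl (key1 _ h))⟩, hx, Or.inr (Or.inl (key1 _ h))⟩
        · exact ⟨⟨hx, Or.inl (key0 _ h)⟩, hx, Or.inl (key0 _ h)⟩
        · exact ⟨⟨hx, Or.inr (Or.inl (key1 _ h))⟩, hx, Or.inr (Or.inl (key1 _ h))⟩
    rw [heq]
    refine IsPreconnected.union' ?_ (IsPreconnected.union' ?_
      (IsPreconnected.union' ?_ (hD _ _) (hD _ _)) (hD _ _)) (hD _ _)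
    · obtain ⟨x, h1, h2⟩ := hDpt 1 (-1) (by simp) (by simp)
      exact ⟨x, Or.inl (Or.inl h1), h2⟩
    · obtain ⟨x, h1, h2⟩ := hDpt (-1) 1 (by simp) (by simp)
      exact ⟨x, Or.inr h2, h1⟩
    · exact hDpt 1 1 (by simp) (by simp)
  rw [hunion]
  exact exists_addCircle_lift_union (hopen _) (hopen _) hinter (hstar _ (Or.inl rfl))
    (hstar _ (Or.inr rfl))

/-- Every continuous map to the circle from a punctured relatively open ball of a half-space lifts
to the reals. -/
theorem exists_addCircle_lift_punctured_halfBall (y : EuclideanHalfSpace 3)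
    {U : Set (EuclideanHalfSpace 3)} (hU : IsOpen U) (hy : y ∈ U) :
    ∃ B ⊆ U, IsOpen B ∧ y ∈ B ∧ ∀ F : EuclideanHalfSpace 3 → AddCircle (1 : ℝ),
      ContinuousOn F (B \ {y}) → ∃ G : EuclideanHalfSpace 3 → ℝ, ContinuousOn G (B \ {y}) ∧
        ∀ x ∈ B \ {y}, (G x : AddCircle (1 : ℝ)) = F x := by
  classical
  let H : Set (EuclideanSpace ℝ (Fin 3)) := {x | 0 ≤ x 0}
  obtain ⟨U', hU', rfl⟩ := isOpen_induced_iff.1 hU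
  obtain ⟨r₀, hr₀, hball⟩ := Metric.isOpen_iff.1 hU' y.1 hy
  obtain ⟨r, hr, hrr, hcase⟩ : ∃ r > 0, r ≤ r₀ ∧
      (y.1 0 = 0 ∨ Metric.ball y.1 r ⊆ H) := by
    rcases (show 0 ≤ y.1 0 from y.2).eq_or_lt with h | h
    · exact ⟨r₀, hr₀, le_rfl, Or.inl h.symm⟩
    · refine ⟨min r₀ (y.1 0), lt_min hr₀ h, min_le_left _ _, Or.inr fun x hx => ?_⟩
      have h1 : dist x y.1 < y.1 0 := lt_of_lt_of_le (Metric.mem_ball.1 hx) (min_le_right _ _)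
      have h2 : |x 0 - y.1 0| ≤ dist x y.1 := by
        rw [dist_eq_norm]
        exact PiLp.norm_apply_le (x - y.1) 0
      have := (abs_lt.1 (h2.trans_lt h1)).1
      show 0 ≤ x 0
      linarith
  refine ⟨Subtype.val ⁻¹' Metric.ball y.1 r, fun x hx => hball (Metric.ball_subset_ball hrr hx),
    Metric.isOpen_ball.preimage continuous_subtype_val, Metric.mem_ball_self hr, fun F hF => ?_⟩
  let F' : EuclideanSpace ℝ (Fin 3) → AddCircle (1 : ℝ) :=
    fun x => if h : 0 ≤ x 0 then F ⟨x, h⟩ else 0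
  have hF' : ContinuousOn F' ((Metric.ball y.1 r ∩ H) \ {y.1}) := by
    rw [continuousOn_iff_continuous_domRestrict] at hF ⊢
    let g : ↥((Metric.ball y.1 r ∩ H) \ {y.1}) →
        ↥((Subtype.val ⁻¹' Metric.ball y.1 r : Set (EuclideanHalfSpace 3)) \ {y}) :=
      fun x => ⟨⟨x.1, x.2.1.2⟩, x.2.1.1, fun h => x.2.2 (congrArg Subtype.val h)⟩
    have hg : Continuous g := by
      refine Continuous.subtype_mk (Continuous.subtype_mk continuous_subtype_val _) _
    have : ((Metric.ball y.1 r ∩ H) \ {y.1}).domRestrict F' =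
      (((Subtype.val ⁻¹' Metric.ball y.1 r : Set (EuclideanHalfSpace 3)) \ {y}).domRestrict F) ∘ g := by
      ext x
      have : 0 ≤ x.1 0 := x.2.1.2
      exact dif_pos this
    rw [this]
    exact hF.comp hg
  obtain ⟨G, hG, hGF⟩ : ∃ G : EuclideanSpace ℝ (Fin 3) → ℝ,
      ContinuousOn G ((Metric.ball y.1 r ∩ H) \ {y.1}) ∧
        ∀ x ∈ (Metric.ball y.1 r ∩ H) \ {y.1}, (G x : AddCircle (1 : ℝ)) = F' x := by
    -- At a boundary point the punctured half-ball is star-shaped about `y` pushed inwards by `r /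
    -- 2`: any positive weight of the centre makes coordinate 0 positive, so the segment avoids `y`.
    -- At an interior point the radius was chosen so that the ball lies in the half-space.
    rcases hcase with h0 | hsub
    · have hc : y.1 + EuclideanSpace.single 0 (r / 2) ∈ (Metric.ball y.1 r ∩ H) \ {y.1} := by
        refine ⟨⟨?_, ?_⟩, ?_⟩
        · rw [Metric.mem_ball, dist_eq_norm, add_sub_cancel_left, PiLp.norm_single,
            Real.norm_of_nonneg (by linarith)]
          linarith
        · show 0 ≤ (y.1 + EuclideanSpace.single 0 (r / 2) : EuclideanSpace ℝ (Fin 3)) 0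
          simp [h0]
          linarith
        · intro h
          have := congrArg (fun z : EuclideanSpace ℝ (Fin 3) => z 0) h
          simp at this
          linarith
      refine StarConvex.exists_addCircle_lift
        (c := y.1 + EuclideanSpace.single 0 (r / 2)) ?_ hF'
      intro x hx a b ha hb hab
      have hH : 0 ≤ x 0 := hx.1.2
      have e0 : (a • (y.1 + EuclideanSpace.single 0 (r / 2)) + b • x :
          EuclideanSpace ℝ (Fin 3)) 0 = a * (r / 2) + b * x 0 := by
        simp [h0]
      refine ⟨⟨convex_ball _ _ hc.1.1 hx.1.1 ha hb hab, ?_⟩, ?_⟩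
      · show 0 ≤ (_ : EuclideanSpace ℝ (Fin 3)) 0
        rw [e0]
        positivity
      · rcases ha.eq_or_lt with rfl | ha
        · have : b = 1 := by linarith
          subst this
          simpa using hx.2
        · intro h
          have h1 := congrArg (fun z : EuclideanSpace ℝ (Fin 3) => z 0) h
          simp only [e0, h0] at h1
          have : 0 < a * (r / 2) := by positivity
          have : 0 ≤ b * x 0 := by positivity
          linarith
    · rw [Set.inter_eq_left.2 hsub] at hF' ⊢
      exact exists_addCircle_lift_punctured_ball _ hr hF'
  have hmaps : Set.MapsTo (Subtype.val : EuclideanHalfSpace 3 → EuclideanSpace ℝ (Fin 3))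
      ((Subtype.val ⁻¹' Metric.ball y.1 r : Set (EuclideanHalfSpace 3)) \ {y})
      ((Metric.ball y.1 r ∩ H) \ {y.1}) :=
    fun x hx => ⟨⟨hx.1, x.2⟩, fun h => hx.2 (Subtype.ext h)⟩
  refine ⟨fun x => G x.1, hG.comp continuous_subtype_val.continuousOn hmaps, fun x hx => ?_⟩
  rw [hGF _ (hmaps hx)]
  have : 0 ≤ x.1 0 := x.2
  simp [F', this]

/-! ### Potentials on disjoint unions of paths and cycles. -/

/-- A function on the directed edges of a finite graph consisting of disjoint paths and cycles is
a coboundary if its sum along every cycle vanishes. -/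
theorem exists_potential_of_cycle_sum_eq_zero {α : Type*} [Finite α] {r : α → α → Prop}
    (hfun : ∀ a b b', r a b → r a b' → b = b') (hinj : ∀ a a' b, r a b → r a' b → a = a')
    {β : α → ℝ}
    (hβ : ∀ (k : ℕ) (c : Fin k → α), Function.Injective c →
      (∀ j, r (c j) (c (finRotate k j))) → ∑ j, β (c j) = 0) :
    ∃ h : α → ℝ, ∀ a b, r a b → h b = h a + β a := by
  classical
  have := Fintype.ofFinite α
  let e : {a // ∃ b, r a b} ≃ {b // ∃ a, r a b} :=
    { toFun := fun a => ⟨a.2.choose, a.1, a.2.choose_spec⟩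
      invFun := fun b => ⟨b.2.choose, b.1, b.2.choose_spec⟩
      left_inv := fun a => Subtype.ext (hinj _ _ a.2.choose
        (Exists.choose_spec (p := fun x => r x a.2.choose) ⟨a.1, a.2.choose_spec⟩)
        a.2.choose_spec)
      right_inv := fun b => Subtype.ext (hfun b.2.choose _ _
        (Exists.choose_spec (p := fun x => r b.2.choose x) ⟨b.1, b.2.choose_spec⟩)
        b.2.choose_spec) }
  -- Extending the partial injection `r` to a permutation closes each path up artificially. An
  -- element is `good` if its `π`-orbit uses only genuine `r`-steps.
  let π : Equiv.Perm α := e.extendSubtype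
  have hπ : ∀ a b, r a b → π a = b := by
    intro a b h
    have hp : ∃ b, r a b := ⟨b, h⟩
    rw [show π a = e ⟨a, hp⟩ from e.extendSubtype_apply_of_mem a hp]
    exact hfun a _ _ hp.choose_spec h
  have hπ' : ∀ a, (∃ b, r a b) → r a (π a) := by
    rintro a ⟨b, h⟩
    rwa [hπ a b h]
  let good (a : α) : Prop := ∀ j, ∃ b, r (π^[j] a) b
  have hsum : ∀ a, good a → birkhoffSum π β (Function.minimalPeriod π a) a = 0 := by
    intro a ha
    have := hβ (Function.minimalPeriod π a) (fun j => π^[j] a) ?_ ?_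
    · rw [birkhoffSum, Finset.sum_range]
      exact this
    · intro i j hij
      exact Fin.ext (Function.iterate_injOn_Iio_minimalPeriod i.2 j.2 hij)
    · intro j
      have hj : r (π^[j] a) (π^[j + 1] a) := by
        rw [Function.iterate_succ_apply']
        exact hπ' _ (ha j)
      convert hj using 1
      generalize hk : Function.minimalPeriod π a = k at j
      cases k with
      | zero => exact j.elim0
      | succ k =>
        rcases lt_or_eq_of_le (Nat.lt_succ_iff.1 j.2) with h | h
        · rw [finRotate_of_lt h]
        · have : j = Fin.last k := Fin.ext h
          subst this
          rw [finRotate_last]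
          have hp : π^[k + 1] a = a := by
            rw [← hk]
            exact Function.iterate_minimalPeriod
          simpa using hp.symm
  have hbad : ∀ a, ¬ good a → ∃ j, ¬ ∃ b, r (π^[j] a) b := fun a ha => not_forall.1 ha
  -- On a path, the potential is minus the sum of `β` from `a` to the end of the path. On a cycle,
  -- it is minus the average of the partial sums starting at `a`, which avoids choosing a base
  -- point.
  refine ⟨fun a => if ha : good a then
      -(∑ m ∈ Finset.range (Function.minimalPeriod π a), birkhoffSum π β m a) /
        (Function.minimalPeriod π a)
    else -birkhoffSum π β (Nat.find (hbad a ha)) a, fun a b hab => ?_⟩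
  obtain rfl := hπ a b hab
  by_cases ha : good a
  · have hb : good (π a) := fun j => by
      rw [← Function.iterate_succ_apply]
      exact ha (j + 1)
    have hper : Function.minimalPeriod π (π a) = Function.minimalPeriod π a :=
      Function.minimalPeriod_apply (π.injective.mem_periodicPts a)
    have hpos : 0 < Function.minimalPeriod π a :=
      Function.minimalPeriod_pos_of_mem_periodicPts (π.injective.mem_periodicPts a)
    simp only [ha, hb, dif_pos, hper]
    have h1 : ∀ m, birkhoffSum π β m (π a) = birkhoffSum π β (m + 1) a - β a := fun m => by
      rw [birkhoffSum_succ']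
      ring
    have h2 := Finset.sum_range_succ (fun m => birkhoffSum π β m a) (Function.minimalPeriod π a)
    rw [Finset.sum_range_succ', hsum a ha, birkhoffSum_zero, add_zero, add_zero] at h2
    simp only [h1, Finset.sum_sub_distrib, h2, Finset.sum_const, Finset.card_range, nsmul_eq_mul]
    have : (Function.minimalPeriod π a : ℝ) ≠ 0 := by exact_mod_cast hpos.ne'
    field_simp
    ring
  · have hb : ¬ good (π a) := fun hb => ha fun j => by
      cases j with
      | zero => exact ⟨_, hab⟩
      | succ j =>
        rw [Function.iterate_succ_apply]
        exact hb j
    simp only [ha, hb, dif_neg, not_false_eq_true]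
    have hfind : Nat.find (hbad a ha) = Nat.find (hbad _ hb) + 1 := by
      rw [Nat.find_eq_iff]
      refine ⟨?_, fun m hm => ?_⟩
      · rw [Function.iterate_succ_apply]
        exact Nat.find_spec (hbad _ hb)
      · cases m with
        | zero => exact not_not.2 ⟨_, hab⟩
        | succ m =>
          rw [Function.iterate_succ_apply]
          exact Nat.find_min (hbad _ hb) (by omega)
    rw [hfind, birkhoffSum_succ']
    ring

/-! ### Matching equations as jumps, and the corner potential. -/

namespace FaceGluing

variable {n : ℕ}

theorem EdgeStep.right_unique {T : FaceGluing n} {φ ψ ψ' : Fin n × Equiv.Perm (Fin 4)}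
    (h : T.EdgeStep φ ψ) (h' : T.EdgeStep φ ψ') : ψ = ψ' := by
  obtain ⟨g, hg, h0, h1, h2, h3⟩ := h
  obtain ⟨g', hg', h0', h1', h2', h3'⟩ := h'
  rw [hg, Option.some_inj, Prod.mk.injEq] at hg'
  obtain ⟨hj, rfl⟩ := hg'
  refine Prod.ext hj (Equiv.ext fun x => ?_)
  fin_cases x
  · exact h0.trans h0'.symm
  · exact h1.trans h1'.symm
  · exact h2.trans h2'.symm
  · exact h3.trans h3'.symm

/-- Transposing the last two entries of the frame reverses the walk around the edge; uniqueness of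
predecessors thereby reduces to uniqueness of successors. -/
theorem EdgeStep.reverse {T : FaceGluing n} {φ ψ : Fin n × Equiv.Perm (Fin 4)}
    (h : T.EdgeStep φ ψ) :
    T.EdgeStep (ψ.1, ψ.2 * Equiv.swap 2 3) (φ.1, φ.2 * Equiv.swap 2 3) := by
  obtain ⟨g, hg, h0, h1, h2, h3⟩ := h
  have e0 : Equiv.swap (2 : Fin 4) 3 0 = 0 := by decide
  have e1 : Equiv.swap (2 : Fin 4) 3 1 = 1 := by decide
  refine ⟨g.symm, ?_, ?_, ?_, ?_, ?_⟩
  · simpa [h3] using T.glue_symm _ _ _ _ hg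
  all_goals simp [h0, h1, h2, h3, e0, e1]

theorem EdgeStep.left_unique {T : FaceGluing n} {φ φ' ψ : Fin n × Equiv.Perm (Fin 4)}
    (h : T.EdgeStep φ ψ) (h' : T.EdgeStep φ' ψ) : φ = φ' := by
  have := h.reverse.right_unique h'.reverse
  rw [Prod.mk.injEq, mul_left_inj] at this
  exact Prod.ext this.1 this.2

/-- The increment of the triangle coordinates around `v` that the standard matching equations
force when crossing face `f` of tetrahedron `i`, for given quadrilateral coordinates. -/
def jump (T : FaceGluing n) (q : QuadVec n) (i : Fin n) (f v : Fin 4) : ℝ :=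
  match T.glue i f with
  | some (j, g) => q (i, quadSeparating v f) - q (j, quadSeparating (g v) (g f))
  | none => 0

theorem jump_of_glue {T : FaceGluing n} (q : QuadVec n) {i j : Fin n} {f : Fin 4}
    {g : Equiv.Perm (Fin 4)} (h : T.glue i f = some (j, g)) (v : Fin 4) :
    T.jump q i f v = q (i, quadSeparating v f) - q (j, quadSeparating (g v) (g f)) := by
  simp [jump, h]

theorem jump_symm {T : FaceGluing n} (q : QuadVec n) {i j : Fin n} {f : Fin 4}
    {g : Equiv.Perm (Fin 4)} (h : T.glue i f = some (j, g)) (v : Fin 4) :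
    T.jump q j (g f) (g v) = -T.jump q i f v := by
  rw [jump_of_glue q h, jump_of_glue q (T.glue_symm _ _ _ _ h)]
  simp

theorem stdMatching_iff_jump {T : FaceGluing n} {w : StdVec n} :
    T.StdMatching w ↔ ∀ i f j g, T.glue i f = some (j, g) → ∀ v, v ≠ f →
      w (j, Sum.inl (g v)) = w (i, Sum.inl v) + T.jump (quadProj w) i f v := by
  refine forall_congr' fun i => forall_congr' fun f => forall_congr' fun j => forall_congr' fun g =>
    forall_congr' fun h => forall_congr' fun v => forall_congr' fun _ => ?_
  rw [jump_of_glue _ h, quadProj, quadProj]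
  constructor <;> intro h <;> linarith

/-- The quadrilateral subtracted in a jump is the downward one of the next tetrahedron, so shifting
the second sum by one step of the cycle matches the terms. -/
theorem sum_jump_eq {T : FaceGluing n} (q : QuadVec n) {k : ℕ}
    {c : Fin k → Fin n × Equiv.Perm (Fin 4)} (hc : ∀ j, T.EdgeStep (c j) (c (finRotate k j))) :
    ∑ j, T.jump q (c j).1 ((c j).2 2) ((c j).2 0) =
      ∑ j, q ((c j).1, quadSeparating ((c j).2 0) ((c j).2 2)) -
        ∑ j, q ((c j).1, quadSeparating ((c j).2 0) ((c j).2 3)) := by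
  rw [← Equiv.sum_comp (finRotate k) fun j => q ((c j).1, quadSeparating ((c j).2 0) ((c j).2 3)),
    ← Finset.sum_sub_distrib]
  refine Finset.sum_congr rfl fun j _ => ?_
  obtain ⟨g, hg, h0, h1, h2, h3⟩ := hc j
  rw [jump_of_glue _ hg, h0, h3]

/-- The jumps are differences of consecutive triangle coordinates around the lower end of the edge,
and these telescope over a cycle. -/
theorem StdMatching.quadMatching {T : FaceGluing n} {w : StdVec n} (hw : T.StdMatching w) :
    T.QuadMatching (quadProj w) := by
  intro k c _ hc
  rw [← sub_eq_zero, ← sum_jump_eq _ hc]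
  rw [stdMatching_iff_jump] at hw
  have h := Equiv.sum_comp (finRotate k) fun j => w ((c j).1, Sum.inl ((c j).2 0))
  rw [← sub_eq_zero, ← Finset.sum_sub_distrib] at h
  rw [← h]
  refine Finset.sum_congr rfl fun j _ => ?_
  obtain ⟨g, hg, h0, h1, h2, h3⟩ := hc j
  rw [h0, hw _ _ _ _ hg _ ((c j).2.injective.ne (by decide))]
  ring

/-- Solutions of the quadrilateral matching equations give rise to a function on the corners of
the triangles in the vertex links with prescribed jumps across the edges of the links. -/
theorem QuadMatching.exists_cornerPotential {T : FaceGluing n} {q : QuadVec n}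
    (hq : T.QuadMatching q) :
    ∃ c : Fin n → Fin 4 → Fin 4 → ℝ, ∀ i f j g, T.glue i f = some (j, g) →
      ∀ v w, v ≠ f → w ≠ f → v ≠ w → c j (g v) (g w) = c i v w + T.jump q i f v := by
  classical
  obtain ⟨h, hh⟩ := exists_potential_of_cycle_sum_eq_zero (r := T.EdgeStep)
    (β := fun φ => T.jump q φ.1 (φ.2 2) (φ.2 0))
    (fun _ _ _ => EdgeStep.right_unique) (fun _ _ _ => EdgeStep.left_unique)
    (fun k c hc hs => by rw [sum_jump_eq q hs, hq k c hc hs, sub_self])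
  have e0 : Equiv.swap (2 : Fin 4) 3 0 = 0 := by decide
  have e1 : Equiv.swap (2 : Fin 4) 3 1 = 1 := by decide
  -- The crossed face is opposite `σ 2` or `σ 3`. The first case is a step of the walk; the second
  -- is the reverse of a step, with the opposite jump.
  have key : ∀ i f j g, T.glue i f = some (j, g) → ∀ σ : Equiv.Perm (Fin 4), σ 0 ≠ f → σ 1 ≠ f →
      h (j, g * σ * Equiv.swap 2 3) = h (i, σ) + T.jump q i f (σ 0) := by
    intro i f j g hg σ h0 h1
    obtain ⟨x, rfl⟩ := σ.surjective f
    have hx : x = 2 ∨ x = 3 := by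
      revert h0 h1
      fin_cases x <;> simp
    rcases hx with rfl | rfl
    · refine hh (i, σ) (j, g * σ * Equiv.swap 2 3) ⟨g, hg, ?_⟩
      simp [e0, e1]
    · have := hh (j, g * σ * Equiv.swap 2 3) (i, σ) ⟨g.symm, ?_, ?_⟩
      · rw [this]
        have h2 := jump_symm q hg (σ 0)
        simp [e0, h2]
      · simpa using T.glue_symm _ _ _ _ hg
      · simp [e0, e1]
  -- A corner of a link triangle is a pair `v, w`, but `h` also depends on the direction of the
  -- walk; averaging over the two frames removes this dependence, since gluing permutes the frames.
  refine ⟨fun i v w => (∑ σ with σ 0 = v ∧ σ 1 = w, h (i, σ)) / 2, ?_⟩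
  intro i f j g hg v w hv hw hvw
  have hcard : ∀ v w : Fin 4, v ≠ w →
      (Finset.univ.filter fun σ : Equiv.Perm (Fin 4) => σ 0 = v ∧ σ 1 = w).card = 2 := by
    decide
  have hs : ∑ σ with σ 0 = v ∧ σ 1 = w, (h (i, σ) + T.jump q i f v) =
      ∑ σ with σ 0 = g v ∧ σ 1 = g w, h (j, σ) := by
    refine Finset.sum_equiv ((Equiv.mulLeft g).trans (Equiv.mulRight (Equiv.swap 2 3))) ?_ ?_
    · intro σ
      simp [e0, e1]
    · intro σ hσ
      simp only [Finset.mem_filter, Finset.mem_univ, true_and] at hσ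
      obtain ⟨rfl, rfl⟩ := hσ
      exact (key i f j g hg σ hv hw).symm
  dsimp only
  rw [← hs, Finset.sum_add_distrib, Finset.sum_const, hcard v w hvw]
  simp
  ring

end FaceGluing

/-! ### The circle-valued map near a vertex and the resulting potential. -/

theorem eq_single_of_mem_stdSimplex {ι : Type*} [Fintype ι] [DecidableEq ι] {x : ι → ℝ}
    (hx : x ∈ stdSimplex ℝ ι) {v : ι} (hv : x v = 1) : x = Pi.single v 1 := by
  have h := hx.2
  rw [← Finset.add_sum_erase _ _ (Finset.mem_univ v), hv, add_eq_left,
    Finset.sum_eq_zero_iff_of_nonneg fun i _ => hx.1 i] at h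
  ext w
  by_cases hw : w = v
  · subst hw
    simpa using hv
  · simpa [hw] using h w (by simp [hw])

theorem abs_sub_single_le_of_mem_stdSimplex {ι : Type*} [Fintype ι] [DecidableEq ι] {x : ι → ℝ}
    (hx : x ∈ stdSimplex ℝ ι) (v w : ι) :
    |x w - (Pi.single v 1 : ι → ℝ) w| ≤ 1 - x v := by
  by_cases hw : w = v
  · subst hw
    have := mem_Icc_of_mem_stdSimplex hx w
    rw [Pi.single_eq_same, abs_sub_comm, abs_of_nonneg (by linarith [this.2])]
  · have h := hx.2
    rw [← Finset.add_sum_erase _ _ (Finset.mem_univ v)] at h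
    have h1 : x w ≤ ∑ u ∈ Finset.univ.erase v, x u :=
      Finset.single_le_sum (f := x) (fun i _ => hx.1 i) (by simp [hw])
    rw [Pi.single_eq_of_ne hw, sub_zero, abs_of_nonneg (hx.1 w)]
    linarith

/-- The affine interpolation, on the link of the vertex `v` of a simplex, of the values `c w` at
the vertices of the link. -/
noncomputable def linkInterpolation (c : Fin 4 → ℝ) (v : Fin 4) (x : Fin 4 → ℝ) : ℝ :=
  ∑ w, if w = v then 0 else c w * x w / (1 - x v)

theorem continuousOn_linkInterpolation (c : Fin 4 → ℝ) (v : Fin 4) :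
    ContinuousOn (linkInterpolation c v) {x | x v ≠ 1} := by
  refine continuousOn_finsetSum _ fun w _ => ?_
  by_cases hw : w = v
  · simp only [hw, if_true]
    exact continuousOn_const
  · simp only [hw, if_false]
    refine ContinuousOn.div (by fun_prop) (by fun_prop) fun x hx => ?_
    exact sub_ne_zero.2 (Ne.symm hx)

/-- The weights `x w / (1 - x v)` with `w ≠ v` sum to 1, so a common shift of the corner values
passes through. The uncontrolled value at `f` has weight zero. -/
theorem linkInterpolation_of_glue {c c' : Fin 4 → ℝ} {v f : Fin 4} {g : Equiv.Perm (Fin 4)}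
    {J : ℝ} (hc : ∀ w, w ≠ f → v ≠ w → c' (g w) = c w + J) {x x' : Fin 4 → ℝ}
    (hx : x ∈ stdSimplex ℝ (Fin 4)) (hxf : x f = 0) (hxx' : ∀ w, x' (g w) = x w) (hv : x v ≠ 1) :
    linkInterpolation c' (g v) x' = linkInterpolation c v x + J := by
  have h1 : (1 - x v) ≠ 0 := sub_ne_zero.2 (Ne.symm hv)
  have hJ : J = ∑ w, if w = v then 0 else J * x w / (1 - x v) := by
    have h := hx.2
    rw [← Finset.add_sum_erase _ _ (Finset.mem_univ v)] at h
    rw [← Finset.add_sum_erase _ _ (Finset.mem_univ v), if_pos rfl, zero_add]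
    rw [Finset.sum_congr rfl fun w hw => if_neg (Finset.ne_of_mem_erase hw),
      ← Finset.sum_div, ← Finset.mul_sum, eq_div_iff h1]
    congr 1
    linarith
  rw [linkInterpolation, linkInterpolation, hJ, ← Finset.sum_add_distrib,
    ← Equiv.sum_comp g]
  refine Finset.sum_congr rfl fun w _ => ?_
  simp only [g.injective.eq_iff, hxx']
  by_cases hw : w = v
  · simp [hw]
  · simp only [hw, if_false]
    by_cases hwf : w = f
    · subst hwf
      simp [hxf]
    · rw [hc w hwf (Ne.symm hw)]
      ring

theorem linkInterpolation_of_eq_one (c : Fin 4 → ℝ) {v : Fin 4} {x : Fin 4 → ℝ} (hv : x v = 1) :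
    linkInterpolation c v x = 0 := by
  simp [linkInterpolation, hv]

namespace FaceGluing

variable {n : ℕ} (T : FaceGluing n)

/-- The vertices of the triangulation together with the barycentric coordinates that are larger
than `1 / 2` at a given point; this determines how close the point is to which vertex. -/
def closeVertices : T.Realization → Set (T.Vertex × ℝ) :=
  Quot.lift (fun p => {z | ∃ v, 1 / 2 < p.2.1 v ∧ z = (Quot.mk _ (p.1, v), p.2.1 v)}) <| by
    rintro p p' ⟨f, g, hg, hf, hx⟩
    have hne : ∀ v, 1 / 2 < p.2.1 v → v ≠ f := by
      rintro v hv rfl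
      linarith
    have hq : ∀ v, v ≠ f → (Quot.mk T.VertexIdent (p.1, v)) = Quot.mk T.VertexIdent (p'.1, g v) :=
      fun v hv => Quot.sound ⟨f, g, hg, hv, rfl⟩
    ext z
    constructor
    · rintro ⟨v, hv, rfl⟩
      exact ⟨g v, by rwa [hx], by rw [hx, hq v (hne v hv)]⟩
    · rintro ⟨v, hv, rfl⟩
      obtain ⟨v, rfl⟩ := g.surjective v
      rw [hx] at hv ⊢
      exact ⟨v, hv, by rw [hq v (hne v hv)]⟩

theorem mem_closeVertices_mk {p : Fin n × stdSimplex ℝ (Fin 4)} {z : T.Vertex × ℝ} :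
    z ∈ T.closeVertices (Quot.mk _ p) ↔
      ∃ v, 1 / 2 < p.2.1 v ∧ z = (Quot.mk _ (p.1, v), p.2.1 v) :=
  Iff.rfl

/-- The point of the realization that corresponds to a vertex of the triangulation. -/
def vertexPoint : T.Vertex → T.Realization :=
  Quot.lift (fun c => Quot.mk _ (c.1, ⟨Pi.single c.2 1, single_mem_stdSimplex ℝ c.2⟩)) <| by
    rintro c c' ⟨f, g, hg, hf, hc⟩
    refine Quot.sound ⟨f, g, hg, by simp [Ne.symm hf], fun v => ?_⟩
    simp only [hc]
    by_cases h : v = c.2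
    · simp [h]
    · simp [h]

/-- This recognises the vertex point in the quotient by an invariant, so the generated equivalence
relation need not be described. -/
theorem one_mem_closeVertices_iff {V : T.Vertex} {y : T.Realization} :
    (V, (1 : ℝ)) ∈ T.closeVertices y ↔ y = T.vertexPoint V := by
  constructor
  · induction y using Quot.inductionOn with
    | h p =>
      rw [mem_closeVertices_mk]
      rintro ⟨v, -, h⟩
      rw [Prod.mk.injEq] at h
      rw [h.1]
      have := eq_single_of_mem_stdSimplex p.2.2 h.2.symm
      show _ = Quot.mk _ _
      congr 1
      exact Prod.ext rfl (Subtype.ext this)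
  · rintro rfl
    induction V using Quot.inductionOn with
    | h c =>
      exact ⟨c.2, by simp; norm_num, by simp⟩

theorem continuous_barycentricCoord (v : Fin 4) :
    Continuous fun p : Fin n × stdSimplex ℝ (Fin 4) => p.2.1 v :=
  (continuous_apply v).comp (continuous_subtype_val.comp continuous_snd)

theorem isOpen_closeVertices (V : T.Vertex) :
    IsOpen {y | ∃ t, (V, t) ∈ T.closeVertices y} := by
  rw [← isQuotientMap_quot_mk.isOpen_preimage]
  have : (Quot.mk T.PointIdent ⁻¹' {y | ∃ t, (V, t) ∈ T.closeVertices y}) =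
      ⋃ i, ⋃ v, {p : Fin n × stdSimplex ℝ (Fin 4) | p.1 = i ∧ 1 / 2 < p.2.1 v ∧
        Quot.mk T.VertexIdent (i, v) = V} := by
    ext p
    simp only [Set.mem_preimage, Set.mem_ofPred_eq, mem_closeVertices_mk, Set.mem_iUnion,
      Prod.mk.injEq]
    constructor
    · rintro ⟨t, v, hv, hV, -⟩
      exact ⟨p.1, v, rfl, hv, hV.symm⟩
    · rintro ⟨i, v, rfl, hv, hV⟩
      exact ⟨_, v, hv, hV.symm, rfl⟩
  rw [this]
  refine isOpen_iUnion fun i => isOpen_iUnion fun v => ?_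
  refine IsOpen.inter ?_ (IsOpen.inter ?_ isOpen_const)
  · exact (isOpen_discrete {i}).preimage continuous_fst
  · exact isOpen_lt continuous_const (continuous_barycentricCoord v)

theorem isOpen_punctured_closeVertices :
    IsOpen {y | ∃ z ∈ T.closeVertices y, z.2 < 1} := by
  rw [← isQuotientMap_quot_mk.isOpen_preimage]
  have : (Quot.mk T.PointIdent ⁻¹' {y | ∃ z ∈ T.closeVertices y, z.2 < 1}) =
      ⋃ v, {p : Fin n × stdSimplex ℝ (Fin 4) | 1 / 2 < p.2.1 v ∧ p.2.1 v < 1} := by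
    ext p
    simp only [Set.mem_preimage, Set.mem_ofPred_eq, mem_closeVertices_mk, Set.mem_iUnion]
    constructor
    · rintro ⟨_, ⟨v, hv, rfl⟩, h⟩
      exact ⟨v, hv, h⟩
    · rintro ⟨v, hv, h⟩
      exact ⟨_, ⟨v, hv, rfl⟩, h⟩
  rw [this]
  refine isOpen_iUnion fun v => ?_
  exact (isOpen_lt continuous_const (continuous_barycentricCoord v)).inter
    (isOpen_lt (continuous_barycentricCoord v) continuous_const)

/-- A corner potential with integral jumps induces a circle-valued map on the neighbourhoods of
the vertices, which is continuous away from the vertices. -/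
theorem exists_circleMap {q : QuadVec n} {m : QuadCoord n → ℤ} (hm : ∀ p, q p = m p)
    {c : Fin n → Fin 4 → Fin 4 → ℝ}
    (hc : ∀ i f j g, T.glue i f = some (j, g) →
      ∀ v w, v ≠ f → w ≠ f → v ≠ w → c j (g v) (g w) = c i v w + T.jump q i f v) :
    ∃ F : T.Realization → AddCircle (1 : ℝ),
      (∀ (p : Fin n × stdSimplex ℝ (Fin 4)) v, 1 / 2 < p.2.1 v →
        F (Quot.mk _ p) = (linkInterpolation (c p.1 v) v p.2.1 : ℝ)) ∧
      ContinuousOn F {y | ∃ z ∈ T.closeVertices y, z.2 < 1} := by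
  classical
  let F' (p : Fin n × stdSimplex ℝ (Fin 4)) : AddCircle (1 : ℝ) :=
    -- At most one barycentric coordinate exceeds `1 / 2`, so the sum has at most one term; written
    -- as a sum it is visibly compatible with permuting the vertices.
    ∑ v, if 1 / 2 < p.2.1 v then ((linkInterpolation (c p.1 v) v p.2.1 : ℝ) : AddCircle (1 : ℝ))
      else 0
  have hF'v : ∀ (p : Fin n × stdSimplex ℝ (Fin 4)) v, 1 / 2 < p.2.1 v →
      F' p = (linkInterpolation (c p.1 v) v p.2.1 : ℝ) := by
    intro p v hv
    simp only [F']
    rw [Finset.sum_eq_single v, if_pos hv]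
    · intro w _ hw
      rw [if_neg]
      have h1 := p.2.2.2
      rw [← Finset.add_sum_erase _ _ (Finset.mem_univ v)] at h1
      have h2 : p.2.1 w ≤ ∑ u ∈ Finset.univ.erase v, p.2.1 u :=
        Finset.single_le_sum (f := p.2.1) (fun i _ => p.2.2.1 i) (by simp [hw])
      linarith
    · simp
  have hJ : ∀ i f v, ((T.jump q i f v : ℝ) : AddCircle (1 : ℝ)) = 0 := by
    intro i f v
    rw [AddCircle.coe_eq_zero_iff]
    unfold jump
    split
    · rename_i j g _
      refine ⟨m (i, quadSeparating v f) - m (j, quadSeparating (g v) (g f)), ?_⟩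
      rw [hm, hm]
      simp
    · exact ⟨0, by simp⟩
  have hF' : ∀ p p', T.PointIdent p p' → F' p = F' p' := by
    rintro p p' ⟨f, g, hg, hf, hx⟩
    simp only [F']
    rw [← Equiv.sum_comp g fun v => if 1 / 2 < p'.2.1 v then
      ((linkInterpolation (c p'.1 v) v p'.2.1 : ℝ) : AddCircle (1 : ℝ)) else 0]
    refine Finset.sum_congr rfl fun v _ => ?_
    rw [hx]
    by_cases hv : 1 / 2 < p.2.1 v
    · simp only [hv, if_true]
      -- At the vertex itself the division by zero gives the value 0 on both sides; no continuity is
      -- claimed there.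
      by_cases h1 : p.2.1 v = 1
      · rw [linkInterpolation_of_eq_one _ h1, linkInterpolation_of_eq_one]
        rwa [hx]
      · have hvf : v ≠ f := by
          rintro rfl
          linarith
        rw [linkInterpolation_of_glue (fun w => hc _ _ _ _ hg v w hvf) p.2.2 hf hx h1,
          AddCircle.coe_add, hJ, add_zero]
    · simp only [hv, if_false]
  refine ⟨Quot.lift F' hF', hF'v, ?_⟩
  rw [isQuotientMap_quot_mk.continuousOn_isOpen_iff T.isOpen_punctured_closeVertices]
  rintro p hp
  obtain ⟨_, ⟨v, hv, rfl⟩, h⟩ := hp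
  refine ContinuousAt.continuousWithinAt ?_
  have hS : {p' : Fin n × stdSimplex ℝ (Fin 4) | p'.1 = p.1 ∧ 1 / 2 < p'.2.1 v ∧ p'.2.1 v < 1} ∈
      nhds p := by
    refine IsOpen.mem_nhds (IsOpen.inter ?_ (IsOpen.inter ?_ ?_)) ⟨rfl, hv, h⟩
    · exact (isOpen_discrete {p.1}).preimage continuous_fst
    · exact isOpen_lt continuous_const (continuous_barycentricCoord v)
    · exact isOpen_lt (continuous_barycentricCoord v) continuous_const
  have hcont : ContinuousAt (fun p' : Fin n × stdSimplex ℝ (Fin 4) =>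
      ((linkInterpolation (c p.1 v) v p'.2.1 : ℝ) : AddCircle (1 : ℝ))) p := by
    have h1 : ContinuousAt (linkInterpolation (c p.1 v) v) p.2.1 := by
      refine (continuousOn_linkInterpolation _ v).continuousAt ?_
      refine IsOpen.mem_nhds (isOpen_ne_fun (by fun_prop) continuous_const) h.ne
    have h2 : ContinuousAt (fun p' : Fin n × stdSimplex ℝ (Fin 4) => p'.2.1) p := by fun_prop
    exact (AddCircle.continuous_mk' 1).continuousAt.comp (h1.comp_of_eq h2 rfl)
  refine hcont.congr ?_
  filter_upwards [hS] with p' hp'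
  show _ = F' p'
  rw [hF'v p' v hp'.2.1, hp'.1]

/-- In a manifold, a corner potential with integral jumps differs from a potential that is constant
on each triangle of the link of `V`: the link has trivial first cohomology. -/
theorem exists_potential_at_vertex (hT : T.IsCompactThreeManifoldTriangulation) {q : QuadVec n}
    {m : QuadCoord n → ℤ} (hm : ∀ p, q p = m p) {c : Fin n → Fin 4 → Fin 4 → ℝ}
    (hc : ∀ i f j g, T.glue i f = some (j, g) →
      ∀ v w, v ≠ f → w ≠ f → v ≠ w → c j (g v) (g w) = c i v w + T.jump q i f v)
    (V : T.Vertex) :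
    ∃ t : Fin n → Fin 4 → ℝ, ∀ i f j g, T.glue i f = some (j, g) → ∀ v, v ≠ f →
      Quot.mk _ (i, v) = V → t j (g v) = t i v + T.jump q i f v := by
  obtain ⟨F, hF, hFc⟩ := T.exists_circleMap hm hc
  obtain ⟨e, he⟩ := hT.locallyHalfSpace (T.vertexPoint V)
  have hVV : (V, (1 : ℝ)) ∈ T.closeVertices (T.vertexPoint V) :=
    T.one_mem_closeVertices_iff.2 rfl
  obtain ⟨B, hBU, hB, hyB, hlift⟩ := exists_addCircle_lift_punctured_halfBall
    (e (T.vertexPoint V)) (e.isOpen_inter_preimage_symm (T.isOpen_closeVertices V))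
    ⟨e.map_source he, 1, by rwa [e.left_inv he]⟩
  have hmaps : Set.MapsTo e.symm (B \ {e (T.vertexPoint V)})
      {y | ∃ z ∈ T.closeVertices y, z.2 < 1} := by
    rintro y ⟨hy, hne⟩
    obtain ⟨hyt, t, ht⟩ := hBU hy
    refine ⟨_, ht, ?_⟩
    have hle : t ≤ 1 := by
      generalize e.symm y = z at ht
      induction z using Quot.inductionOn with
      | h p =>
        obtain ⟨v, -, h⟩ := ht
        rw [Prod.mk.injEq] at h
        rw [h.2]
        exact (mem_Icc_of_mem_stdSimplex p.2.2 v).2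
    refine lt_of_le_of_ne hle fun h1 => hne ?_
    dsimp only at h1
    rw [h1] at ht
    rw [Set.mem_singleton_iff, ← T.one_mem_closeVertices_iff.1 ht, e.right_inv hyt]
  obtain ⟨G, hGc, hG⟩ := hlift (F ∘ e.symm) (hFc.comp
    (e.continuousOn_symm.mono fun y hy => (hBU hy.1).1) hmaps)
  have hOo : IsOpen (e.source ∩ e ⁻¹' B) := e.isOpen_inter_preimage hB
  -- Near corner `v` of tetrahedron `i`, the lift minus the interpolation is continuous and
  -- integer-valued on a convex set, hence equal to a constant `t`.
  have hcorner : ∀ i v, ∃ δ t : ℝ, 0 < δ ∧ δ ≤ 1 / 2 ∧ (Quot.mk _ (i, v) = V →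
      ∀ x : stdSimplex ℝ (Fin 4), 1 - δ < x.1 v → x.1 v < 1 →
        G (e (Quot.mk _ (i, x))) = linkInterpolation (c i v) v x.1 + t) := by
    intro i v
    by_cases hV : Quot.mk _ (i, v) = V
    swap
    · exact ⟨1 / 2, 0, by norm_num, le_rfl, fun h => (hV h).elim⟩
    let k : stdSimplex ℝ (Fin 4) → T.Realization := fun x => Quot.mk _ (i, x)
    have hk : Continuous k := continuous_quot_mk.comp (by fun_prop)
    let ev : stdSimplex ℝ (Fin 4) := ⟨Pi.single v 1, single_mem_stdSimplex ℝ v⟩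
    have hkv : k ev = T.vertexPoint V := by
      rw [← hV]
      rfl
    obtain ⟨δ, hδ, hball⟩ := Metric.isOpen_iff.1 (hOo.preimage hk) ev
      (by rw [Set.mem_preimage, hkv]; exact ⟨he, hyB⟩)
    set δ' := min δ (1 / 2) with hδ'
    have hδ'0 : 0 < δ' := lt_min hδ (by norm_num)
    let K : Set (stdSimplex ℝ (Fin 4)) := {x | 1 - δ' < x.1 v ∧ x.1 v < 1}
    have hKsub : ∀ x ∈ K, k x ∈ e.source ∧ e (k x) ∈ B \ {e (T.vertexPoint V)} := by
      intro x hx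
      have hxb : x ∈ Metric.ball ev δ := by
        rw [Metric.mem_ball, Subtype.dist_eq, dist_pi_lt_iff hδ]
        intro w
        rw [Real.dist_eq]
        have h1 := abs_sub_single_le_of_mem_stdSimplex x.2 v w
        have h2 := min_le_left δ (1 / 2)
        have h3 := hx.1
        refine h1.trans_lt ?_
        linarith
      refine ⟨(hball hxb).1, (hball hxb).2, fun h => ?_⟩
      have h1 : k x = T.vertexPoint V := e.injOn (hball hxb).1 he h
      rw [← one_mem_closeVertices_iff, mem_closeVertices_mk] at h1
      obtain ⟨v', -, h1⟩ := h1
      rw [Prod.mk.injEq] at h1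
      have h2 := eq_single_of_mem_stdSimplex x.2 h1.2.symm
      have h3 : x.1 v = _ := congrFun h2 v
      by_cases hvv : v = v'
      · rw [hvv, Pi.single_eq_same] at h3
        have := hx.2
        rw [hvv] at this
        linarith
      · rw [Pi.single_eq_of_ne hvv] at h3
        have := hx.1
        have h2 := min_le_right δ (1 / 2)
        linarith
    have hK : IsPreconnected K := by
      rw [← Topology.IsInducing.subtypeVal.isPreconnected_image]
      have : Subtype.val '' K = stdSimplex ℝ (Fin 4) ∩ {x | 1 - δ' < x v ∧ x v < 1} := by
        ext x
        constructor
        · rintro ⟨x, hx, rfl⟩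
          exact ⟨x.2, hx⟩
        · rintro ⟨h1, h2⟩
          exact ⟨⟨x, h1⟩, h2, rfl⟩
      rw [this]
      refine ((convex_stdSimplex ℝ (Fin 4)).inter ?_).isPreconnected
      exact (convex_Ioo (1 - δ') 1).is_linear_preimage (f := fun x : Fin 4 → ℝ => x v)
        ⟨fun _ _ => rfl, fun _ _ => rfl⟩
    have hcontK : ContinuousOn (fun x : stdSimplex ℝ (Fin 4) =>
        G (e (k x)) - linkInterpolation (c i v) v x.1) K := by
      refine ContinuousOn.sub ?_ ?_
      · refine hGc.comp (e.continuousOn.comp hk.continuousOn fun x hx => (hKsub x hx).1)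
          fun x hx => (hKsub x hx).2
      · exact (continuousOn_linkInterpolation _ v).comp continuous_subtype_val.continuousOn
          fun x hx => hx.2.ne
    have hz : ∀ x ∈ K, ((G (e (k x)) - linkInterpolation (c i v) v x.1 : ℝ) :
        AddCircle (1 : ℝ)) = 0 := by
      intro x hx
      rw [AddCircle.coe_sub, hG _ (hKsub x hx).2, Function.comp_apply,
        e.left_inv (hKsub x hx).1, hF (i, x) v, sub_self]
      have := hx.1
      have h2 := min_le_right δ (1 / 2)
      show 1 / 2 < x.1 v
      linarith
    obtain ⟨t, ht⟩ : ∃ t : ℝ, ∀ x ∈ K, G (e (k x)) - linkInterpolation (c i v) v x.1 = t := by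
      by_cases hne : K.Nonempty
      · obtain ⟨x₀, hx₀⟩ := hne
        exact ⟨_, fun x hx => hK.eq_of_addCircle_eq_zero hcontK hz hx hx₀⟩
      · exact ⟨0, fun x hx => (hne ⟨x, hx⟩).elim⟩
    refine ⟨δ', t, hδ'0, min_le_right _ _, fun _ x h1 h2 => ?_⟩
    have := ht x ⟨h1, h2⟩
    simp only [k] at this
    linarith
  choose δ t hδ0 hδ1 ht using hcorner
  -- The lift is single-valued across the face while the interpolation jumps, so `t` jumps by the
  -- negative amount. The two are compared at a point of the face `f`, on the edge from `v` to `w`,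
  -- close enough to `v` for both corners.
  refine ⟨fun i v => -t i v, fun i f j g hg v hv hV => ?_⟩
  obtain ⟨w, hwv, hwf⟩ : ∃ w : Fin 4, w ≠ v ∧ w ≠ f :=
    (by decide : ∀ v f : Fin 4, ∃ w, w ≠ v ∧ w ≠ f) v f
  set s := min (δ i v) (δ j (g v)) / 2 with hs
  have hm0 : 0 < min (δ i v) (δ j (g v)) := lt_min (hδ0 _ _) (hδ0 _ _)
  have hs1 : s < δ i v := by
    have := min_le_left (δ i v) (δ j (g v))
    linarith
  have hs2 : s < δ j (g v) := by
    have := min_le_right (δ i v) (δ j (g v))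
    linarith
  have hs0 : 0 < s := by linarith
  have hs3 : s ≤ 1 := by linarith [hδ1 i v]
  have hx : (1 - s) • (Pi.single v 1 : Fin 4 → ℝ) + s • Pi.single w 1 ∈ stdSimplex ℝ (Fin 4) :=
    convex_stdSimplex ℝ _ (single_mem_stdSimplex ℝ v) (single_mem_stdSimplex ℝ w)
      (by linarith) hs0.le (by ring)
  set x : Fin 4 → ℝ := (1 - s) • (Pi.single v 1 : Fin 4 → ℝ) + s • Pi.single w 1 with hxdef
  have hxv : x v = 1 - s := by simp [hxdef, Ne.symm hwv]
  have hxf : x f = 0 := by simp [hxdef, Ne.symm hv, Ne.symm hwf]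
  have hx' : x ∘ g.symm ∈ stdSimplex ℝ (Fin 4) := by
    refine ⟨fun u => hx.1 _, ?_⟩
    rw [← hx.2]
    exact Equiv.sum_comp g.symm x
  have hxx' : ∀ u, (x ∘ g.symm) (g u) = x u := fun u => by simp
  have hmk : (Quot.mk T.PointIdent (i, ⟨x, hx⟩)) = Quot.mk T.PointIdent (j, ⟨x ∘ g.symm, hx'⟩) :=
    Quot.sound ⟨f, g, hg, hxf, hxx'⟩
  have hVg : Quot.mk T.VertexIdent (j, g v) = V := by
    rw [← hV]
    exact (Quot.sound ⟨f, g, hg, hv, rfl⟩).symm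
  have h1 := ht i v hV ⟨x, hx⟩ (by simp only [hxv]; linarith) (by simp only [hxv]; linarith)
  have h2 := ht j (g v) hVg ⟨x ∘ g.symm, hx'⟩ (by simp only [hxx', hxv]; linarith)
    (by simp only [hxx', hxv]; linarith)
  have h3 := linkInterpolation_of_glue (fun u => hc _ _ _ _ hg v u hv) hx hxf hxx'
    (by rw [hxv]; linarith)
  rw [hmk] at h1
  simp only at h1 h2
  linarith

variable {T} in
theorem QuadMatching.exists_stdMatching_of_int (hT : T.IsCompactThreeManifoldTriangulation)
    {q : QuadVec n} (hq : T.QuadMatching q) {m : QuadCoord n → ℤ} (hm : ∀ p, q p = m p) :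
    ∃ w, T.StdMatching w ∧ quadProj w = q := by
  obtain ⟨c, hc⟩ := hq.exists_cornerPotential
  choose t ht using T.exists_potential_at_vertex hT hm hc
  refine ⟨fun p => Sum.elim (fun v => t (Quot.mk _ (p.1, v)) p.1 v) (fun k => q (p.1, k)) p.2,
    ?_, rfl⟩
  rw [stdMatching_iff_jump]
  intro i f j g hg v hv
  have hVg : Quot.mk T.VertexIdent (j, g v) = Quot.mk T.VertexIdent (i, v) :=
    (Quot.sound ⟨f, g, hg, hv, rfl⟩).symm
  simp only [Sum.elim_inl, hVg]
  exact ht _ i f j g hg v hv rfl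

/-! ### From integral to real quadrilateral solutions. -/

/-- The subspace of solutions of the standard matching equations. -/
def stdMatchingSubmodule : Submodule ℝ (StdVec n) where
  carrier := {w | T.StdMatching w}
  add_mem' := by
    intro a b ha hb i f j g hg v hv
    have h1 := ha i f j g hg v hv
    have h2 := hb i f j g hg v hv
    simp only [Pi.add_apply]
    linarith
  zero_mem' := by
    intro i f j g hg v hv
    simp
  smul_mem' := by
    intro r a ha i f j g hg v hv
    have h1 := ha i f j g hg v hv
    simp only [Pi.smul_apply, smul_eq_mul, ← mul_add, h1]

/-- The subspace of solutions of the quadrilateral matching equations. -/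
def quadMatchingSubmodule : Submodule ℝ (QuadVec n) where
  carrier := {q | T.QuadMatching q}
  add_mem' := by
    intro a b ha hb k c hc hs
    simp only [Pi.add_apply, Finset.sum_add_distrib, ha k c hc hs, hb k c hc hs]
  zero_mem' := by
    intro k c hc hs
    simp
  smul_mem' := by
    intro r a ha k c hc hs
    simp only [Pi.smul_apply, smul_eq_mul, ← Finset.mul_sum, ha k c hc hs]

/-- The quadrilateral projection as a linear map. -/
def quadProjLinear : StdVec n →ₗ[ℝ] QuadVec n where
  toFun := quadProj
  map_add' _ _ := rfl
  map_smul' _ _ := rfl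

variable {T} in
/-- Every solution of the quadrilateral matching equations extends to a solution of the standard
matching equations. -/
theorem QuadMatching.exists_stdMatching (hT : T.IsCompactThreeManifoldTriangulation)
    {q : QuadVec n} (hq : T.QuadMatching q) : ∃ w, T.StdMatching w ∧ quadProj w = q := by
  classical
  -- The equations have integer coefficients, so in a basis of `ℝ` over `ℚ` each component of `q`
  -- solves them rationally. Clearing denominators reduces to the integral case, and `q` is a finite
  -- real combination of its components.
  let b := Module.Basis.ofVectorSpace ℚ ℝ
  let S : Submodule ℝ (QuadVec n) := T.stdMatchingSubmodule.map quadProjLinear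
  suffices q ∈ S from this
  have hcoord : ∀ x, (fun p => ((b.repr (q p) x : ℚ) : ℝ)) ∈ S := by
    intro x
    obtain ⟨D, hD, hDm⟩ : ∃ D : ℕ, D ≠ 0 ∧ ∀ p, ∃ z : ℤ, (D : ℚ) * b.repr (q p) x = z := by
      refine ⟨∏ p, (b.repr (q p) x).den, ?_, fun p => ?_⟩
      · exact Finset.prod_ne_zero_iff.2 fun p _ => (b.repr (q p) x).den_nz
      · obtain ⟨k, hk⟩ := Finset.dvd_prod_of_mem (fun p => (b.repr (q p) x).den)
          (Finset.mem_univ p)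
        refine ⟨k * (b.repr (q p) x).num, ?_⟩
        rw [hk]
        push_cast
        rw [mul_comm ((b.repr (q p) x).den : ℚ), mul_assoc, mul_comm _ (b.repr (q p) x),
          Rat.mul_den_eq_num]
    choose z hz using hDm
    have hDr : (D : ℝ) ≠ 0 := by exact_mod_cast hD
    have hmatch : T.QuadMatching fun p => (z p : ℝ) := by
      intro k c hc hs
      have h := congrArg (fun y => (D : ℚ) * b.repr y x) (hq k c hc hs)
      simp only [map_sum, Finsupp.coe_finsetSum, Finset.sum_apply, Finset.mul_sum, hz] at h
      dsimp only
      exact_mod_cast h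
    have hmem : (fun p => (z p : ℝ)) ∈ S := hmatch.exists_stdMatching_of_int hT fun _ => rfl
    have : (fun p => ((b.repr (q p) x : ℚ) : ℝ)) = (D : ℝ)⁻¹ • fun p => (z p : ℝ) := by
      ext p
      have h : ((D : ℚ) * b.repr (q p) x : ℚ) = ((z p : ℤ) : ℚ) := hz p
      have h' : (D : ℝ) * ((b.repr (q p) x : ℚ) : ℝ) = (z p : ℝ) := by exact_mod_cast h
      rw [Pi.smul_apply, smul_eq_mul, ← h', inv_mul_cancel_left₀ hDr]
    rw [this]
    exact S.smul_mem _ hmem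
  have hq' : q = ∑ x ∈ Finset.univ.biUnion fun p => (b.repr (q p)).support,
      (b x) • fun p => ((b.repr (q p) x : ℚ) : ℝ) := by
    ext p
    rw [Finset.sum_apply]
    conv_lhs => rw [← b.linearCombination_repr (q p), Finsupp.linearCombination_apply, Finsupp.sum]
    refine Finset.sum_subset_zero_on_sdiff
      (Finset.subset_biUnion_of_mem (fun p => (b.repr (q p)).support) (Finset.mem_univ p)) ?_ ?_
    · intro x hx
      simp only [Finset.mem_sdiff, Finsupp.mem_support_iff, not_not] at hx
      simp [hx.2]
    · intro x _
      simp [Rat.smul_def, mul_comm]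
  rw [hq']
  exact S.sum_mem fun x _ => S.smul_mem _ (hcoord x)

end FaceGluing

/-! ### Extreme rays as vectors of minimal support, and the double description step. -/

section ExtremeRays

variable {ι : Type*} {W : Submodule ℝ (ι → ℝ)} {C C' : Set ι}

/-- `y` is a positive multiple of `x` on the coordinates in `C`. -/
def Proportional (C : Set ι) (y x : ι → ℝ) : Prop := ∃ a : ℝ, 0 < a ∧ ∀ i ∈ C, y i = a * x i

theorem Proportional.refl (C : Set ι) (x : ι → ℝ) : Proportional C x x := ⟨1, one_pos, by simp⟩

theorem Proportional.symm {x y : ι → ℝ} (h : Proportional C y x) : Proportional C x y := by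
  obtain ⟨a, ha, h⟩ := h
  exact ⟨a⁻¹, inv_pos.2 ha, fun i hi => by rw [h i hi, inv_mul_cancel_left₀ ha.ne']⟩

theorem Proportional.trans {x y z : ι → ℝ} (h : Proportional C x y) (h' : Proportional C y z) :
    Proportional C x z := by
  obtain ⟨a, ha, h⟩ := h
  obtain ⟨b, hb, h'⟩ := h'
  exact ⟨a * b, mul_pos ha hb, fun i hi => by rw [h i hi, h' i hi, mul_assoc]⟩

theorem Proportional.mono {x y : ι → ℝ} (h : Proportional C x y) (hC : C' ⊆ C) :
    Proportional C' x y := by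
  obtain ⟨a, ha, h⟩ := h
  exact ⟨a, ha, fun i hi => h i (hC hi)⟩

theorem Proportional.eq_zero {x y : ι → ℝ} (h : Proportional C x y) {i : ι} (hi : i ∈ C)
    (h0 : y i = 0) : x i = 0 := by
  obtain ⟨a, ha, h⟩ := h
  rw [h i hi, h0, mul_zero]

/-- `x` spans an extreme ray of the cone of all vectors of `W` that are non-negative on `C`,
modulo the vectors of `W` that vanish on `C`: it is a non-zero vector of minimal support. -/
structure IsExtremeOn (W : Submodule ℝ (ι → ℝ)) (C : Set ι) (x : ι → ℝ) : Prop where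
  mem : x ∈ W
  nonneg : ∀ i ∈ C, 0 ≤ x i
  nonzero : ∃ i ∈ C, x i ≠ 0
  minimal : ∀ y ∈ W, (∀ i ∈ C, 0 ≤ y i) → (∀ i ∈ C, x i = 0 → y i = 0) →
    ∃ a : ℝ, ∀ i ∈ C, y i = a * x i

theorem IsExtremeOn.proportional {x y : ι → ℝ} (hx : IsExtremeOn W C x) (hy : y ∈ W)
    (hy0 : ∀ i ∈ C, 0 ≤ y i) (hyx : ∀ i ∈ C, x i = 0 → y i = 0) (hne : ∃ i ∈ C, y i ≠ 0) :
    Proportional C y x := by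
  obtain ⟨a, ha⟩ := hx.minimal y hy hy0 hyx
  refine ⟨a, ?_, ha⟩
  obtain ⟨i, hi, hyi⟩ := hne
  have h1 := (hy0 i hi).lt_of_ne' hyi
  rw [ha i hi] at h1
  exact pos_of_mul_pos_left h1 (hx.nonneg i hi)

theorem IsExtremeOn.congr {x y : ι → ℝ} (hx : IsExtremeOn W C x) (hy : y ∈ W)
    (h : Proportional C y x) : IsExtremeOn W C y := by
  have h' := h.symm
  obtain ⟨a, ha, h⟩ := h
  refine ⟨hy, fun i hi => ?_, ?_, fun z hz hz0 hzy => ?_⟩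
  · rw [h i hi]
    exact mul_nonneg ha.le (hx.nonneg i hi)
  · obtain ⟨i, hi, hxi⟩ := hx.nonzero
    exact ⟨i, hi, by rw [h i hi]; exact mul_ne_zero ha.ne' hxi⟩
  · obtain ⟨b, hb⟩ := hx.minimal z hz hz0 fun i hi h0 => hzy i hi (by rw [h i hi, h0, mul_zero])
    obtain ⟨c, -, hc⟩ := h'
    exact ⟨b * c, fun i hi => by rw [hb i hi, hc i hi, mul_assoc]⟩

/-- If `β ≥ 0` the support of `u` lies in that of `z`; if `β < 0` the support of `z` lies in that of
`u`. Minimality applies either way. -/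
theorem IsExtremeOn.proportional_of_eq {z u w : ι → ℝ} (hz : IsExtremeOn W C z)
    (hu : IsExtremeOn W C u) (hw : ∀ i ∈ C, 0 ≤ w i) {s β : ℝ} (hs : 0 < s)
    (h : ∀ i ∈ C, z i = s * u i + β * w i) : Proportional C z u := by
  rcases le_or_gt 0 β with hβ | hβ
  · refine (hz.proportional hu.mem hu.nonneg (fun i hi h0 => ?_) hu.nonzero).symm
    have h1 := mul_nonneg hs.le (hu.nonneg i hi)
    have h2 := mul_nonneg hβ (hw i hi)
    have h3 : s * u i = 0 := by linarith [h i hi]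
    exact (mul_eq_zero.1 h3).resolve_left hs.ne'
  · refine hu.proportional hz.mem hz.nonneg (fun i hi h0 => ?_) hz.nonzero
    have h1 := mul_nonneg (neg_nonneg.2 hβ.le) (hw i hi)
    have h2 := h i hi
    rw [h0] at h2
    linarith [hz.nonneg i hi]

/-- The ratio test: the largest admissible multiple of `y` removes a position from the support of
`x`, which drives the inductions on support size. -/
theorem exists_max_smul_le [Finite ι] {x y : ι → ℝ} (hx : ∀ i ∈ C, 0 ≤ x i) (hy : ∀ i ∈ C, 0 ≤ y i)
    (hyx : ∀ i ∈ C, x i = 0 → y i = 0) (hne : ∃ i ∈ C, y i ≠ 0) :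
    ∃ t : ℝ, 0 < t ∧ (∀ i ∈ C, 0 ≤ x i - t * y i) ∧ ∃ i ∈ C, y i ≠ 0 ∧ x i - t * y i = 0 := by
  obtain ⟨i, ⟨hi, hyi⟩, hmin⟩ := Set.exists_min_image {i | i ∈ C ∧ y i ≠ 0} (fun i => x i / y i)
    (Set.toFinite _) hne
  have hyi' := (hy i hi).lt_of_ne' hyi
  have hxi' := (hx i hi).lt_of_ne' fun h => hyi (hyx i hi h)
  refine ⟨x i / y i, div_pos hxi' hyi', fun j hj => ?_, i, hi, hyi, ?_⟩
  · by_cases hyj : y j = 0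
    · rw [hyj, mul_zero, sub_zero]
      exact hx j hj
    · have := hmin j ⟨hj, hyj⟩
      rw [le_div_iff₀ ((hy j hj).lt_of_ne' hyj)] at this
      linarith
  · rw [div_mul_cancel₀ _ hyi, sub_self]

theorem ncard_support_lt [Finite ι] {x y : ι → ℝ} (hyx : ∀ i ∈ C, x i = 0 → y i = 0) {i : ι} (hi : i ∈ C)
    (hxi : x i ≠ 0) (hyi : y i = 0) :
    {i | i ∈ C ∧ y i ≠ 0}.ncard < {i | i ∈ C ∧ x i ≠ 0}.ncard := by
  refine Set.ncard_lt_ncard ⟨fun j hj => ⟨hj.1, fun h => hj.2 (hyx j hj.1 h)⟩, fun h => ?_⟩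
    (Set.toFinite _)
  exact (h ⟨hi, hxi⟩ : i ∈ C ∧ y i ≠ 0).2 hyi

/-- If `x` is not minimal, some `y` in its face is no multiple of `x`. Subtracting the largest
possible multiple of `y` leaves a non-zero vector of smaller support. -/
theorem exists_isExtremeOn [Finite ι] {x : ι → ℝ} (hx : x ∈ W) (hx0 : ∀ i ∈ C, 0 ≤ x i)
    (hne : ∃ i ∈ C, x i ≠ 0) :
    ∃ z, IsExtremeOn W C z ∧ ∀ i ∈ C, x i = 0 → z i = 0 := by
  induction hk : {i | i ∈ C ∧ x i ≠ 0}.ncard using Nat.strong_induction_on generalizing x with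
  | h k ih =>
    subst hk
    by_cases hE : IsExtremeOn W C x
    · exact ⟨x, hE, fun _ _ h => h⟩
    obtain ⟨y, hy, hy0, hyx, hya⟩ : ∃ y ∈ W, (∀ i ∈ C, 0 ≤ y i) ∧
        (∀ i ∈ C, x i = 0 → y i = 0) ∧ ∀ a : ℝ, ∃ i ∈ C, y i ≠ a * x i := by
      by_contra hcon
      push Not at hcon
      exact hE ⟨hx, hx0, hne, hcon⟩
    have hyne : ∃ i ∈ C, y i ≠ 0 := by simpa using hya 0
    obtain ⟨t, ht, h0, i, hi, hyi, hti⟩ := exists_max_smul_le hx0 hy0 hyx hyne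
    have hsupp : ∀ i ∈ C, x i = 0 → (x - t • y) i = 0 := fun i hi h => by simp [h, hyx i hi h]
    have hne' : ∃ i ∈ C, (x - t • y) i ≠ 0 := by
      obtain ⟨j, hj, hjne⟩ := hya t⁻¹
      refine ⟨j, hj, fun h => hjne ?_⟩
      have : x j = t * y j := by
        simp at h
        linarith
      rw [this, inv_mul_cancel_left₀ ht.ne']
    obtain ⟨z, hz, hzx⟩ := ih _ (ncard_support_lt (y := x - t • y) hsupp hi
      (fun h => hyi (hyx i hi h)) (by simpa using hti)) (W.sub_mem hx (W.smul_mem t hy))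
      (by simpa using h0) hne' rfl
    exact ⟨z, hz, fun i hi h => hzx i hi (hsupp i hi h)⟩

/-- A vector of the cone is a non-negative combination of extreme vectors supported on its
support, modulo vectors that vanish on `C`. -/
theorem isExtremeOn_induction [Finite ι] {D : (ι → ℝ) → Prop} {x : ι → ℝ} (hx : x ∈ W)
    (hx0 : ∀ i ∈ C, 0 ≤ x i) (zero : ∀ y ∈ W, (∀ i ∈ C, y i = 0) → D y)
    (ext : ∀ z, IsExtremeOn W C z → (∀ i ∈ C, x i = 0 → z i = 0) → D z)
    (add : ∀ y z (t : ℝ), 0 < t → D y → D z → D (y + t • z)) : D x := by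
  induction hk : {i | i ∈ C ∧ x i ≠ 0}.ncard using Nat.strong_induction_on generalizing x with
  | h k ih =>
    subst hk
    by_cases hne : ∃ i ∈ C, x i ≠ 0
    swap
    · push Not at hne
      exact zero x hx hne
    obtain ⟨z, hz, hzx⟩ := exists_isExtremeOn hx hx0 hne
    obtain ⟨t, ht, h0, i, hi, hzi, hti⟩ := exists_max_smul_le hx0 hz.nonneg hzx hz.nonzero
    have hsupp : ∀ i ∈ C, x i = 0 → (x - t • z) i = 0 := fun i hi h => by simp [h, hzx i hi h]
    have := ih _ (ncard_support_lt (y := x - t • z) hsupp hi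
      (fun h => hzi (hzx i hi h)) (by simpa using hti)) (W.sub_mem hx (W.smul_mem t hz.mem))
      (by simpa using h0) (fun z' hz' h => ext z' hz' fun i hi hxi => h i hi (hsupp i hi hxi)) rfl
    simpa using add _ _ t ht this (ext z hz hzx)

/-- If the only extreme vectors supported on the supports of `u` and `w` are `u` and `w`, then
every vector of the cone supported there is a combination of `u` and `w`. -/
theorem exists_eq_add_of_adjacent [Finite ι] {u w y : ι → ℝ} (hy : y ∈ W) (hy0 : ∀ i ∈ C, 0 ≤ y i)
    (hyuw : ∀ i ∈ C, u i = 0 → w i = 0 → y i = 0)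
    (hadj : ∀ z, IsExtremeOn W C z → (∀ i ∈ C, u i = 0 → w i = 0 → z i = 0) →
      Proportional C z u ∨ Proportional C z w) :
    ∃ a b : ℝ, ∀ i ∈ C, y i = a * u i + b * w i := by
  refine isExtremeOn_induction (D := fun y => ∃ a b : ℝ, ∀ i ∈ C, y i = a * u i + b * w i) hy hy0
    (fun y _ h => ⟨0, 0, fun i hi => by simp [h i hi]⟩) (fun z hz hzy => ?_) ?_
  · rcases hadj z hz (fun i hi h1 h2 => hzy i hi (hyuw i hi h1 h2)) with ⟨a, -, h⟩ | ⟨a, -, h⟩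
    · exact ⟨a, 0, fun i hi => by simp [h i hi]⟩
    · exact ⟨0, a, fun i hi => by simp [h i hi]⟩
  · rintro y z t - ⟨a, b, h⟩ ⟨a', b', h'⟩
    refine ⟨a + t * a', b + t * b', fun i hi => ?_⟩
    simp only [Pi.add_apply, Pi.smul_apply, smul_eq_mul, h i hi, h' i hi]
    ring

/-- The point where the segment between `u` and `w` meets the hyperplane `x p = 0`. -/
noncomputable def hyperplanePoint (p : ι) (u w : ι → ℝ) : ι → ℝ :=
  (u p - w p)⁻¹ • (u p • w - w p • u)

theorem hyperplanePoint_spec {p : ι} {u w : ι → ℝ} (hu : 0 < u p) (hw : w p < 0) :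
    hyperplanePoint p u w p = 0 ∧
      ∃ a b : ℝ, 0 < a ∧ 0 < b ∧ ∀ i, hyperplanePoint p u w i = a * u i + b * w i := by
  have h : 0 < u p - w p := by linarith
  refine ⟨?_, (u p - w p)⁻¹ * (-w p), (u p - w p)⁻¹ * u p, ?_, ?_, fun i => ?_⟩
  · simp [hyperplanePoint, mul_comm]
  · exact mul_pos (inv_pos.2 h) (by linarith)
  · exact mul_pos (inv_pos.2 h) hu
  · simp only [hyperplanePoint, Pi.smul_apply, Pi.sub_apply, smul_eq_mul]
    ring

theorem hyperplanePoint_self {p : ι} {u w : ι → ℝ} (hu : 0 < u p) (hw : w p < 0) :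
    hyperplanePoint p u w p = 0 :=
  (hyperplanePoint_spec hu hw).1

theorem hyperplanePoint_mem {p : ι} {u w : ι → ℝ} (hu : u ∈ W) (hw : w ∈ W) :
    hyperplanePoint p u w ∈ W :=
  W.smul_mem _ (W.sub_mem (W.smul_mem _ hw) (W.smul_mem _ hu))

theorem hyperplanePoint_nonneg {p : ι} {u w : ι → ℝ} (hu : 0 < u p) (hw : w p < 0)
    (hu0 : ∀ i ∈ C, 0 ≤ u i) (hw0 : ∀ i ∈ C, 0 ≤ w i) :
    ∀ i ∈ insert p C, 0 ≤ hyperplanePoint p u w i := by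
  obtain ⟨h0, a, b, ha, hb, h⟩ := hyperplanePoint_spec hu hw
  rintro i (rfl | hi)
  · rw [h0]
  · rw [h]
    exact add_nonneg (mul_nonneg ha.le (hu0 i hi)) (mul_nonneg hb.le (hw0 i hi))

theorem hyperplanePoint_eq_zero {p : ι} {u w : ι → ℝ} {i : ι}
    (hui : u i = 0) (hwi : w i = 0) : hyperplanePoint p u w i = 0 := by
  simp [hyperplanePoint, hui, hwi]

theorem eq_zero_of_hyperplanePoint_eq_zero {p : ι} {u w : ι → ℝ} (hu : 0 < u p) (hw : w p < 0)
    {i : ι} (hui : 0 ≤ u i) (hwi : 0 ≤ w i) (h0 : hyperplanePoint p u w i = 0) :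
    u i = 0 ∧ w i = 0 := by
  obtain ⟨-, a, b, ha, hb, h⟩ := hyperplanePoint_spec hu hw
  rw [h] at h0
  have h1 := mul_nonneg ha.le hui
  have h2 := mul_nonneg hb.le hwi
  exact ⟨(mul_eq_zero.1 (by linarith : a * u i = 0)).resolve_left ha.ne',
    (mul_eq_zero.1 (by linarith : b * w i = 0)).resolve_left hb.ne'⟩

/-- The intersection of the hyperplane `x p = 0` with a two-dimensional face spans an extreme
ray of the new cone. -/
theorem isExtremeOn_hyperplanePoint {p : ι} (hp : ∀ x ∈ W, (∀ i ∈ C, x i = 0) → x p = 0)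
    {u w : ι → ℝ} (huW : u ∈ W) (hwW : w ∈ W) (hu0 : ∀ i ∈ C, 0 ≤ u i) (hw0 : ∀ i ∈ C, 0 ≤ w i)
    (hune : ∃ i ∈ C, u i ≠ 0) (hu : 0 < u p) (hw : w p < 0)
    (hspan : ∀ y ∈ W, (∀ i ∈ C, 0 ≤ y i) → (∀ i ∈ C, u i = 0 → w i = 0 → y i = 0) →
      ∃ a b : ℝ, ∀ i ∈ C, y i = a * u i + b * w i) :
    IsExtremeOn W (insert p C) (hyperplanePoint p u w) := by
  refine ⟨hyperplanePoint_mem huW hwW, hyperplanePoint_nonneg hu hw hu0 hw0, ?_, ?_⟩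
  · obtain ⟨i, hi, hui⟩ := hune
    refine ⟨i, Or.inr hi, fun h => hui ?_⟩
    exact (eq_zero_of_hyperplanePoint_eq_zero hu hw (hu0 i hi) (hw0 i hi) h).1
  · intro y hy hy0 hyv
    have hyp : y p = 0 := hyv p (Or.inl rfl) (hyperplanePoint_self hu hw)
    obtain ⟨a, b, hab⟩ := hspan y hy (fun i hi => hy0 i (Or.inr hi)) fun i hi h1 h2 =>
      hyv i (Or.inr hi) (hyperplanePoint_eq_zero h1 h2)
    have h1 := hp (y - (a • u + b • w))
      (W.sub_mem hy (W.add_mem (W.smul_mem _ huW) (W.smul_mem _ hwW)))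
      fun i hi => by simp [hab i hi]
    simp only [Pi.sub_apply, Pi.add_apply, Pi.smul_apply, smul_eq_mul, hyp] at h1
    have hup := hu.ne'
    have hd : u p - w p ≠ 0 := by linarith
    -- The factor is read off from the coefficient of `w`; the coefficient of `u` then agrees
    -- because `a * u p + b * w p = 0`.
    refine ⟨b * (u p - w p) / u p, ?_⟩
    rintro i (rfl | hi)
    · rw [hyp, hyperplanePoint_self hu hw, mul_zero]
    · rw [hab i hi]
      simp only [hyperplanePoint, Pi.smul_apply, Pi.sub_apply, smul_eq_mul]
      field_simp
      linear_combination (-u i) * h1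

/-- Extreme rays on the non-negative side of the hyperplane remain extreme. -/
theorem IsExtremeOn.to_insert {p : ι} (hp : ∀ x ∈ W, (∀ i ∈ C, x i = 0) → x p = 0) {x : ι → ℝ}
    (hx : IsExtremeOn W C x) (hxp : 0 ≤ x p) : IsExtremeOn W (insert p C) x := by
  refine ⟨hx.mem, ?_, ?_, fun y hy hy0 hyx => ?_⟩
  · rintro i (rfl | hi)
    exacts [hxp, hx.nonneg i hi]
  · obtain ⟨i, hi, h⟩ := hx.nonzero
    exact ⟨i, Or.inr hi, h⟩
  · obtain ⟨a, ha⟩ := hx.minimal y hy (fun i hi => hy0 i (Or.inr hi))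
      fun i hi => hyx i (Or.inr hi)
    refine ⟨a, ?_⟩
    rintro i (rfl | hi)
    · have := hp (y - a • x) (W.sub_mem hy (W.smul_mem _ hx.mem)) fun i hi => by simp [ha i hi]
      simpa [sub_eq_zero] using this
    · exact ha i hi

/-- The hypothesis `hp` says that, on `W`, coordinate `p` is determined by the coordinates in `C`,
so relations on `C` persist at `p`. -/
theorem Proportional.to_insert {p : ι} (hp : ∀ x ∈ W, (∀ i ∈ C, x i = 0) → x p = 0) {x y : ι → ℝ}
    (hx : x ∈ W) (hy : y ∈ W) (h : Proportional C y x) : Proportional (insert p C) y x := by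
  obtain ⟨a, ha, h⟩ := h
  refine ⟨a, ha, ?_⟩
  rintro i (rfl | hi)
  · have := hp (y - a • x) (W.sub_mem hy (W.smul_mem _ hx)) fun i hi => by simp [h i hi]
    simpa [sub_eq_zero] using this
  · exact h i hi

theorem hyperplanePoint_comm (p : ι) (u w : ι → ℝ) :
    hyperplanePoint p u w = hyperplanePoint p w u := by
  rw [hyperplanePoint, hyperplanePoint, ← neg_sub (w p), ← neg_sub (w p • u), inv_neg, neg_smul,
    smul_neg, neg_neg]

/-- Two extreme vectors on the same side of the hyperplane with proportional intersection points
are proportional. -/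
theorem IsExtremeOn.proportional_of_hyperplanePoint {p : ι} {z u w : ι → ℝ}
    (hz : IsExtremeOn W C z) (hu : IsExtremeOn W C u) (hw0 : ∀ i ∈ C, 0 ≤ w i) (hwp : w p ≠ 0)
    (hpos : 0 < (z p - w p) / (u p - w p))
    (h : Proportional C (hyperplanePoint p z w) (hyperplanePoint p u w)) :
    Proportional C z u := by
  obtain ⟨a, ha, h⟩ := h
  have hd1 : z p - w p ≠ 0 := fun h => by simp [h] at hpos
  have hd2 : u p - w p ≠ 0 := fun h => by simp [h] at hpos
  -- The constants come from solving the proportionality of the two intersection points for `z`;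
  -- lying on the same side makes the coefficient of `u` positive.
  refine hz.proportional_of_eq hu hw0 (s := a * ((z p - w p) / (u p - w p)))
    (β := (z p - a * ((z p - w p) / (u p - w p)) * u p) / w p) (mul_pos ha hpos) fun i hi => ?_
  have h1 := h i hi
  simp only [hyperplanePoint, Pi.smul_apply, Pi.sub_apply, smul_eq_mul] at h1
  field_simp at h1 ⊢
  linear_combination (-1 : ℝ) * h1

/-- Every extreme ray of the new cone is an extreme ray of the old one, or the intersection of the
hyperplane with the face spanned by two adjacent extreme rays of the old cone. -/
theorem IsExtremeOn.of_insert [Finite ι] {p : ι} (hp : ∀ x ∈ W, (∀ i ∈ C, x i = 0) → x p = 0) {v : ι → ℝ}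
    (hv : IsExtremeOn W (insert p C) v) :
    IsExtremeOn W C v ∨ ∃ u w, IsExtremeOn W C u ∧ IsExtremeOn W C w ∧ 0 < u p ∧ w p < 0 ∧
      v p = 0 ∧ (∀ i ∈ C, v i = 0 → u i = 0 ∧ w i = 0) ∧
      ∀ z, IsExtremeOn W C z → (∀ i ∈ C, v i = 0 → z i = 0) →
        Proportional C z u ∨ Proportional C z w := by
  by_cases hE : IsExtremeOn W C v
  · exact Or.inl hE
  right
  have hv0 : ∀ i ∈ C, 0 ≤ v i := fun i hi => hv.nonneg i (Or.inr hi)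
  have hvp : 0 ≤ v p := hv.nonneg p (Or.inl rfl)
  have hvne : ¬ ∀ i ∈ C, v i = 0 := by
    intro hcon
    obtain ⟨i, rfl | hi, h⟩ := hv.nonzero
    · exact h (hp v hv.mem hcon)
    · exact h (hcon i hi)
  -- An old extreme ray that lies in the face of `v` for the new cone would be proportional to `v`,
  -- making `v` an old extreme ray.
  have hno : ∀ z, IsExtremeOn W C z → (∀ i ∈ C, v i = 0 → z i = 0) →
      ¬ (0 ≤ z p ∧ (v p = 0 → z p = 0)) := by
    rintro z hz hzv ⟨h1, h2⟩
    have : Proportional (insert p C) z v := by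
      refine hv.proportional hz.mem ?_ ?_ ?_
      · rintro i (rfl | hi)
        exacts [h1, hz.nonneg i hi]
      · rintro i (rfl | hi)
        exacts [h2, hzv i hi]
      · obtain ⟨i, hi, h⟩ := hz.nonzero
        exact ⟨i, Or.inr hi, h⟩
    exact hE (hz.congr hv.mem (this.symm.mono fun i hi => Or.inr hi))
  -- Otherwise, by `hno`, all old extreme rays in the face are strictly negative at `p`. Then so is
  -- their combination `v`, unless it vanishes on `C`; both are impossible. The negative ray `w` is
  -- found symmetrically, once `v p = 0` is known.
  obtain ⟨u, hu, huv, hup⟩ : ∃ u, IsExtremeOn W C u ∧ (∀ i ∈ C, v i = 0 → u i = 0) ∧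
      0 < u p := by
    by_contra hcon
    push Not at hcon
    have := isExtremeOn_induction (D := fun y => y p < 0 ∨ (y p = 0 ∧ ∀ i ∈ C, y i = 0)) hv.mem hv0
      (fun y hy h => Or.inr ⟨hp y hy h, h⟩) (fun z hz hzv => ?_) ?_
    · exact this.elim (fun h => by linarith) fun h => hvne h.2
    · refine Or.inl (lt_of_le_of_ne (hcon z hz hzv) fun h => ?_)
      exact hno z hz hzv ⟨h.ge, fun _ => h⟩
    · rintro y z t ht (hy | ⟨hy, hy'⟩) (hz | ⟨hz, hz'⟩) <;>
        simp only [Pi.add_apply, Pi.smul_apply, smul_eq_mul]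
      · exact Or.inl (by linarith [mul_neg_of_pos_of_neg ht hz])
      · exact Or.inl (by simpa [hz])
      · exact Or.inl (by linarith [mul_neg_of_pos_of_neg ht hz])
      · exact Or.inr ⟨by simp [hy, hz], fun i hi => by simp [hy' i hi, hz' i hi]⟩
  have hvp0 : v p = 0 := by
    by_contra h
    exact hno u hu huv ⟨hup.le, fun h' => (h h').elim⟩
  obtain ⟨w, hw, hwv, hwp⟩ : ∃ w, IsExtremeOn W C w ∧ (∀ i ∈ C, v i = 0 → w i = 0) ∧
      w p < 0 := by
    by_contra hcon
    push Not at hcon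
    have := isExtremeOn_induction (D := fun y => 0 < y p ∨ (y p = 0 ∧ ∀ i ∈ C, y i = 0)) hv.mem hv0
      (fun y hy h => Or.inr ⟨hp y hy h, h⟩) (fun z hz hzv => ?_) ?_
    · exact this.elim (fun h => by linarith) fun h => hvne h.2
    · refine Or.inl (lt_of_le_of_ne (hcon z hz hzv) fun h => ?_)
      exact hno z hz hzv ⟨h.le, fun _ => h.symm⟩
    · rintro y z t ht (hy | ⟨hy, hy'⟩) (hz | ⟨hz, hz'⟩) <;>
        simp only [Pi.add_apply, Pi.smul_apply, smul_eq_mul]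
      · exact Or.inl (by linarith [mul_pos ht hz])
      · exact Or.inl (by simpa [hz])
      · exact Or.inl (by linarith [mul_pos ht hz])
      · exact Or.inr ⟨by simp [hy, hz], fun i hi => by simp [hy' i hi, hz' i hi]⟩
  -- Every pair on opposite sides in the face cuts the hyperplane in the ray of `v`. Hence there is
  -- only one ray on each side, which is the adjacency asserted.
  have hcomb : ∀ u w, IsExtremeOn W C u → IsExtremeOn W C w → 0 < u p → w p < 0 →
      (∀ i ∈ C, v i = 0 → u i = 0) → (∀ i ∈ C, v i = 0 → w i = 0) →
      Proportional C (hyperplanePoint p u w) v := by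
    intro u w hu hw hup hwp huv hwv
    refine Proportional.mono (C := insert p C) ?_ fun i hi => Or.inr hi
    refine hv.proportional (hyperplanePoint_mem hu.mem hw.mem)
      (hyperplanePoint_nonneg hup hwp hu.nonneg hw.nonneg) ?_ ?_
    · rintro i (rfl | hi) h
      · exact hyperplanePoint_self hup hwp
      · exact hyperplanePoint_eq_zero (huv i hi h) (hwv i hi h)
    · obtain ⟨i, hi, h⟩ := hu.nonzero
      exact ⟨i, Or.inr hi, fun h' => h (eq_zero_of_hyperplanePoint_eq_zero hup hwp
        (hu.nonneg i hi) (hw.nonneg i hi) h').1⟩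
  have huwv := hcomb u w hu hw hup hwp huv hwv
  refine ⟨u, w, hu, hw, hup, hwp, hvp0, fun i hi h => ⟨huv i hi h, hwv i hi h⟩,
    fun z hz hzv => ?_⟩
  rcases lt_trichotomy (z p) 0 with hzp | hzp | hzp
  · right
    refine hz.proportional_of_hyperplanePoint hw hu.nonneg hup.ne'
      (div_pos_of_neg_of_neg (by linarith) (by linarith)) ?_
    rw [hyperplanePoint_comm p z, hyperplanePoint_comm p w]
    exact (hcomb u z hu hz hup hzp huv hzv).trans huwv.symm
  · exact (hno z hz hzv ⟨hzp.ge, fun _ => hzp⟩).elim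
  · left
    exact hz.proportional_of_hyperplanePoint hu hw.nonneg hwp.ne
      (div_pos (by linarith) (by linarith)) ((hcomb z w hz hw hzp hwp hzv hwv).trans huwv.symm)

end ExtremeRays

/-! ### Quadrilateral constraints depend only on supports. -/

section QuadConstraints

variable {n : ℕ}

theorem mem_quadPositions (i : Fin n) (k : Fin 3) : (i, Sum.inr k) ∈ quadPositions n := ⟨i, k, rfl⟩

theorem QuadConstraints.of_support {v z : StdVec n} (hv : QuadConstraints (quadProj v))
    (h : ∀ p ∈ quadPositions n, v p = 0 → z p = 0) : QuadConstraints (quadProj z) :=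
  fun i k k' hk hk' => hv i k k' (fun h0 => hk (h _ (mem_quadPositions i k) h0))
    fun h0 => hk' (h _ (mem_quadPositions i k') h0)

theorem QuadConstraints.quadCompatible {v u w : StdVec n} (hv : QuadConstraints (quadProj v))
    (hu : ∀ p ∈ quadPositions n, v p = 0 → u p = 0)
    (hw : ∀ p ∈ quadPositions n, v p = 0 → w p = 0) : QuadCompatible u w := by
  intro i
  obtain ⟨k, k', hne, hk, hk'⟩ : ∃ k k' : Fin 3, k ≠ k' ∧ v (i, Sum.inr k) = 0 ∧
      v (i, Sum.inr k') = 0 := by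
    have key : ∀ k k', k ≠ k' → v (i, Sum.inr k) = 0 ∨ v (i, Sum.inr k') = 0 := by
      intro k k' hne
      by_contra hcon
      push Not at hcon
      exact hne (hv i k k' hcon.1 hcon.2)
    rcases key 0 1 (by decide) with h | h
    · rcases key 1 2 (by decide) with h' | h'
      · exact ⟨0, 1, by decide, h, h'⟩
      · exact ⟨0, 2, by decide, h, h'⟩
    · rcases key 0 2 (by decide) with h' | h'
      · exact ⟨1, 0, by decide, h, h'⟩
      · exact ⟨1, 2, by decide, h, h'⟩
  exact ⟨k, k', hne, ⟨hu _ (mem_quadPositions i k) hk, hw _ (mem_quadPositions i k) hk⟩,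
    hu _ (mem_quadPositions i k') hk', hw _ (mem_quadPositions i k') hk'⟩

theorem QuadCompatible.quadConstraints {u w z : StdVec n} (h : QuadCompatible u w)
    (hz : ∀ p ∈ quadPositions n, u p = 0 → w p = 0 → z p = 0) : QuadConstraints (quadProj z) := by
  intro i k k' hk hk'
  obtain ⟨a, b, hab, ha, hb⟩ := h i
  have h1 : z (i, Sum.inr a) = 0 := hz _ (mem_quadPositions i a) ha.1 ha.2
  have h2 : z (i, Sum.inr b) = 0 := hz _ (mem_quadPositions i b) hb.1 hb.2
  have ka : k ≠ a := by rintro rfl; exact hk h1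
  have kb : k ≠ b := by rintro rfl; exact hk h2
  have ka' : k' ≠ a := by rintro rfl; exact hk' h1
  have kb' : k' ≠ b := by rintro rfl; exact hk' h2
  have : ∀ a b k k' : Fin 3, a ≠ b → k ≠ a → k ≠ b → k' ≠ a → k' ≠ b → k = k' := by decide
  exact this a b k k' hab ka kb ka' kb'

end QuadConstraints

/-! ### One position: no duplicates or proportional vectors arise. -/

section ProcessPosition

variable {n : ℕ} {W : Submodule ℝ (StdVec n)} {C : Set (StdCoord n)} {L : List (StdVec n)}

theorem PairCondition.eq_or_eq {u w z : StdVec n} (h : PairCondition C L u w) (hz : z ∈ L)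
    (hzuw : ∀ i ∈ C, u i = 0 → w i = 0 → z i = 0) : z = u ∨ z = w := by
  by_contra hcon
  push Not at hcon
  exact h.2 ⟨z, hz, hcon.1, hcon.2, hzuw⟩

theorem mem_processPosition {p : StdCoord n} {v : StdVec n} :
    v ∈ (processPosition (C, L) p).2 ↔ (v ∈ L ∧ 0 ≤ v p) ∨
      ∃ u ∈ L, ∃ w ∈ L, 0 < u p ∧ w p < 0 ∧ PairCondition C L u w ∧ v = hyperplanePoint p u w := by
  simp only [processPosition, List.mem_append, List.mem_filter, List.mem_map, decide_eq_true_eq,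
    List.pair_mem_product, Prod.exists]
  constructor
  · rintro ((⟨h, h0⟩ | ⟨h, h0⟩) | ⟨u, w, ⟨⟨⟨hu, hup⟩, hw, hwp⟩, hc⟩, rfl⟩)
    · exact Or.inl ⟨h, h0.ge⟩
    · exact Or.inl ⟨h, h0.le⟩
    · exact Or.inr ⟨u, hu, w, hw, hup, hwp, hc, rfl⟩
  · rintro (⟨h, h0⟩ | ⟨u, hu, w, hw, hup, hwp, hc, rfl⟩)
    · rcases h0.eq_or_lt with h0 | h0
      · exact Or.inl (Or.inl ⟨h, h0.symm⟩)
      · exact Or.inl (Or.inr ⟨h, h0⟩)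
    · exact Or.inr ⟨u, w, ⟨⟨⟨hu, hup⟩, hw, hwp⟩, hc⟩, rfl⟩

/-- The basic properties of the list of vectors in the course of the algorithm: it consists of
vectors of the cone that satisfy the quadrilateral constraints, no two of them proportional. -/
structure IsConeList (W : Submodule ℝ (StdVec n)) (C : Set (StdCoord n)) (L : List (StdVec n)) :
    Prop where
  nodup : L.Nodup
  mem : ∀ z ∈ L, z ∈ W
  nonneg : ∀ z ∈ L, ∀ i ∈ C, 0 ≤ z i
  quad : ∀ z ∈ L, QuadConstraints (quadProj z)
  inj : ∀ z ∈ L, ∀ z' ∈ L, Proportional C z z' → z = z'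

theorem PairCondition.eq_or_eq_of_hyperplanePoint {p : StdCoord n} {u w z : StdVec n}
    (hc : PairCondition C L u w) (hz : z ∈ L) (hzv : ∀ i ∈ C, hyperplanePoint p u w i = 0 → z i = 0) :
    z = u ∨ z = w :=
  hc.eq_or_eq hz fun i hi h1 h2 => hzv i hi (hyperplanePoint_eq_zero h1 h2)

/-- Only the combinatorial condition on pairs is used, not extremality, so the lemma applies
although intermediate lists may contain non-extreme vectors. -/
theorem IsConeList.process (h : IsConeList W C L)
    (p : StdCoord n) : IsConeList W (insert p C) (processPosition (C, L) p).2 := by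
  -- An old vector proportional to a new one is supported in the face of `u, w`, so it is `u` or
  -- `w`; but it vanishes at `p`.
  have hold : ∀ u ∈ L, ∀ w ∈ L, ∀ z ∈ L, 0 < u p → w p < 0 → PairCondition C L u w →
      0 ≤ z p → ¬ ∃ a : ℝ, a ≠ 0 ∧ ∀ i ∈ insert p C, z i = a * hyperplanePoint p u w i := by
    rintro u hu w hw z hz hup hwp hc hzp ⟨a, ha, hza⟩
    have hz0 : z p = 0 := by
      rw [hza p (Or.inl rfl), hyperplanePoint_self hup hwp, mul_zero]
    rcases hc.eq_or_eq_of_hyperplanePoint hz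
      (fun i hi h0 => by rw [hza i (Or.inr hi), h0, mul_zero]) with rfl | rfl <;> linarith
  -- Both members of the second pair are supported in the face of the first, and their signs at `p`
  -- decide which is which.
  have hnew : ∀ u ∈ L, ∀ w ∈ L, ∀ u' ∈ L, ∀ w' ∈ L, 0 < u p → w p < 0 → PairCondition C L u w →
      0 < u' p → w' p < 0 →
      (∀ i ∈ C, hyperplanePoint p u w i = 0 → hyperplanePoint p u' w' i = 0) →
      u' = u ∧ w' = w := by
    intro u hu w hw u' hu' w' hw' hup hwp hc hup' hwp' hpp
    have h1 : ∀ i ∈ C, hyperplanePoint p u w i = 0 → u' i = 0 ∧ w' i = 0 := fun i hi h0 =>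
      eq_zero_of_hyperplanePoint_eq_zero hup' hwp' (h.nonneg _ hu' i hi) (h.nonneg _ hw' i hi)
        (hpp i hi h0)
    constructor
    · rcases hc.eq_or_eq_of_hyperplanePoint hu' fun i hi h0 => (h1 i hi h0).1
        with h2 | h2
      · exact h2
      · rw [h2] at hup'
        linarith
    · rcases hc.eq_or_eq_of_hyperplanePoint hw' fun i hi h0 => (h1 i hi h0).2
        with h2 | h2
      · rw [h2] at hwp'
        linarith
      · exact h2
  refine ⟨?_, ?_, ?_, ?_, ?_⟩
  · simp only [processPosition]
    refine List.Nodup.append (List.Nodup.append (h.nodup.filter _) (h.nodup.filter _) ?_) ?_ ?_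
    · intro z hz hz'
      simp only [List.mem_filter, decide_eq_true_eq] at hz hz'
      linarith [hz.2, hz'.2]
    · refine List.Nodup.map_on ?_ (List.Nodup.filter _ ((h.nodup.filter _).product
        (h.nodup.filter _)))
      rintro ⟨u, w⟩ huw ⟨u', w'⟩ huw' heq
      simp only [List.mem_filter, decide_eq_true_eq, List.pair_mem_product] at huw huw'
      obtain ⟨⟨⟨hu, hup⟩, hw, hwp⟩, hc⟩ := huw
      obtain ⟨⟨⟨hu', hup'⟩, hw', hwp'⟩, hc'⟩ := huw'
      have heq' : hyperplanePoint p u w = hyperplanePoint p u' w' := heq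
      obtain ⟨rfl, rfl⟩ := hnew u hu w hw u' hu' w' hw' hup hwp hc hup' hwp'
        (fun i _ h0 => by rwa [← heq'])
      rfl
    · intro z hz hz'
      simp only [List.mem_map, List.mem_filter, decide_eq_true_eq, List.pair_mem_product,
        Prod.exists] at hz'
      obtain ⟨u, w, ⟨⟨⟨hu, hup⟩, hw, hwp⟩, hc⟩, rfl⟩ := hz'
      simp only [List.mem_append, List.mem_filter, decide_eq_true_eq] at hz
      refine hold u hu w hw (hyperplanePoint p u w) ?_ hup hwp hc
        (hyperplanePoint_self hup hwp).ge ⟨1, one_ne_zero, fun i _ => (one_mul _).symm⟩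
      exact hz.elim (fun h => h.1) fun h => h.1
  · intro z hz
    rcases mem_processPosition.1 hz with ⟨hz, -⟩ | ⟨u, hu, w, hw, hup, hwp, -, rfl⟩
    · exact h.mem z hz
    · exact hyperplanePoint_mem (h.mem u hu) (h.mem w hw)
  · intro z hz
    rcases mem_processPosition.1 hz with ⟨hz, hzp⟩ | ⟨u, hu, w, hw, hup, hwp, -, rfl⟩
    · rintro i (rfl | hi)
      exacts [hzp, h.nonneg z hz i hi]
    · exact hyperplanePoint_nonneg hup hwp (h.nonneg u hu) (h.nonneg w hw)
  · intro z hz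
    rcases mem_processPosition.1 hz with ⟨hz, hzp⟩ | ⟨u, hu, w, hw, hup, hwp, hc, rfl⟩
    · exact h.quad z hz
    · exact hc.1.quadConstraints fun i _ h1 h2 => hyperplanePoint_eq_zero h1 h2
  · intro z hz z' hz' hzz
    rcases mem_processPosition.1 hz with ⟨hz, hzp⟩ | ⟨u, hu, w, hw, hup, hwp, hc, rfl⟩ <;>
      rcases mem_processPosition.1 hz' with ⟨hz', hzp'⟩ | ⟨u', hu', w', hw', hup', hwp', hc', rfl⟩
    · exact h.inj z hz z' hz' (hzz.mono fun i hi => Or.inr hi)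
    · obtain ⟨a, ha, h2⟩ := hzz
      exact (hold u' hu' w' hw' z hz hup' hwp' hc' hzp ⟨a, ha.ne', h2⟩).elim
    · obtain ⟨a, ha, h2⟩ := hzz.symm
      exact (hold u hu w hw z' hz' hup hwp hc hzp' ⟨a, ha.ne', h2⟩).elim
    · obtain ⟨rfl, rfl⟩ := hnew u hu w hw u' hu' w' hw' hup hwp hc hup' hwp'
        fun i hi h0 => hzz.symm.eq_zero (Or.inr hi) h0
      rfl

end ProcessPosition

/-! ### Processing all positions around one vertex. -/

section Phase

variable {n : ℕ} {W : Submodule ℝ (StdVec n)} {C₀ P C : Set (StdCoord n)} {ℓ : StdVec n}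
  {K L : List (StdVec n)}

/-- The list of the extreme rays that satisfy the quadrilateral constraints. -/
structure IsExtremeList (W : Submodule ℝ (StdVec n)) (C : Set (StdCoord n))
    (L : List (StdVec n)) : Prop where
  nodup : L.Nodup
  extreme : ∀ z ∈ L, IsExtremeOn W C z
  quad : ∀ z ∈ L, QuadConstraints (quadProj z)
  inj : ∀ z ∈ L, ∀ z' ∈ L, Proportional C z z' → z = z'
  complete : ∀ z, IsExtremeOn W C z → QuadConstraints (quadProj z) →
    ∃ z' ∈ L, Proportional C z z'

/-- The situation at the beginning of the processing of a vertex with link `ℓ`: `P` is the set of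
triangle positions around the vertex, `C₀` the set of positions processed before. -/
structure IsPhaseStart (W : Submodule ℝ (StdVec n)) (C₀ P : Set (StdCoord n)) (ℓ : StdVec n)
    (K : List (StdVec n)) : Prop where
  quad_subset : quadPositions n ⊆ C₀
  link_mem : ℓ ∈ W
  link_zero : ∀ i ∈ C₀, ℓ i = 0
  link_pos : ∀ i ∈ P, 0 < ℓ i
  null : ∀ x ∈ W, (∀ i ∈ C₀, x i = 0) → ∃ c : ℝ, ∀ i ∈ C₀ ∪ P, x i = c * ℓ i
  list : IsExtremeList W C₀ K
  list_nonneg : ∀ k ∈ K, ∀ i ∈ P, 0 ≤ k i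
  list_zero : ∀ k ∈ K, ∃ i ∈ P, k i = 0

/-- The situation in the course of the processing of a vertex, after at least one position: the
list consists of the extreme rays other than the vertex link, and of the initial list. -/
structure IsPhaseList (W : Submodule ℝ (StdVec n)) (C₀ P : Set (StdCoord n)) (ℓ : StdVec n)
    (K : List (StdVec n)) (C : Set (StdCoord n)) (L : List (StdVec n)) : Prop where
  subset : C₀ ⊆ C
  subset_union : C ⊆ C₀ ∪ P
  touched : ∃ i ∈ C, i ∈ P
  coneList : IsConeList W C L
  extreme_or_mem : ∀ z ∈ L, (IsExtremeOn W C z ∧ ¬ Proportional C z ℓ) ∨ z ∈ K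
  initial_subset : ∀ k ∈ K, k ∈ L
  complete : ∀ z, IsExtremeOn W C z → QuadConstraints (quadProj z) → ¬ Proportional C z ℓ →
    ∃ z' ∈ L, Proportional C z z'

namespace IsPhaseStart

/-- An extreme ray of the initial cone remains extreme if one of its coordinates at the vertex
vanishes. -/
theorem isExtremeOn_of_zero (h : IsPhaseStart W C₀ P ℓ K) (hsub : C₀ ⊆ C) (hsup : C ⊆ C₀ ∪ P) {v : StdVec n}
    (hv : IsExtremeOn W C₀ v) (hv0 : ∀ i ∈ C, 0 ≤ v i) {i : StdCoord n} (hi : i ∈ C) (hiP : i ∈ P)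
    (hvi : v i = 0) : IsExtremeOn W C v := by
  refine ⟨hv.mem, hv0, ?_, fun y hy hy0 hyv => ?_⟩
  · obtain ⟨j, hj, h0⟩ := hv.nonzero
    exact ⟨j, hsub hj, h0⟩
  · obtain ⟨a, ha⟩ := hv.minimal y hy (fun j hj => hy0 j (hsub hj)) fun j hj => hyv j (hsub hj)
    -- Extremality over `C₀` determines `y` only up to a multiple of `ℓ`; the common zero at `i`,
    -- where `ℓ` is positive, kills this multiple.
    obtain ⟨c, hc⟩ := h.null (y - a • v) (W.sub_mem hy (W.smul_mem _ hv.mem))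
      fun j hj => by simp [ha j hj]
    have h1 := hc i (Or.inr hiP)
    simp only [Pi.sub_apply, Pi.smul_apply, smul_eq_mul, hvi, hyv i hi hvi, mul_zero, sub_zero] at h1
    have hc0 : c = 0 := (mul_eq_zero.1 h1.symm).resolve_right (h.link_pos i hiP).ne'
    refine ⟨a, fun j hj => ?_⟩
    have := hc j (hsup hj)
    simp only [Pi.sub_apply, Pi.smul_apply, smul_eq_mul, hc0, zero_mul] at this
    linarith

theorem link_nonneg (h : IsPhaseStart W C₀ P ℓ K) (hsup : C ⊆ C₀ ∪ P) : ∀ i ∈ C, 0 ≤ ℓ i :=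
  fun i hi => (hsup hi).elim (fun h0 => (h.link_zero i h0).ge) fun h0 => (h.link_pos i h0).le

/-- A competitor supported on `ℓ` vanishes on `C₀`, so `null` makes it a multiple of `ℓ`. -/
theorem isExtremeOn_link (h : IsPhaseStart W C₀ P ℓ K) (hsub : C₀ ⊆ C) (hsup : C ⊆ C₀ ∪ P)
    (ht : ∃ i ∈ C, i ∈ P) : IsExtremeOn W C ℓ := by
  refine ⟨h.link_mem, h.link_nonneg hsup, ?_, fun y hy hy0 hyv => ?_⟩
  · obtain ⟨i, hi, hP⟩ := ht
    exact ⟨i, hi, (h.link_pos i hP).ne'⟩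
  · obtain ⟨c, hc⟩ := h.null y hy fun i hi => hyv i (hsub hi) (h.link_zero i hi)
    exact ⟨c, fun i hi => hc i (hsup hi)⟩

/-- This supplies the hypothesis `hp` of the double description lemmas. It needs a position of `P`
in `C`, so the first position requires a separate argument. -/
theorem apply_eq_zero (h : IsPhaseStart W C₀ P ℓ K) (hsub : C₀ ⊆ C) (ht : ∃ i ∈ C, i ∈ P)
    {p : StdCoord n} (hp : p ∈ P) : ∀ x ∈ W, (∀ i ∈ C, x i = 0) → x p = 0 := by
  intro x hx hx0
  obtain ⟨c, hc⟩ := h.null x hx fun i hi => hx0 i (hsub hi)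
  obtain ⟨i, hi, hP⟩ := ht
  have h1 := hc i (Or.inr hP)
  rw [hx0 i hi] at h1
  rw [hc p (Or.inr hp), (mul_eq_zero.1 h1.symm).resolve_right (h.link_pos i hP).ne', zero_mul]

theorem not_proportional_link (h : IsPhaseStart W C₀ P ℓ K) (hsub : C₀ ⊆ C) {z : StdVec n}
    (hz : ∃ i ∈ C₀, z i ≠ 0) : ¬ Proportional C z ℓ := by
  intro hp
  obtain ⟨i, hi, hzi⟩ := hz
  exact hzi (hp.eq_zero (hsub hi) (h.link_zero i hi))

/-- Below an initial vector that is not extreme there is an extreme ray. -/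
theorem exists_sub_smul_link (h : IsPhaseStart W C₀ P ℓ K) (hsub : C₀ ⊆ C) (hsup : C ⊆ C₀ ∪ P)
    (ht : ∃ i ∈ C, i ∈ P) {k : StdVec n} (hk : k ∈ K) (hkE : ¬ IsExtremeOn W C k) :
    (∀ i ∈ C, k i = 0 → ℓ i = 0) ∧ ∃ t : ℝ, 0 < t ∧ IsExtremeOn W C (k - t • ℓ) := by
  have hkext := h.list.extreme k hk
  have hk0 : ∀ i ∈ C, 0 ≤ k i := fun i hi =>
    (hsup hi).elim (hkext.nonneg i) (h.list_nonneg k hk i)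
  -- A zero of `k` at a processed position of `P` would make `k` extreme. So `ℓ` lies in the face of
  -- `k`, and can be subtracted until such a zero appears.
  have hsupp : ∀ i ∈ C, k i = 0 → ℓ i = 0 := by
    intro i hi hki
    rcases hsup hi with h0 | h0
    · exact h.link_zero i h0
    · exact (hkE (h.isExtremeOn_of_zero hsub hsup hkext hk0 hi h0 hki)).elim
  have hlk := h.isExtremeOn_link hsub hsup ht
  obtain ⟨t, ht0, hpos, i, hi, hli, hti⟩ := exists_max_smul_le hk0 hlk.nonneg hsupp hlk.nonzero
  refine ⟨hsupp, t, ht0, ?_⟩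
  refine h.isExtremeOn_of_zero hsub hsup ?_ (by simpa using hpos) hi
    ((hsup hi).resolve_left fun h1 => hli (h.link_zero i h1)) (by simpa using hti)
  exact hkext.congr (W.sub_mem hkext.mem (W.smul_mem _ h.link_mem))
    ⟨1, one_pos, fun j hj => by simp [h.link_zero j hj]⟩

theorem eq_of_support (h : IsPhaseStart W C₀ P ℓ K) {k k' : StdVec n} (hk : k ∈ K) (hk' : k' ∈ K)
    (hs : ∀ i ∈ C₀, k i = 0 → k' i = 0) : k' = k :=
  h.list.inj k' hk' k hk ((h.list.extreme k hk).proportional (h.list.extreme k' hk').mem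
    (h.list.extreme k' hk').nonneg hs (h.list.extreme k' hk').nonzero)

end IsPhaseStart

namespace IsPhaseList

theorem not_proportional_of_isExtremeOn (h : IsPhaseStart W C₀ P ℓ K)
    (hL : IsPhaseList W C₀ P ℓ K C L) {z : StdVec n} (hz : z ∈ L) : ¬ Proportional C z ℓ :=
  (hL.extreme_or_mem z hz).elim (fun h => h.2) fun hk =>
    h.not_proportional_link hL.subset (h.list.extreme z hk).nonzero

theorem exists_nonzero (h : IsPhaseStart W C₀ P ℓ K) (hL : IsPhaseList W C₀ P ℓ K C L)
    {z : StdVec n} (hz : z ∈ L) : ∃ i ∈ C, z i ≠ 0 :=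
  (hL.extreme_or_mem z hz).elim (fun h => h.1.nonzero) fun hk =>
    let ⟨i, hi, h0⟩ := (h.list.extreme z hk).nonzero
    ⟨i, hL.subset hi, h0⟩

/-- A processed pair spans the face that contains it. -/
theorem exists_eq_add_of_pairCondition (h : IsPhaseStart W C₀ P ℓ K)
    (hL : IsPhaseList W C₀ P ℓ K C L) {p : StdCoord n} (hp : p ∈ P) {u w : StdVec n} (hu : u ∈ L)
    (hw : w ∈ L) (hwp : w p < 0) (hc : PairCondition C L u w) {y : StdVec n}
    (hy : y ∈ W) (hy0 : ∀ i ∈ C, 0 ≤ y i) (hyuw : ∀ i ∈ C, u i = 0 → w i = 0 → y i = 0) :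
    ∃ a b : ℝ, ∀ i ∈ C, y i = a * u i + b * w i := by
  have hsub := hL.subset
  have hsup := hL.subset_union
  have hwK : w ∉ K := fun hk => hwp.not_ge (h.list_nonneg w hk p hp)
  have hwE : IsExtremeOn W C w := ((hL.extreme_or_mem w hw).resolve_right hwK).1
  have hlk := h.isExtremeOn_link hsub hsup hL.touched
  -- If `u` is not extreme, it is `t • ℓ` plus an extreme vector whose representative in `L` must be
  -- `w` by the pair condition. The face is then spanned by `u` and `ℓ`, hence by `u` and `w`.
  by_cases huE : IsExtremeOn W C u
  swap
  · have huK : u ∈ K := (hL.extreme_or_mem u hu).resolve_left fun h => huE h.1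
    obtain ⟨hsupp, t, ht, hE⟩ := h.exists_sub_smul_link hsub hsup hL.touched huK huE
    have hE0 : ∀ i ∈ C₀, (u - t • ℓ) i = u i := fun i hi => by simp [h.link_zero i hi]
    obtain ⟨z, hz, hzp⟩ := hL.complete _ hE
      ((hL.coneList.quad u hu).of_support fun i hi h0 => by rw [hE0 i (h.quad_subset hi), h0])
      (h.not_proportional_link hsub (by
        obtain ⟨i, hi, h0⟩ := (h.list.extreme u huK).nonzero
        exact ⟨i, hi, by rwa [hE0 i hi]⟩))
    have hzE : IsExtremeOn W C z := hE.congr (hL.coneList.mem z hz) hzp.symm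
    have hzw : z = w := by
      refine (hc.eq_or_eq hz fun i hi h1 _ => ?_).resolve_left fun h1 => huE (h1 ▸ hzE)
      exact hzp.symm.eq_zero hi (by simp [h1, hsupp i hi h1])
    subst hzw
    obtain ⟨a, ha, hza⟩ := hzp.symm
    obtain ⟨b, hb⟩ := (h.list.extreme u huK).minimal y hy (fun i hi => hy0 i (hsub hi))
      fun i hi h0 => hyuw i (hsub hi) h0 (by rw [hza i (hsub hi), hE0 i hi, h0, mul_zero])
    obtain ⟨c, hc⟩ := h.null (y - b • u)
      (W.sub_mem hy (W.smul_mem _ (hL.coneList.mem u hu))) fun i hi => by simp [hb i hi]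
    refine ⟨b + c / t, -(c / (t * a)), fun i hi => ?_⟩
    have h1 := hc i (hsup hi)
    have h2 := hza i hi
    simp only [Pi.sub_apply, Pi.smul_apply, smul_eq_mul] at h1 h2
    rw [h2]
    field_simp
    linear_combination t * h1
  have hul : ¬ Proportional C u ℓ := not_proportional_of_isExtremeOn h hL hu
  have hwl : ¬ Proportional C w ℓ := not_proportional_of_isExtremeOn h hL hw
  have hext : ∀ z, IsExtremeOn W C z → (∀ i ∈ C, u i = 0 → w i = 0 → z i = 0) →
      Proportional C z ℓ ∨ Proportional C z u ∨ Proportional C z w := by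
    intro z hz hzuw
    by_cases hzl : Proportional C z ℓ
    · exact Or.inl hzl
    right
    obtain ⟨z', hz', hp⟩ := hL.complete z hz
      (hc.1.quadConstraints fun i hi => hzuw i (hsub (h.quad_subset hi))) hzl
    rcases hc.eq_or_eq hz' fun i hi h1 h2 => hp.symm.eq_zero hi (hzuw i hi h1 h2) with rfl | rfl
    exacts [Or.inl hp, Or.inr hp]
  -- Since `ℓ` is missing from `L`, the pair condition does not exclude it from the face directly.
  -- If it lay there, subtract the largest multiple of `ℓ` from `u + w` and expand the rest in `u`,
  -- `w`, `ℓ`. At the new zero the coefficient of `ℓ` and one of the others vanish, so `u` or `w` is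
  -- `t • ℓ` plus a multiple of the other and is proportional to `ℓ`.
  have hlface : ¬ ∀ i ∈ C, u i = 0 → w i = 0 → ℓ i = 0 := by
    intro hl
    have hadd : ∀ i ∈ C, (u + w) i = 0 → u i = 0 ∧ w i = 0 := by
      intro i hi h0
      have h1 := huE.nonneg i hi
      have h2 := hwE.nonneg i hi
      simp only [Pi.add_apply] at h0
      constructor <;> linarith
    obtain ⟨t, ht, hpos, i, hi, hli, hti⟩ := exists_max_smul_le (x := u + w) (C := C)
      (fun i hi => add_nonneg (huE.nonneg i hi) (hwE.nonneg i hi)) hlk.nonneg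
      (fun i hi h0 => hl i hi (hadd i hi h0).1 (hadd i hi h0).2) hlk.nonzero
    obtain ⟨a, b, c, ha, hb, hc0, habc⟩ : ∃ a b c : ℝ, 0 ≤ a ∧ 0 ≤ b ∧ 0 ≤ c ∧
        ∀ i ∈ C, (u + w - t • ℓ) i = a * u i + b * w i + c * ℓ i := by
      refine isExtremeOn_induction (W := W) (D := fun y => ∃ a b c : ℝ, 0 ≤ a ∧ 0 ≤ b ∧ 0 ≤ c ∧
        ∀ i ∈ C, y i = a * u i + b * w i + c * ℓ i)
        (W.sub_mem (W.add_mem huE.mem hwE.mem) (W.smul_mem _ h.link_mem)) (by simpa using hpos)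
        (fun y _ h => ⟨0, 0, 0, le_rfl, le_rfl, le_rfl, fun i hi => by simp [h i hi]⟩)
        (fun z hz hzx => ?_) ?_
      · rcases hext z hz fun i hi h1 h2 => hzx i hi (by simp [h1, h2, hl i hi h1 h2])
          with ⟨a, ha, h⟩ | ⟨a, ha, h⟩ | ⟨a, ha, h⟩
        · exact ⟨0, 0, a, le_rfl, le_rfl, ha.le, fun i hi => by simp [h i hi]⟩
        · exact ⟨a, 0, 0, ha.le, le_rfl, le_rfl, fun i hi => by simp [h i hi]⟩
        · exact ⟨0, a, 0, le_rfl, ha.le, le_rfl, fun i hi => by simp [h i hi]⟩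
      · rintro y z s hs ⟨a, b, c, ha, hb, hc, h⟩ ⟨a', b', c', ha', hb', hc', h'⟩
        refine ⟨a + s * a', b + s * b', c + s * c', by positivity, by positivity, by positivity,
          fun i hi => ?_⟩
        simp only [Pi.add_apply, Pi.smul_apply, smul_eq_mul, h i hi, h' i hi]
        ring
    have hiP := h.link_pos i ((hsup hi).resolve_left fun h1 => hli (h.link_zero i h1))
    have h0 := habc i hi
    have h1 := mul_nonneg ha (huE.nonneg i hi)
    have h2 := mul_nonneg hb (hwE.nonneg i hi)
    have h3 := mul_nonneg hc0 hiP.le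
    have htl := mul_pos ht hiP
    simp only [Pi.add_apply] at hti
    simp only [Pi.add_apply, Pi.sub_apply, Pi.smul_apply, smul_eq_mul] at h0 habc
    have hc' : c = 0 := (mul_eq_zero.1 (by linarith : c * ℓ i = 0)).resolve_right hiP.ne'
    subst hc'
    rcases (huE.nonneg i hi).eq_or_lt with hui | hui
    · have hwi : w i ≠ 0 := by
        intro h
        rw [h, ← hui] at hti
        linarith
      have hb' : b = 0 := (mul_eq_zero.1 (by linarith : b * w i = 0)).resolve_right hwi
      refine hwl (hwE.proportional_of_eq hlk huE.nonneg (s := t) (β := a - 1) ht fun j hj => ?_)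
      have := habc j hj
      rw [hb'] at this
      linear_combination this
    · have ha' : a = 0 := (mul_eq_zero.1 (by linarith : a * u i = 0)).resolve_right hui.ne'
      refine hul (huE.proportional_of_eq hlk hwE.nonneg (s := t) (β := b - 1) ht fun j hj => ?_)
      have := habc j hj
      rw [ha'] at this
      linear_combination this
  refine exists_eq_add_of_adjacent hy hy0 hyuw fun z hz hzuw =>
    (hext z hz hzuw).resolve_left fun hzl => hlface fun i hi h1 h2 => ?_
  exact hzl.symm.eq_zero hi (hzuw i hi h1 h2)

end IsPhaseList

end Phase

section Phase

variable {n : ℕ} {W : Submodule ℝ (StdVec n)} {C₀ P C : Set (StdCoord n)} {ℓ : StdVec n}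
  {K L : List (StdVec n)}

/-- A vector of the new list that is supported on an extreme ray represents that ray. -/
theorem IsConeList.proportional_of_support {p : StdCoord n}
    (hL : IsConeList W (insert p C) L) {v z : StdVec n}
    (hv : IsExtremeOn W (insert p C) v) (hz : z ∈ L) (hvz : ∀ i ∈ C, v i = 0 → z i = 0)
    (hvp : v p = 0 → z p = 0) (hne : ∃ i ∈ C, z i ≠ 0) : Proportional (insert p C) v z := by
  refine (hv.proportional (hL.mem z hz) (hL.nonneg z hz) ?_ ?_).symm
  · rintro i (rfl | hi)
    exacts [hvp, hvz i hi]
  · obtain ⟨i, hi, h0⟩ := hne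
    exact ⟨i, Or.inr hi, h0⟩

/-- By `of_insert`, `v` is an old ray or the cut of an adjacent pair `u, w`. Here `w` is never `ℓ`,
because `ℓ p > 0`, so it has a representative `w'` in `L`. If `u` is not `ℓ` either, the
representatives form a processed pair. If `u` is `ℓ`, the vector `w'` is extreme already on `C₀`,
and its counterpart `k ∈ K` replaces `ℓ`: it represents `v` itself, or its pair with `w'` does. -/
theorem IsPhaseList.complete_processPosition (h : IsPhaseStart W C₀ P ℓ K)
    (hL : IsPhaseList W C₀ P ℓ K C L) {p : StdCoord n} (hp : p ∈ P) {v : StdVec n}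
    (hv : IsExtremeOn W (insert p C) v) (hvq : QuadConstraints (quadProj v))
    (hvl : ¬ Proportional (insert p C) v ℓ) :
    ∃ z ∈ (processPosition (C, L) p).2, Proportional (insert p C) v z := by
  have hsub := hL.subset
  have hsup := hL.subset_union
  have hp0 := h.apply_eq_zero hsub hL.touched hp
  have hlk := h.isExtremeOn_link hsub hsup hL.touched
  have hnew := hL.coneList.process p
  rcases hv.of_insert hp0 with hvE | ⟨u, w, hu, hw, hup, hwp, -, hsu, hadj⟩
  · obtain ⟨z, hz, hvz⟩ := hL.complete v hvE hvq fun h1 =>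
      hvl (h1.to_insert hp0 h.link_mem hvE.mem)
    have hvz' := hvz.to_insert hp0 (hL.coneList.mem z hz) hvE.mem
    refine ⟨z, mem_processPosition.2 (Or.inl ⟨hz, ?_⟩), hvz'⟩
    obtain ⟨a, ha, h1⟩ := hvz'.symm
    rw [h1 p (Or.inl rfl)]
    exact mul_nonneg ha.le (hv.nonneg p (Or.inl rfl))
  have hquad : ∀ z : StdVec n, (∀ i ∈ C, v i = 0 → z i = 0) → ∀ i ∈ quadPositions n, v i = 0 → z i = 0 :=
    fun z hz i hi => hz i (hsub (h.quad_subset hi))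
  have hrep : ∀ z, IsExtremeOn W C z → (∀ i ∈ C, v i = 0 → z i = 0) → ¬ Proportional C z ℓ →
      ∃ z' ∈ L, Proportional (insert p C) z z' ∧ IsExtremeOn W C z' ∧
        ∀ i ∈ C, v i = 0 → z' i = 0 := by
    intro z hz hzv hzl
    obtain ⟨z', hz', hzz⟩ := hL.complete z hz (hvq.of_support (hquad z hzv)) hzl
    exact ⟨z', hz', hzz.to_insert hp0 (hL.coneList.mem z' hz') hz.mem,
      hz.congr (hL.coneList.mem z' hz') hzz.symm,
      fun i hi h0 => hzz.symm.eq_zero hi (hzv i hi h0)⟩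
  have hwl : ¬ Proportional C w ℓ := by
    intro h1
    obtain ⟨a, ha, h2⟩ := h1.to_insert hp0 h.link_mem hw.mem
    have := mul_pos ha (h.link_pos p hp)
    linarith [h2 p (Or.inl rfl)]
  obtain ⟨w', hw', hww, hwE, hwv⟩ := hrep w hw (fun i hi h0 => (hsu i hi h0).2) hwl
  have hwp' : w' p < 0 := by
    obtain ⟨a, ha, h1⟩ := hww.symm
    rw [h1 p (Or.inl rfl)]
    exact mul_neg_of_pos_of_neg ha hwp
  have hadj' : ∀ z, IsExtremeOn W C z → (∀ i ∈ C, v i = 0 → z i = 0) →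
      Proportional C z u ∨ Proportional C z w' := fun z hz hzv =>
    (hadj z hz hzv).imp_right fun h1 => h1.trans (hww.mono fun i hi => Or.inr hi)
  -- every admissible pair in the face of `v` gives a representative of `v`
  have hfin : ∀ x ∈ L, 0 < x p → (∀ i ∈ C, v i = 0 → x i = 0) →
      (∀ z ∈ L, z ≠ x → z ≠ w' → ¬ ∀ i ∈ C, x i = 0 → w' i = 0 → z i = 0) →
      ∃ z ∈ (processPosition (C, L) p).2, Proportional (insert p C) v z := by
    intro x hx hxp hxv hno
    have hmem : hyperplanePoint p x w' ∈ (processPosition (C, L) p).2 :=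
      mem_processPosition.2 (Or.inr ⟨x, hx, w', hw', hxp, hwp',
        ⟨hvq.quadCompatible (hquad x hxv) (hquad w' hwv),
          fun ⟨z, hz, h1, h2, h3⟩ => hno z hz h1 h2 h3⟩, rfl⟩)
    refine ⟨_, hmem, hnew.proportional_of_support hv hmem
      (fun i hi h0 => hyperplanePoint_eq_zero (hxv i hi h0) (hwv i hi h0))
      (fun _ => hyperplanePoint_self hxp hwp') ?_⟩
    obtain ⟨i, hi, h0⟩ := hwE.nonzero
    exact ⟨i, hi, fun h1 => h0 (eq_zero_of_hyperplanePoint_eq_zero hxp hwp'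
      (hL.coneList.nonneg x hx i hi) (hwE.nonneg i hi) h1).2⟩
  by_cases hul : Proportional C u ℓ
  swap
  · obtain ⟨u', hu', huu, huE, huv⟩ := hrep u hu (fun i hi h0 => (hsu i hi h0).1) hul
    have huu' : Proportional C u u' := huu.mono fun i hi => Or.inr hi
    have hup' : 0 < u' p := by
      obtain ⟨a, ha, h1⟩ := huu.symm
      rw [h1 p (Or.inl rfl)]
      exact mul_pos ha hup
    refine hfin u' hu' hup' huv fun z hz hzu hzw hzs => ?_
    have hzv : ∀ i ∈ C, v i = 0 → z i = 0 := fun i hi h0 => hzs i hi (huv i hi h0) (hwv i hi h0)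
    by_cases hzE : IsExtremeOn W C z
    · rcases hadj' z hzE hzv with h1 | h1
      · exact hzu (hL.coneList.inj z hz u' hu' (h1.trans huu'))
      · exact hzw (hL.coneList.inj z hz w' hw' h1)
    -- A non-extreme `z` in the face would bring `ℓ` into the face, whose only rays are those of `u`
    -- and `w'`.
    · have hzK : z ∈ K := (hL.extreme_or_mem z hz).resolve_left fun h1 => hzE h1.1
      have hsl := (h.exists_sub_smul_link hsub hsup hL.touched hzK hzE).1
      rcases hadj ℓ hlk fun i hi h0 => hsl i hi (hzv i hi h0) with h1 | h1
      · exact hul h1.symm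
      · exact hwl h1.symm
  -- the face of `v` is spanned by the vertex link and `w'`
  have hlv : ∀ i ∈ C, v i = 0 → ℓ i = 0 := fun i hi h0 =>
    hul.symm.eq_zero hi (hsu i hi h0).1
  have hwne : ∃ i ∈ C₀, w' i ≠ 0 := by
    by_contra hcon
    push Not at hcon
    obtain ⟨c, hc⟩ := h.null w' hwE.mem hcon
    obtain ⟨i, hi, hiP⟩ := hL.touched
    have h1 := hc i (Or.inr hiP)
    have h2 := hwE.nonneg i hi
    have h3 := hc p (Or.inr hp)
    have hc0 : 0 ≤ c := nonneg_of_mul_nonneg_left (h1 ▸ h2) (h.link_pos i hiP)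
    linarith [mul_nonneg hc0 (h.link_pos p hp).le]
  have hwE0 : IsExtremeOn W C₀ w' := by
    refine ⟨hwE.mem, fun i hi => hwE.nonneg i (hsub hi), hwne, fun y hy hy0 hyw => ?_⟩
    -- A large multiple of `ℓ` makes `y` non-negative around the vertex without changing it on `C₀`;
    -- the result lies in the face spanned by `ℓ` and `w'`.
    obtain ⟨M, hM⟩ : ∃ M : ℝ, ∀ i ∈ P, 0 ≤ y i + M * ℓ i := by
      refine ⟨∑ j, |y j / ℓ j|, fun i hi => ?_⟩
      have hl := h.link_pos i hi
      have h1 : |y i / ℓ i| ≤ ∑ j, |y j / ℓ j| :=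
        Finset.single_le_sum (f := fun j => |y j / ℓ j|) (fun j _ => abs_nonneg _)
          (Finset.mem_univ i)
      have h2 : -(y i / ℓ i) ≤ ∑ j, |y j / ℓ j| := (neg_le_abs _).trans h1
      have h3 := mul_le_mul_of_nonneg_right h2 hl.le
      rw [neg_mul, div_mul_cancel₀ _ hl.ne'] at h3
      linarith
    obtain ⟨a, b, hab⟩ : ∃ a b : ℝ, ∀ i ∈ C, (y + M • ℓ) i = a * ℓ i + b * w' i := by
      refine exists_eq_add_of_adjacent (W.add_mem hy (W.smul_mem M h.link_mem))
        (fun i hi => (hsup hi).elim (fun h0 => by simpa [h.link_zero i h0] using hy0 i h0)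
          fun h0 => hM i h0) (fun i hi h1 h2 => ?_) fun z hz hzs => ?_
      · have hi0 : i ∈ C₀ := (hsup hi).resolve_right fun h0 => (h.link_pos i h0).ne' h1
        simp [h1, hyw i hi0 h2]
      · exact (hadj' z hz fun i hi h0 => hzs i hi (hlv i hi h0) (hwv i hi h0)).imp_left
          fun h1 => h1.trans hul
    refine ⟨b, fun i hi => ?_⟩
    simpa [h.link_zero i hi] using hab i (hsub hi)
  obtain ⟨k, hk, hwk⟩ := h.list.complete w' hwE0 (hL.coneList.quad w' hw')
  have hkE := h.list.extreme k hk
  have hkL := hL.initial_subset k hk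
  have hkv : ∀ i ∈ C, v i = 0 → k i = 0 := by
    intro i hi h0
    have hi0 : i ∈ C₀ := (hsup hi).resolve_right fun h1 => (h.link_pos i h1).ne' (hlv i hi h0)
    exact hwk.symm.eq_zero hi0 (hwv i hi h0)
  rcases (h.list_nonneg k hk p hp).eq_or_lt with hkp | hkp
  · have hmem : k ∈ (processPosition (C, L) p).2 := mem_processPosition.2 (Or.inl ⟨hkL, hkp.le⟩)
    exact ⟨k, hmem, hnew.proportional_of_support hv hmem hkv (fun _ => hkp.symm)
      (hL.exists_nonzero h hkL)⟩
  · refine hfin k hkL hkp hkv fun z hz hzk hzw hzs => ?_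
    have hzv : ∀ i ∈ C, v i = 0 → z i = 0 := fun i hi h0 => hzs i hi (hkv i hi h0) (hwv i hi h0)
    -- An extreme `z` in the face would represent `ℓ`, which `L` does not contain, or `w'`. A `z`
    -- from `K` has its support on `C₀` within that of `k`, so it equals `k`.
    rcases hL.extreme_or_mem z hz with ⟨hzE, hzl⟩ | hzK
    · rcases hadj' z hzE hzv with h1 | h1
      · exact hzl (h1.trans hul)
      · exact hzw (hL.coneList.inj z hz w' hw' h1)
    · exact hzk (h.eq_of_support hk hzK fun i hi h0 =>
        hzs i (hsub hi) h0 (hwk.eq_zero hi h0))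

theorem IsPhaseList.process (h : IsPhaseStart W C₀ P ℓ K)
    (hL : IsPhaseList W C₀ P ℓ K C L) {p : StdCoord n} (hp : p ∈ P) :
    IsPhaseList W C₀ P ℓ K (insert p C) (processPosition (C, L) p).2 := by
  have hp0 := h.apply_eq_zero hL.subset hL.touched hp
  refine ⟨fun i hi => Or.inr (hL.subset hi), ?_, ⟨p, Or.inl rfl, hp⟩, hL.coneList.process p,
    fun z hz => ?_, fun k hk => ?_, fun v hv => hL.complete_processPosition h hp hv⟩
  · rintro i (rfl | hi)
    exacts [Or.inr hp, hL.subset_union hi]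
  · rcases mem_processPosition.1 hz with ⟨hz, hzp⟩ | ⟨u, hu, w, hw, hup, hwp, hc, rfl⟩
    · refine (hL.extreme_or_mem z hz).imp_left fun h1 => ⟨h1.1.to_insert hp0 hzp, fun h2 => ?_⟩
      exact h1.2 (h2.mono fun i hi => Or.inr hi)
    · refine Or.inl ⟨isExtremeOn_hyperplanePoint hp0 (hL.coneList.mem u hu) (hL.coneList.mem w hw)
        (hL.coneList.nonneg u hu) (hL.coneList.nonneg w hw) (hL.exists_nonzero h hu) hup hwp
        fun y hy hy0 hys => hL.exists_eq_add_of_pairCondition h hp hu hw hwp hc hy hy0 hys,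
        fun h1 => ?_⟩
      exact (h.link_pos p hp).ne' (h1.symm.eq_zero (Or.inl rfl) (hyperplanePoint_self hup hwp))
  · exact mem_processPosition.2 (Or.inl ⟨hL.initial_subset k hk, h.list_nonneg k hk p hp⟩)

/-- Processing the first position of a vertex. -/
theorem IsPhaseStart.process (h : IsPhaseStart W C₀ P ℓ K) {p : StdCoord n} (hp : p ∈ P) :
    IsPhaseList W C₀ P ℓ K (insert p C₀) (processPosition (C₀, K ++ [-ℓ]) p).2 := by
  have hsub : C₀ ⊆ insert p C₀ := fun i hi => Or.inr hi
  have hsup : insert p C₀ ⊆ C₀ ∪ P := by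
    rintro i (rfl | hi)
    exacts [Or.inr hp, Or.inl hi]
  have hlp := h.link_pos p hp
  have hnegp : (-ℓ) p < 0 := by simpa using hlp
  have hneg0 : ∀ i ∈ C₀, (-ℓ) i = 0 := fun i hi => by simp [h.link_zero i hi]
  have hnegK : ∀ k ∈ K, ¬ ∀ i ∈ C₀, k i = 0 := fun k hk h0 =>
    let ⟨i, hi, h1⟩ := (h.list.extreme k hk).nonzero
    h1 (h0 i hi)
  have hcone : IsConeList W C₀ (K ++ [-ℓ]) := by
    refine ⟨?_, ?_, ?_, ?_, ?_⟩
    · refine h.list.nodup.append (List.nodup_singleton _) ?_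
      intro z hz hz'
      rw [List.mem_singleton] at hz'
      subst hz'
      exact hnegK _ hz hneg0
    · simp only [List.mem_append, List.mem_singleton]
      rintro z (hz | rfl)
      exacts [(h.list.extreme z hz).mem, W.neg_mem h.link_mem]
    · simp only [List.mem_append, List.mem_singleton]
      rintro z (hz | rfl)
      exacts [(h.list.extreme z hz).nonneg, fun i hi => (hneg0 i hi).ge]
    · simp only [List.mem_append, List.mem_singleton]
      rintro z (hz | rfl)
      · exact h.list.quad z hz
      · intro i k k' hk
        exact (hk (hneg0 _ (h.quad_subset (mem_quadPositions i k)))).elim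
    · simp only [List.mem_append, List.mem_singleton]
      rintro z (hz | rfl) z' (hz' | rfl) hzz
      · exact h.list.inj z hz z' hz' hzz
      · exact (hnegK z hz fun i hi => hzz.eq_zero hi (hneg0 i hi)).elim
      · exact (hnegK z' hz' fun i hi => hzz.symm.eq_zero hi (hneg0 i hi)).elim
      · rfl
  have hnew := hcone.process p
  have hcase : ∀ z ∈ K ++ [-ℓ], z ∈ K ∨ z = -ℓ := by simp
  refine ⟨hsub, hsup, ⟨p, Or.inl rfl, hp⟩, hnew, fun z hz => ?_, fun k hk => ?_,
    fun v hv hvq hvl => ?_⟩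
  · rcases mem_processPosition.1 hz with ⟨hz', hzp⟩ | ⟨u, hu, w, hw, hup, hwp, hc, rfl⟩
    · refine Or.inr ((hcase z hz').resolve_right ?_)
      rintro rfl
      linarith
    · left
      have huK : u ∈ K := (hcase u hu).resolve_right (by rintro rfl; linarith)
      -- Only `-ℓ` is negative at the first position, so every new vector is an initial vector
      -- shifted along `ℓ` until it vanishes at `p`, up to a positive factor.
      obtain rfl : w = -ℓ := (hcase w hw).resolve_left fun hk =>
        hwp.not_ge (h.list_nonneg w hk p hp)
      have hvp := hyperplanePoint_self hup hwp
      have hprop : Proportional C₀ (hyperplanePoint p u (-ℓ)) u := by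
        obtain ⟨-, a, b, ha, hb, hab⟩ := hyperplanePoint_spec hup hwp
        exact ⟨a, ha, fun i hi => by rw [hab, hneg0 i hi, mul_zero, add_zero]⟩
      refine ⟨h.isExtremeOn_of_zero hsub hsup ((h.list.extreme u huK).congr
        (hyperplanePoint_mem (h.list.extreme u huK).mem (W.neg_mem h.link_mem)) hprop)
        (hnew.nonneg _ hz) (Or.inl rfl) hp hvp, fun h1 => ?_⟩
      exact hlp.ne' (h1.symm.eq_zero (Or.inl rfl) hvp)
  · exact mem_processPosition.2 (Or.inl ⟨List.mem_append_left _ hk, h.list_nonneg k hk p hp⟩)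
  -- If `v p` were positive, `ℓ` would be supported on `v`, and `v` would represent `ℓ`.
  · have hvp : v p = 0 := by
      by_contra h0
      refine hvl (hv.proportional h.link_mem (h.link_nonneg hsup) ?_ ⟨p, Or.inl rfl, hlp.ne'⟩).symm
      rintro i (rfl | hi) hi0
      exacts [(h0 hi0).elim, h.link_zero i hi]
    have hvE : IsExtremeOn W C₀ v := by
      refine ⟨hv.mem, fun i hi => hv.nonneg i (Or.inr hi), ?_, fun y hy hy0 hyv => ?_⟩
      · obtain ⟨i, rfl | hi, h0⟩ := hv.nonzero
        exacts [(h0 hvp).elim, ⟨i, hi, h0⟩]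
      -- Competitors on `C₀` can be normalised to vanish at `p` along `ℓ`, so extremality passes
      -- from `insert p C₀` back to `C₀`.
      · have hyp : (y - (y p / ℓ p) • ℓ) p = 0 := by
          simp [div_mul_cancel₀ _ hlp.ne']
        have hy' : ∀ i ∈ C₀, (y - (y p / ℓ p) • ℓ) i = y i := fun i hi => by
          simp [h.link_zero i hi]
        obtain ⟨a, ha⟩ := hv.minimal (y - (y p / ℓ p) • ℓ)
          (W.sub_mem hy (W.smul_mem _ h.link_mem)) (by
            rintro i (rfl | hi)
            exacts [hyp.ge, by rw [hy' i hi]; exact hy0 i hi]) (by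
            rintro i (rfl | hi) h0
            exacts [hyp, by rw [hy' i hi]; exact hyv i hi h0])
        exact ⟨a, fun i hi => by rw [← hy' i hi, ha i (Or.inr hi)]⟩
    obtain ⟨k, hk, hvk⟩ := h.list.complete v hvE hvq
    have hkv : ∀ i ∈ C₀, v i = 0 → k i = 0 := fun i hi h0 => hvk.symm.eq_zero hi h0
    have hkne := (h.list.extreme k hk).nonzero
    rcases (h.list_nonneg k hk p hp).eq_or_lt with hkp | hkp
    · have hmem : k ∈ (processPosition (C₀, K ++ [-ℓ]) p).2 :=
        mem_processPosition.2 (Or.inl ⟨List.mem_append_left _ hk, hkp.le⟩)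
      exact ⟨k, hmem, hnew.proportional_of_support hv hmem hkv (fun _ => hkp.symm) hkne⟩
    · have hmem : hyperplanePoint p k (-ℓ) ∈ (processPosition (C₀, K ++ [-ℓ]) p).2 := by
        refine mem_processPosition.2 (Or.inr ⟨k, List.mem_append_left _ hk, -ℓ, by simp, hkp,
          hnegp, ⟨hvq.quadCompatible (fun i hi => hkv i (h.quad_subset hi))
            fun i hi _ => hneg0 i (h.quad_subset hi), ?_⟩, rfl⟩)
        rintro ⟨z, hz, hzk, hzl, hzs⟩
        exact hzk (h.eq_of_support hk ((hcase z hz).resolve_right hzl) fun i hi h0 =>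
          hzs i hi h0 (hneg0 i hi))
      refine ⟨_, hmem, hnew.proportional_of_support hv hmem
        (fun i hi h0 => hyperplanePoint_eq_zero (hkv i hi h0) (hneg0 i hi))
        (fun _ => hyperplanePoint_self hkp hnegp) ?_⟩
      obtain ⟨i, hi, h0⟩ := hkne
      exact ⟨i, hi, fun h1 => h0 (eq_zero_of_hyperplanePoint_eq_zero hkp hnegp
        ((h.list.extreme k hk).nonneg i hi) (hneg0 i hi).ge h1).1⟩

theorem processPosition_foldl_fst (ps : List (StdCoord n))
    (s : Set (StdCoord n) × List (StdVec n)) :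
    (ps.foldl processPosition s).1 = s.1 ∪ {p | p ∈ ps} := by
  induction ps generalizing s with
  | nil => simp
  | cons p ps ih =>
    rw [List.foldl_cons, ih]
    ext i
    simp [processPosition]
    tauto

theorem IsPhaseList.foldl (h : IsPhaseStart W C₀ P ℓ K) {ps : List (StdCoord n)}
    (hps : ∀ p ∈ ps, p ∈ P) {s : Set (StdCoord n) × List (StdVec n)}
    (hL : IsPhaseList W C₀ P ℓ K s.1 s.2) :
    IsPhaseList W C₀ P ℓ K (ps.foldl processPosition s).1
      (ps.foldl processPosition s).2 := by
  induction ps generalizing s with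
  | nil => exact hL
  | cons p ps ih =>
    exact ih (fun q hq => hps q (List.mem_cons_of_mem _ hq))
      (hL.process h (hps p List.mem_cons_self))

/-- Processing all positions of a vertex and appending the vertex link. -/
theorem IsPhaseStart.isExtremeList (h : IsPhaseStart W C₀ P ℓ K) {ps : List (StdCoord n)}
    (hps : ∀ p, p ∈ ps ↔ p ∈ P) (hne : P.Nonempty) :
    IsExtremeList W (C₀ ∪ P) ((ps.foldl processPosition (C₀, K ++ [-ℓ])).2 ++ [ℓ]) := by
  have hL : IsPhaseList W C₀ P ℓ K (C₀ ∪ P)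
      (ps.foldl processPosition (C₀, K ++ [-ℓ])).2 := by
    have h1 : C₀ ∪ P = (ps.foldl processPosition (C₀, K ++ [-ℓ])).1 := by
      rw [processPosition_foldl_fst]
      ext i
      simp [hps]
    rw [h1]
    cases ps with
    | nil =>
      obtain ⟨p, hp⟩ := hne
      simpa using (hps p).2 hp
    | cons p ps =>
      exact (h.process ((hps p).1 List.mem_cons_self)).foldl h
        fun q hq => (hps q).1 (List.mem_cons_of_mem _ hq)
  have hlk := h.isExtremeOn_link hL.subset hL.subset_union hL.touched
  have hext : ∀ z ∈ (ps.foldl processPosition (C₀, K ++ [-ℓ])).2,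
      IsExtremeOn W (C₀ ∪ P) z := by
    intro z hz
    rcases hL.extreme_or_mem z hz with h1 | hk
    · exact h1.1
    · obtain ⟨i, hi, h0⟩ := h.list_zero z hk
      exact h.isExtremeOn_of_zero hL.subset hL.subset_union (h.list.extreme z hk)
        (hL.coneList.nonneg z hz) (Or.inr hi) hi h0
  have hnl : ∀ z ∈ (ps.foldl processPosition (C₀, K ++ [-ℓ])).2,
      ¬ Proportional (C₀ ∪ P) z ℓ := fun z hz => hL.not_proportional_of_isExtremeOn h hz
  refine ⟨?_, ?_, ?_, ?_, ?_⟩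
  · refine hL.coneList.nodup.append (List.nodup_singleton _) ?_
    intro z hz hz'
    rw [List.mem_singleton] at hz'
    subst hz'
    exact hnl _ hz (Proportional.refl _ _)
  · simp only [List.mem_append, List.mem_singleton]
    rintro z (hz | rfl)
    exacts [hext z hz, hlk]
  · simp only [List.mem_append, List.mem_singleton]
    rintro z (hz | rfl)
    · exact hL.coneList.quad z hz
    · intro i k k' hk
      exact (hk (h.link_zero _ (h.quad_subset (mem_quadPositions i k)))).elim
  · simp only [List.mem_append, List.mem_singleton]
    rintro z (hz | rfl) z' (hz' | rfl) hzz
    · exact hL.coneList.inj z hz z' hz' hzz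
    · exact (hnl z hz hzz).elim
    · exact (hnl z' hz' hzz.symm).elim
    · rfl
  · intro z hz hzq
    by_cases hzl : Proportional (C₀ ∪ P) z ℓ
    · exact ⟨ℓ, by simp, hzl⟩
    · obtain ⟨z', hz', hzz⟩ := hL.complete z hz hzq hzl
      exact ⟨z', List.mem_append_left _ hz', hzz⟩

end Phase

/-! ### Vertices of the projective solution space and extreme rays. -/

section ExtremePoints

variable {ι : Type*} [Fintype ι] {M : Submodule ℝ (ι → ℝ)}

theorem projImage_sum {x : ι → ℝ} (hx : ∑ i, x i ≠ 0) : ∑ i, projImage x i = 1 := by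
  simp [projImage, ← Finset.mul_sum, inv_mul_cancel₀ hx]

theorem IsExtremeOn.sum_pos {x : ι → ℝ} (hx : IsExtremeOn M Set.univ x) : 0 < ∑ i, x i := by
  obtain ⟨i, hi, h0⟩ := hx.nonzero
  exact Finset.sum_pos' (fun j _ => hx.nonneg j trivial)
    ⟨i, Finset.mem_univ i, (hx.nonneg i trivial).lt_of_ne' h0⟩

theorem proportional_projImage (C : Set ι) {x : ι → ℝ} (hx : 0 < ∑ i, x i) :
    Proportional C (projImage x) x :=
  ⟨_, inv_pos.2 hx, fun _ _ => rfl⟩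

theorem IsExtremeOn.projImage {x : ι → ℝ} (hx : IsExtremeOn M Set.univ x) :
    projImage x ∈ stdSimplex ℝ ι ∧ IsExtremeOn M Set.univ (projImage x) := by
  have h := hx.congr (M.smul_mem _ hx.mem) (proportional_projImage Set.univ hx.sum_pos)
  exact ⟨⟨fun i => h.nonneg i trivial, projImage_sum hx.sum_pos.ne'⟩, h⟩

theorem Proportional.eq_of_sum_eq_one {x y : ι → ℝ} (h : Proportional Set.univ x y)
    (hx : ∑ i, x i = 1) (hy : ∑ i, y i = 1) : x = y := by
  obtain ⟨a, -, ha⟩ := h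
  have h1 : ∑ i, x i = a * ∑ i, y i := by
    rw [Finset.mul_sum]
    exact Finset.sum_congr rfl fun i _ => ha i trivial
  rw [hx, hy, mul_one] at h1
  ext i
  rw [ha i trivial, ← h1, one_mul]

/-- The vertices of the intersection of the standard simplex with a linear subspace are its points
of minimal support. -/
theorem mem_extremePoints_stdSimplex_inter {x : ι → ℝ} :
    x ∈ Set.extremePoints ℝ {x | x ∈ stdSimplex ℝ ι ∧ x ∈ M} ↔
      x ∈ stdSimplex ℝ ι ∧ IsExtremeOn M Set.univ x := by
  constructor
  · rintro ⟨⟨hx, hxM⟩, hext⟩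
    have hx1 := hx.2
    refine ⟨hx, hxM, fun i _ => hx.1 i, ?_, fun y hy hy0 hyx => ?_⟩
    · by_contra hcon
      push Not at hcon
      rw [Finset.sum_eq_zero fun i _ => hcon i trivial] at hx1
      exact zero_ne_one hx1
    by_cases hne : ∃ i ∈ Set.univ, y i ≠ 0
    swap
    · push Not at hne
      exact ⟨0, fun i hi => by simp [hne i hi]⟩
    obtain ⟨t, ht, hpos, -⟩ := exists_max_smul_le (fun i _ => hx.1 i) hy0 hyx hne
    have hs : 0 < ∑ i, y i := by
      obtain ⟨i, -, hi⟩ := hne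
      exact Finset.sum_pos' (fun j _ => hy0 j trivial)
        ⟨i, Finset.mem_univ i, (hy0 i trivial).lt_of_ne' hi⟩
    have hsum : ∑ i, (x i - t * y i) = 1 - t * ∑ i, y i := by
      rw [Finset.sum_sub_distrib, hx1, Finset.mul_sum]
    have hle : 0 ≤ 1 - t * ∑ i, y i := hsum ▸ Finset.sum_nonneg fun i _ => hpos i trivial
    -- If nothing is left, `x = t • y`. Otherwise `x` is a proper convex combination of the
    -- normalisations of `y` and `x - t • y`, so extremality identifies it with the former.
    rcases hle.eq_or_lt with heq | hlt
    · rw [← hsum, eq_comm, Finset.sum_eq_zero_iff_of_nonneg fun i _ => hpos i trivial] at heq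
      refine ⟨t⁻¹, fun i _ => ?_⟩
      have := heq i (Finset.mem_univ i)
      rw [eq_inv_mul_iff_mul_eq₀ ht.ne']
      linarith
    · have hy' : projImage y ∈ {x | x ∈ stdSimplex ℝ ι ∧ x ∈ M} :=
        ⟨⟨fun i => mul_nonneg (inv_pos.2 hs).le (hy0 i trivial), projImage_sum hs.ne'⟩,
          M.smul_mem _ hy⟩
      have hz : (1 - t * ∑ i, y i)⁻¹ • (x - t • y) ∈ {x | x ∈ stdSimplex ℝ ι ∧ x ∈ M} := by
        refine ⟨⟨fun i => mul_nonneg (inv_pos.2 hlt).le (hpos i trivial), ?_⟩,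
          M.smul_mem _ (M.sub_mem hxM (M.smul_mem _ hy))⟩
        simp only [Pi.smul_apply, Pi.sub_apply, smul_eq_mul, ← Finset.mul_sum, hsum]
        exact inv_mul_cancel₀ hlt.ne'
      have heq : projImage y = x := by
        refine hext hy' hz ⟨t * ∑ i, y i, 1 - t * ∑ i, y i, mul_pos ht hs, hlt, by ring, ?_⟩
        ext i
        simp only [projImage, Pi.add_apply, Pi.smul_apply, Pi.sub_apply, smul_eq_mul]
        rw [mul_inv_cancel_left₀ hlt.ne', mul_assoc t, mul_inv_cancel_left₀ hs.ne']
        ring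
      refine ⟨∑ i, y i, fun i _ => ?_⟩
      rw [← heq]
      simp [projImage, mul_inv_cancel_left₀ hs.ne']
  · rintro ⟨hx, hE⟩
    refine ⟨⟨hx, hE.mem⟩, ?_⟩
    rintro y ⟨hy, hyM⟩ z ⟨hz, hzM⟩ ⟨a, b, ha, hb, hab, rfl⟩
    refine Proportional.eq_of_sum_eq_one (hE.proportional hyM (fun i _ => hy.1 i)
      (fun i _ h0 => ?_) ?_) hy.2 hx.2
    · simp only [Pi.add_apply, Pi.smul_apply, smul_eq_mul] at h0
      have h1 := mul_nonneg ha.le (hy.1 i)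
      have h2 := mul_nonneg hb.le (hz.1 i)
      exact (mul_eq_zero.1 (by linarith : a * y i = 0)).resolve_left ha.ne'
    · by_contra hcon
      push Not at hcon
      have := hy.2
      rw [Finset.sum_eq_zero fun i _ => hcon i trivial] at this
      exact zero_ne_one this

end ExtremePoints

section ExtremeLists

variable {n : ℕ} {W : Submodule ℝ (StdVec n)} {C : Set (StdCoord n)} {L : List (StdVec n)}

/-- Changes outside `C` are invisible to `IsExtremeList`. The intended map is
`partialCanonicalPart`, which alters only positions around the next vertex. -/
theorem IsExtremeList.map (hL : IsExtremeList W C L) (hC : quadPositions n ⊆ C)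
    {f : StdVec n → StdVec n} (hf : ∀ z ∈ L, f z ∈ W) (hfC : ∀ z, ∀ i ∈ C, f z i = z i) :
    IsExtremeList W C (L.map f) := by
  have hprop : ∀ z, Proportional C (f z) z := fun z =>
    ⟨1, one_pos, fun i hi => by rw [hfC z i hi, one_mul]⟩
  have hinj : ∀ z ∈ L, ∀ z' ∈ L, Proportional C (f z) (f z') → z = z' := fun z hz z' hz' h =>
    hL.inj z hz z' hz' (((hprop z).symm.trans h).trans (hprop z'))
  refine ⟨?_, ?_, ?_, ?_, ?_⟩
  · exact hL.nodup.map_on fun z hz z' hz' h =>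
      hinj z hz z' hz' (h ▸ Proportional.refl C _)
  · simp only [List.forall_mem_map]
    exact fun z hz => (hL.extreme z hz).congr (hf z hz) (hprop z)
  · simp only [List.forall_mem_map]
    exact fun z hz => (hL.quad z hz).of_support fun i hi h0 => by rw [hfC z i (hC hi), h0]
  · simp only [List.forall_mem_map]
    exact fun z hz z' hz' h => congrArg f (hinj z hz z' hz' h)
  · intro z hz hzq
    obtain ⟨z', hz', hzz⟩ := hL.complete z hz hzq
    exact ⟨f z', List.mem_map_of_mem hz', hzz.trans (hprop z').symm⟩

theorem IsExtremeList.nodup_map_projImage (hL : IsExtremeList W Set.univ L) :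
    (L.map projImage).Nodup :=
  hL.nodup.map_on fun z hz z' hz' h => hL.inj z hz z' hz'
    (((proportional_projImage _ (hL.extreme z hz).sum_pos).symm.trans
      (h ▸ Proportional.refl _ _)).trans (proportional_projImage _ (hL.extreme z' hz').sum_pos))

theorem IsExtremeList.mem_map_projImage (hL : IsExtremeList W Set.univ L) {v : StdVec n} :
    v ∈ L.map projImage ↔
      v ∈ Set.extremePoints ℝ {x | x ∈ stdSimplex ℝ (StdCoord n) ∧ x ∈ W} ∧
        QuadConstraints (quadProj v) := by
  rw [mem_extremePoints_stdSimplex_inter, List.mem_map]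
  constructor
  · rintro ⟨z, hz, rfl⟩
    exact ⟨(hL.extreme z hz).projImage, (hL.quad z hz).of_support fun i _ h0 =>
      (proportional_projImage Set.univ (hL.extreme z hz).sum_pos).eq_zero trivial h0⟩
  · rintro ⟨⟨hv, hvE⟩, hvq⟩
    obtain ⟨z, hz, hvz⟩ := hL.complete v hvE hvq
    have hs := (hL.extreme z hz).sum_pos
    exact ⟨z, hz, Proportional.eq_of_sum_eq_one
      ((proportional_projImage _ hs).trans hvz.symm) (projImage_sum hs.ne') hv.2⟩

end ExtremeLists

/-! ### Vertex links, canonical extensions, and induction over the vertices. -/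

namespace FaceGluing

variable {n : ℕ} (T : FaceGluing n)

theorem vertexLink_inl (V : T.Vertex) (i : Fin n) (v : Fin 4) [Decidable (Quot.mk _ (i, v) = V)] :
    T.vertexLink V (i, Sum.inl v) = if Quot.mk _ (i, v) = V then 1 else 0 := by
  simp only [vertexLink]
  congr

theorem vertexLink_inr (V : T.Vertex) (i : Fin n) (k : Fin 3) :
    T.vertexLink V (i, Sum.inr k) = 0 := rfl

theorem vertexLink_mk (i : Fin n) (v : Fin 4) :
    T.vertexLink (Quot.mk _ (i, v)) (i, Sum.inl v) = 1 := by
  classical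
  rw [vertexLink_inl, if_pos rfl]

theorem vertexLink_ne_zero {V : T.Vertex} {p : StdCoord n} :
    T.vertexLink V p ≠ 0 ↔ ∃ i v, p = (i, Sum.inl v) ∧ Quot.mk _ (i, v) = V := by
  classical
  obtain ⟨i, v | k⟩ := p
  · rw [vertexLink_inl]
    constructor
    · intro h
      exact ⟨i, v, rfl, by_contra fun h0 => h (if_neg h0)⟩
    · rintro ⟨i', v', h1, h2⟩
      simp only [Prod.mk.injEq, Sum.inl.injEq] at h1
      obtain ⟨rfl, rfl⟩ := h1
      rw [if_pos h2]
      exact one_ne_zero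
  · simp [vertexLink_inr]

theorem vertexLink_eq_one {V : T.Vertex} {p : StdCoord n} (h : T.vertexLink V p ≠ 0) :
    T.vertexLink V p = 1 := by
  obtain ⟨i, v, rfl, rfl⟩ := T.vertexLink_ne_zero.1 h
  exact T.vertexLink_mk i v

theorem mk_vertex_of_glue {i j : Fin n} {f v : Fin 4} {g : Equiv.Perm (Fin 4)}
    (hg : T.glue i f = some (j, g)) (hv : v ≠ f) :
    Quot.mk T.VertexIdent (j, g v) = Quot.mk T.VertexIdent (i, v) :=
  (Quot.sound ⟨f, g, hg, hv, rfl⟩).symm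

theorem vertexLink_mem (V : T.Vertex) : T.vertexLink V ∈ T.stdMatchingSubmodule := by
  classical
  intro i f j g hg v hv
  rw [vertexLink_inl, vertexLink_inl, T.mk_vertex_of_glue hg hv]
  rfl

/-- A solution of the standard matching equations without quadrilaterals is constant on each
vertex link. -/
theorem exists_eq_of_quadProj_eq_zero {w : StdVec n} (hw : T.StdMatching w)
    (hq : ∀ i k, w (i, Sum.inr k) = 0) :
    ∃ c : T.Vertex → ℝ, ∀ i v, w (i, Sum.inl v) = c (Quot.mk _ (i, v)) := by
  refine ⟨Quot.lift (fun c => w (c.1, Sum.inl c.2)) ?_, fun i v => rfl⟩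
  rintro ⟨i, v⟩ ⟨j, v'⟩ ⟨f, g, hg, hv, rfl⟩
  simpa [hq] using hw i f j g hg v hv

theorem exists_min_around (V : T.Vertex) (w : StdVec n) :
    ∃ i v, Quot.mk _ (i, v) = V ∧
      ∀ i' v', Quot.mk _ (i', v') = V → w (i, Sum.inl v) ≤ w (i', Sum.inl v') := by
  obtain ⟨c, hc⟩ := Quot.exists_rep V
  obtain ⟨⟨i, v⟩, hV, hmin⟩ := Set.exists_min_image {c | Quot.mk T.VertexIdent c = V}
    (fun c => w (c.1, Sum.inl c.2)) (Set.toFinite _) ⟨c, hc⟩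
  exact ⟨i, v, hV, fun i' v' h => hmin (i', v') h⟩

variable {T} in
theorem Canonical.exists_eq_zero {x : StdVec n} (hx : T.Canonical x) (V : T.Vertex) :
    ∃ i v, Quot.mk _ (i, v) = V ∧ x (i, Sum.inl v) = 0 := by
  classical
  obtain ⟨i, v, hV, hmin⟩ := T.exists_min_around V x
  refine ⟨i, v, hV, ?_⟩
  by_contra h0
  obtain ⟨i', v', hlt⟩ := hx.2 V _ ((hx.1 i v).lt_of_ne' h0)
  simp only [Pi.sub_apply, Pi.smul_apply, smul_eq_mul, vertexLink_inl] at hlt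
  split_ifs at hlt with h1
  · linarith [hmin i' v' h1]
  · linarith [hx.1 i' v']

-- The difference of two canonical extensions is constant around each vertex. Each has a zero there
-- while the other is non-negative, so the constant has both signs.
variable {T} in
theorem IsCanonicalExtension.unique {q : QuadVec n} {x y : StdVec n}
    (hx : T.IsCanonicalExtension q x) (hy : T.IsCanonicalExtension q y) : x = y := by
  have hq : ∀ i k, x (i, Sum.inr k) = y (i, Sum.inr k) := fun i k =>
    congrFun (hx.2.2.trans hy.2.2.symm) (i, k)
  obtain ⟨c, hc⟩ := T.exists_eq_of_quadProj_eq_zero (w := x - y)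
    (T.stdMatchingSubmodule.sub_mem hx.1.2.1 hy.1.2.1) fun i k => by simp [hq]
  have hc0 : ∀ V, c V = 0 := by
    intro V
    obtain ⟨i, v, hV, h0⟩ := hx.2.1.exists_eq_zero V
    obtain ⟨i', v', hV', h0'⟩ := hy.2.1.exists_eq_zero V
    have h1 := hc i v
    have h2 := hc i' v'
    rw [hV] at h1
    rw [hV'] at h2
    simp only [Pi.sub_apply, h0, h0'] at h1 h2
    linarith [hx.2.1.1 i' v', hy.2.1.1 i v]
  ext ⟨i, v | k⟩
  · have h1 := hc i v
    rw [hc0, Pi.sub_apply] at h1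
    linarith
  · exact hq i k

-- From any standard solution over `q`, subtract around each vertex the minimum of its triangle
-- coordinates there.
variable {T} in
theorem QuadMatching.existsUnique_canonicalExtension
    (hT : T.IsCompactThreeManifoldTriangulation) {q : QuadVec n} (hq : T.QuadMatching q)
    (hq0 : ∀ p, 0 ≤ q p) (hqc : QuadConstraints q) : ∃! x, T.IsCanonicalExtension q x := by
  classical
  obtain ⟨w, hw, rfl⟩ := hq.exists_stdMatching hT
  choose a b hab hmin using fun V => T.exists_min_around V w
  let x : StdVec n := fun p => Sum.elim
    (fun v => w (p.1, Sum.inl v) - w (a (Quot.mk _ (p.1, v)), Sum.inl (b (Quot.mk _ (p.1, v)))))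
    (fun k => w (p.1, Sum.inr k)) p.2
  have hxq : quadProj x = quadProj w := rfl
  have hx0 : ∀ i v, 0 ≤ x (i, Sum.inl v) := fun i v => sub_nonneg.2 (hmin _ i v rfl)
  suffices hx : T.IsCanonicalExtension (quadProj w) x from ⟨x, hx, fun y hy => hy.unique hx⟩
  refine ⟨⟨?_, ?_, hqc⟩, ⟨hx0, fun V ε hε => ⟨a V, b V, ?_⟩⟩, hxq⟩
  · rintro ⟨i, v | k⟩
    exacts [hx0 i v, hq0 (i, k)]
  · rw [stdMatching_iff_jump] at hw ⊢
    intro i f j g hg v hv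
    have h1 := hw i f j g hg v hv
    simp only [hxq, x, Sum.elim_inl, T.mk_vertex_of_glue hg hv, h1]
    ring
  · simp only [Pi.sub_apply, Pi.smul_apply, smul_eq_mul, vertexLink_inl, hab, if_true, x,
      Sum.elim_inl]
    linarith

theorem canonicalExtension_spec {q : QuadVec n} (h : ∃! x, T.IsCanonicalExtension q x) :
    T.IsCanonicalExtension q (T.canonicalExtension q) :=
  Classical.epsilon_spec h.exists

/-- Extreme rays of the standard cone modulo the triangle coordinates are the extreme rays of the
quadrilateral cone. -/
theorem isExtremeOn_quadPositions_iff (hT : T.IsCompactThreeManifoldTriangulation) {x : StdVec n}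
    (hx : x ∈ T.stdMatchingSubmodule) :
    IsExtremeOn T.stdMatchingSubmodule (quadPositions n) x ↔
      IsExtremeOn T.quadMatchingSubmodule Set.univ (quadProj x) := by
  constructor
  · intro h
    refine ⟨StdMatching.quadMatching hx, fun p _ => h.nonneg _ (mem_quadPositions _ _), ?_,
      fun y hy hy0 hyx => ?_⟩
    · obtain ⟨_, ⟨i, k, rfl⟩, h0⟩ := h.nonzero
      exact ⟨(i, k), trivial, h0⟩
    -- A competitor in quadrilateral coordinates is lifted to the standard solution space; signs of
    -- its triangle coordinates are irrelevant on `quadPositions`.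
    · obtain ⟨w, hw, rfl⟩ := QuadMatching.exists_stdMatching hT hy
      obtain ⟨a, ha⟩ := h.minimal w hw
        (by rintro _ ⟨i, k, rfl⟩; exact hy0 (i, k) trivial)
        (by rintro _ ⟨i, k, rfl⟩; exact hyx (i, k) trivial)
      exact ⟨a, fun p _ => ha _ (mem_quadPositions p.1 p.2)⟩
  · intro h
    refine ⟨hx, ?_, ?_, fun y hy hy0 hyx => ?_⟩
    · rintro _ ⟨i, k, rfl⟩
      exact h.nonneg (i, k) trivial
    · obtain ⟨p, -, h0⟩ := h.nonzero
      exact ⟨_, mem_quadPositions p.1 p.2, h0⟩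
    · obtain ⟨a, ha⟩ := h.minimal (quadProj y) (StdMatching.quadMatching hy)
        (fun p _ => hy0 _ (mem_quadPositions _ _))
        (fun p _ => hyx _ (mem_quadPositions _ _))
      refine ⟨a, ?_⟩
      rintro _ ⟨i, k, rfl⟩
      exact ha (i, k) trivial

theorem mem_quadSolutionSet_iff {q : QuadVec n} :
    q ∈ T.quadSolutionSet ↔ (q ∈ stdSimplex ℝ (QuadCoord n) ∧
      IsExtremeOn T.quadMatchingSubmodule Set.univ q) ∧ QuadConstraints q := by
  rw [← mem_extremePoints_stdSimplex_inter]
  rfl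

theorem existsUnique_canonicalExtension (hT : T.IsCompactThreeManifoldTriangulation)
    {q : QuadVec n} (hq : q ∈ T.quadSolutionSet) : ∃! x, T.IsCanonicalExtension q x := by
  obtain ⟨⟨h1, h2⟩, h3⟩ := T.mem_quadSolutionSet_iff.1 hq
  exact QuadMatching.existsUnique_canonicalExtension hT h2.mem h1.1 h3

/-- The initial list of the algorithm. -/
theorem isExtremeList_canonicalExtension (hT : T.IsCompactThreeManifoldTriangulation)
    {Q : List (QuadVec n)} (hQ_nodup : Q.Nodup) (hQ : ∀ q, q ∈ Q ↔ q ∈ T.quadSolutionSet) :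
    IsExtremeList T.stdMatchingSubmodule (quadPositions n) (Q.map T.canonicalExtension) := by
  have hspec : ∀ q ∈ Q, T.IsCanonicalExtension q (T.canonicalExtension q) := fun q hq =>
    T.canonicalExtension_spec (T.existsUnique_canonicalExtension hT ((hQ q).1 hq))
  have hproj : ∀ q ∈ Q, quadProj (T.canonicalExtension q) = q := fun q hq => (hspec q hq).2.2
  have hmem : ∀ q ∈ Q, T.canonicalExtension q ∈ T.stdMatchingSubmodule := fun q hq =>
    (hspec q hq).1.2.1
  have hQ' := fun q hq => T.mem_quadSolutionSet_iff.1 ((hQ q).1 hq)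
  have hpp : ∀ {x y : StdVec n}, Proportional (quadPositions n) x y →
      Proportional Set.univ (quadProj x) (quadProj y) := by
    rintro x y ⟨a, ha, h⟩
    exact ⟨a, ha, fun p _ => h _ (mem_quadPositions _ _)⟩
  refine ⟨?_, ?_, ?_, ?_, ?_⟩
  · refine hQ_nodup.map_on fun q hq q' hq' h => ?_
    rw [← hproj q hq, ← hproj q' hq', h]
  · simp only [List.forall_mem_map]
    intro q hq
    rw [T.isExtremeOn_quadPositions_iff hT (hmem q hq), hproj q hq]
    exact (hQ' q hq).1.2
  · simp only [List.forall_mem_map]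
    intro q hq
    exact (hspec q hq).1.2.2
  · simp only [List.forall_mem_map]
    intro q hq q' hq' h
    have h1 := hpp h
    rw [hproj q hq, hproj q' hq'] at h1
    rw [h1.eq_of_sum_eq_one (hQ' q hq).1.1.2 (hQ' q' hq').1.1.2]
  · intro z hz hzq
    rw [T.isExtremeOn_quadPositions_iff hT hz.mem] at hz
    have hs := proportional_projImage Set.univ hz.sum_pos
    have hmemQ : projImage (quadProj z) ∈ Q := by
      rw [hQ, mem_quadSolutionSet_iff]
      refine ⟨hz.projImage, fun i k k' hk hk' => hzq i k k' (fun h0 => hk ?_) fun h0 => hk' ?_⟩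
      · exact hs.eq_zero trivial h0
      · exact hs.eq_zero trivial h0
    refine ⟨_, List.mem_map_of_mem hmemQ, ?_⟩
    obtain ⟨a, ha, h⟩ := hs.symm
    refine ⟨a, ha, ?_⟩
    rintro _ ⟨i, k, rfl⟩
    have h1 := h (i, k) trivial
    rw [← hproj _ hmemQ] at h1
    exact h1

/-- The admissible multiples form the ray below the minimum of the triangle coordinates around `V`,
so the supremum is attained there and produces a zero. -/
theorem partialCanonicalPart_eq (V : T.Vertex) (w : StdVec n) :
    ∃ i v, Quot.mk _ (i, v) = V ∧
      (∀ i' v', Quot.mk _ (i', v') = V → w (i, Sum.inl v) ≤ w (i', Sum.inl v')) ∧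
      T.partialCanonicalPart V w = w - w (i, Sum.inl v) • T.vertexLink V := by
  obtain ⟨i, v, hV, hmin⟩ := T.exists_min_around V w
  refine ⟨i, v, hV, hmin, ?_⟩
  have : {l : ℝ | ∀ p, T.vertexLink V p ≠ 0 → 0 ≤ (w - l • T.vertexLink V) p} =
      Set.Iic (w (i, Sum.inl v)) := by
    ext l
    simp only [Set.mem_ofPred_eq, Set.mem_Iic, Pi.sub_apply, Pi.smul_apply, smul_eq_mul]
    constructor
    · intro h
      have := h (i, Sum.inl v) (T.vertexLink_ne_zero.2 ⟨i, v, rfl, hV⟩)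
      rw [← hV, vertexLink_mk] at this
      linarith
    · intro h p hp
      rw [T.vertexLink_eq_one hp]
      obtain ⟨i', v', rfl, hV'⟩ := T.vertexLink_ne_zero.1 hp
      linarith [hmin i' v' hV']
  rw [partialCanonicalPart, this, csSup_Iic]

/-- The coordinate positions that have been treated after processing the vertices in `Vs`. -/
def processedPositions (Vs : List T.Vertex) : Set (StdCoord n) :=
  quadPositions n ∪ {p | ∃ V ∈ Vs, T.vertexLink V p ≠ 0}

/-- The condition `null` holds because a solution without quadrilaterals is constant around each
vertex. Links of different vertices have disjoint supports, so the shift leaves processed positions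
untouched. -/
theorem isPhaseStart {Vs : List T.Vertex} {V : T.Vertex} (hV : V ∉ Vs) {L : List (StdVec n)}
    (hL : IsExtremeList T.stdMatchingSubmodule (T.processedPositions Vs) L) :
    IsPhaseStart T.stdMatchingSubmodule (T.processedPositions Vs) {p | T.vertexLink V p ≠ 0}
      (T.vertexLink V) (L.map (T.partialCanonicalPart V)) := by
  have hzero : ∀ i ∈ T.processedPositions Vs, T.vertexLink V i = 0 := by
    rintro p (⟨i, k, rfl⟩ | ⟨V', hV', hp⟩)
    · rfl
    · by_contra h
      obtain ⟨i, v, rfl, rfl⟩ := T.vertexLink_ne_zero.1 hp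
      obtain ⟨i', v', h1, rfl⟩ := T.vertexLink_ne_zero.1 h
      simp only [Prod.mk.injEq, Sum.inl.injEq] at h1
      obtain ⟨rfl, rfl⟩ := h1
      exact hV hV'
  refine ⟨Set.subset_union_left, T.vertexLink_mem V, hzero, fun p hp => ?_, fun x hx hx0 => ?_,
    hL.map Set.subset_union_left (fun z hz => ?_) fun z p hp => ?_, ?_, ?_⟩
  · rw [T.vertexLink_eq_one hp]
    exact one_pos
  · obtain ⟨c, hc⟩ := T.exists_eq_of_quadProj_eq_zero hx fun i k =>
      hx0 _ (Or.inl (mem_quadPositions i k))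
    refine ⟨c V, ?_⟩
    rintro p (hp | hp)
    · rw [hx0 p hp, hzero p hp, mul_zero]
    · rw [T.vertexLink_eq_one hp, mul_one]
      obtain ⟨i, v, rfl, rfl⟩ := T.vertexLink_ne_zero.1 hp
      exact hc i v
  · exact T.stdMatchingSubmodule.sub_mem (hL.extreme z hz).mem
      (T.stdMatchingSubmodule.smul_mem _ (T.vertexLink_mem V))
  · simp [partialCanonicalPart, hzero p hp]
  · simp only [List.forall_mem_map]
    intro z _ p hp
    obtain ⟨i, v, hv, hmin, h⟩ := T.partialCanonicalPart_eq V z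
    rw [h, Pi.sub_apply, Pi.smul_apply, T.vertexLink_eq_one hp, smul_eq_mul, mul_one]
    obtain ⟨i', v', rfl, hv'⟩ := T.vertexLink_ne_zero.1 hp
    exact sub_nonneg.2 (hmin i' v' hv')
  · simp only [List.forall_mem_map]
    intro z _
    obtain ⟨i, v, hv, -, h⟩ := T.partialCanonicalPart_eq V z
    have hp : T.vertexLink V (i, Sum.inl v) ≠ 0 := T.vertexLink_ne_zero.2 ⟨i, v, rfl, hv⟩
    exact ⟨_, hp, by rw [h, Pi.sub_apply, Pi.smul_apply, T.vertexLink_eq_one hp, smul_eq_mul,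
      mul_one, sub_self]⟩

/-- Induction from the end of `Vs`, since the last vertex is the last one folded in. Stating it for
every duplicate-free list covers all intermediate lists of the algorithm. -/
theorem quadToStd_spec (hT : T.IsCompactThreeManifoldTriangulation)
    {Q : List (QuadVec n)} (hQ_nodup : Q.Nodup) (hQ : ∀ q, q ∈ Q ↔ q ∈ T.quadSolutionSet)
    {pos : T.Vertex → List (StdCoord n)} (hpos : ∀ V p, p ∈ pos V ↔ T.vertexLink V p ≠ 0)
    (Vs : List T.Vertex) (hVs : Vs.Nodup) :
    (T.quadToStd Q pos Vs).1 = T.processedPositions Vs ∧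
      IsExtremeList T.stdMatchingSubmodule (T.processedPositions Vs)
        (T.quadToStd Q pos Vs).2 := by
  induction Vs using List.reverseRecOn with
  | nil =>
    have h : T.processedPositions [] = quadPositions n := by simp [processedPositions]
    rw [h]
    exact ⟨rfl, T.isExtremeList_canonicalExtension hT hQ_nodup hQ⟩
  | append_singleton Vs V ih =>
    rw [List.nodup_append_comm, List.singleton_append, List.nodup_cons] at hVs
    obtain ⟨h1, h2⟩ := ih hVs.2
    have hunion : T.processedPositions (Vs ++ [V]) =
        T.processedPositions Vs ∪ {p | T.vertexLink V p ≠ 0} := by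
      ext p
      simp only [processedPositions, List.mem_append, List.mem_singleton, Set.mem_union,
        Set.mem_ofPred_eq, or_and_right, exists_or, exists_eq_left, or_assoc]
    have hstep : T.quadToStd Q pos (Vs ++ [V]) =
        T.processVertex V (pos V) (T.quadToStd Q pos Vs) := by
      simp [quadToStd]
    have hne : {p | T.vertexLink V p ≠ 0}.Nonempty := by
      obtain ⟨⟨i, v⟩, hV⟩ := Quot.exists_rep V
      exact ⟨_, T.vertexLink_ne_zero.2 ⟨i, v, rfl, hV⟩⟩
    rw [hstep, hunion]
    simp only [processVertex, h1]
    refine ⟨?_, (T.isPhaseStart hVs.1 h2).isExtremeList (hpos V) hne⟩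
    rw [processPosition_foldl_fst]
    ext p
    simp [hpos]

end FaceGluing

/-- Correctness of the quadrilateral-to-standard conversion algorithm, for every enumeration `Q` of
the quadrilateral solution set, every ordering `Vs` of the vertices of the triangulation, and every
order `pos V` of processing the triangular positions around each vertex `V`. -/
theorem mainTheorem1 (n : ℕ) (T : FaceGluing n) (hT : T.IsCompactThreeManifoldTriangulation)
    (Q : List (QuadVec n)) (hQ_nodup : Q.Nodup) (hQ : ∀ q, q ∈ Q ↔ q ∈ T.quadSolutionSet)
    (Vs : List T.Vertex) (hVs_nodup : Vs.Nodup) (hVs : ∀ V, V ∈ Vs)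
    (pos : T.Vertex → List (StdCoord n)) (hpos_nodup : ∀ V, (pos V).Nodup)
    (hpos : ∀ V p, p ∈ pos V ↔ T.vertexLink V p ≠ 0) :
    -- the canonical extensions that form the initial list are well defined
    (∀ q ∈ Q, ∃! x, T.IsCanonicalExtension q x) ∧
    -- none of the successive lists contains a duplicate
    (∀ r ≤ Vs.length, (T.quadToStd Q pos (Vs.take r)).2.Nodup) ∧
    -- the set of coordinate positions finally consists of all positions
    (T.quadToStd Q pos Vs).1 = Set.univ ∧
    -- the projective images of the final list are exactly the standard solution set,
    -- each element occurring once
    ((T.quadToStd Q pos Vs).2.map projImage).Nodup ∧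
    ∀ v, v ∈ (T.quadToStd Q pos Vs).2.map projImage ↔ v ∈ T.stdSolutionSet := by
  have hspec := T.quadToStd_spec hT hQ_nodup hQ hpos
  have huniv : T.processedPositions Vs = Set.univ := by
    refine Set.eq_univ_of_forall ?_
    rintro ⟨i, v | k⟩
    · exact Or.inr ⟨_, hVs _, T.vertexLink_ne_zero.2 ⟨i, v, rfl, rfl⟩⟩
    · exact Or.inl (mem_quadPositions i k)
  obtain ⟨h1, h2⟩ := hspec Vs hVs_nodup
  rw [huniv] at h1 h2
  exact ⟨fun q hq => T.existsUnique_canonicalExtension hT ((hQ q).1 hq),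
    fun r _ => (hspec (Vs.take r) (hVs_nodup.sublist (List.take_sublist r Vs))).2.nodup, h1,
    h2.nodup_map_projImage, fun v => h2.mem_map_projImage⟩
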